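/- **Model of computation.** Complex numbers are treated as basic objects: a *word* is a finite sequence $x$ of complex numbers and its size $|x|$ is its length. A *program* works on finitely many stacks of complex numbers, has finitely many complex constants, and is built with sequencing, branching and while-loops from the primitive operations: push a constant, pop, copy a top element to another stack, the field operations $+,-,\times,/$ on top elements (division by $0$ gives $0$), tests whether a stack is empty or whether its top element is $0$, tossing a fair coin, and calling an oracle. Running time is the number of steps. A *counting problem* $P$ consists of instances, encoded injectively as words, and a value $P(x)\in\mathbb C$ for each instance $x$; $|x|$ denotes the size of its code. $P$ is *solvable in polynomial time* (is in $\mathrm{FP}_{\mathbb C}$) if a program without coin tosses and oracle calls outputs $P(x)$ exactly on each instance $x$, in a number of steps that is at most a polynomial in $|x|$. **Approximation.** For $\varepsilon\in(0,1)$, a number $w$ is a *$2^{\varepsilon}$-approximate solution* for $v\in\mathbb C$ if $w=0$ in case $v=0$, and $2^{-\varepsilon}\le|w/v|\le2^{\varepsilon}$ and $|\arg(w/v)|\le\varepsilon$ (with $\arg\in(-\pi,\pi]$) in case $v\neq0$. A *randomized approximation scheme* for $P$ is a randomized procedure that on each instance $x$ and each $\varepsilon\in(0,1)$ outputs a $2^{\varepsilon}$-approximate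 solution for $P(x)$ with probability at least $3/4$. $P$ is *AP-reducible* to $Q$ if there are a randomized oracle program $N$ with input $(x,\varepsilon)$ and polynomials $p,q$ such that, for every randomized approximation scheme $M$ for $Q$ (not necessarily polynomial-time or computable) used as oracle, whose answers are independent random outcomes of $M$: (i) $N$ is a randomized approximation scheme for $P$; (ii) each oracle call $(w,\delta)$ made by $N$ on $(x,\varepsilon)$ has $\delta\in(0,1)$ and $1/\delta\le q(|x|,1/\varepsilon)$; (iii) $N$ halts on $(x,\varepsilon)$ within $p(|x|,1/\varepsilon)$ steps. In (ii) and (iii), $x$ is any instance of $P$, $\varepsilon\in(0,1)$, and the bounds hold for all outcomes of the coin tosses and oracle answers. **Problems.** A *constraint* of arity $k\ge1$ is a function $f:\{0,1\}^k\to\mathbb C$. For a set $\mathcal G$ of constraints, an instance of $\#\mathrm{CSP}(\mathcal G)$ consists of Boolean variables $x_1,\dots,x_n$ and a finite list $\Omega$ of pairs $\langle h,(x_{i_1},\dots,x_{i_k})\rangle$ with $h\in\mathcal G$ of arity $k$ and $i_1,\dots,i_k\in\{1,\dots,n\}$ (repetitions allowed); its value is $$\sum_{\sigma:\{x_1,\dots,x_n\}\to\{0,1\}}\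 \prod_{\langle h,(x_{i_1},\dots,x_{i_k})\rangle\in\Omega}h(\sigma(x_{i_1}),\dots,\sigma(x_{i_k})).$$ In the encoding, $n$ is written in unary, each variable index and arity is one symbol, and each $h$ is given by the table of its $2^k$ values. $\#\mathrm{CSP}^*(\mathcal F)$ is $\#\mathrm{CSP}(\mathcal F\cup\mathcal U)$, where $\mathcal U$ is the set of all unary constraints. $\mathcal{ED}$ is the set of all constraints of the form $$f(x_1,\dots,x_k)=\prod_{i=1}^{\ell_1}h_i(x_{j_i})\cdot\prod_{i=1}^{\ell_2}g_i(x_{m_i},x_{n_i}),\qquad \ell_1,\ell_2\ge0,\ \ell_1+\ell_2\ge1,$$ with $j_i,m_i,n_i\in\{1,\dots,k\}$, where each $h_i$ is a unary constraint and each $g_i$ is the binary equality $EQ$ or disequality $XOR$. An instance of $\#\mathrm{SAT}_{\mathbb C}$ is a propositional formula $\phi$ over $\neg,\vee,\wedge$ with functions $w_x:\{0,1\}\to\mathbb C\setminus\{0\}$ for the variables $x\in V(\phi)$ that appear in $\phi$; its value is $\sum_{\sigma}\prod_{x\in V(\phi)}w_x(\sigma(x))$, where $\sigma$ ranges over the assignments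 $V(\phi)\to\{0,1\}$ that satisfy $\phi$. It is encoded by $\phi$ in prefix notation (each connective one symbol, each variable occurrence two symbols: a marker and its index), followed by each variable index with its two weights. **Theorem.** Let $\mathcal F$ be any set of complex-valued constraints. If $\mathcal F\subseteq\mathcal{ED}$, then $\#\mathrm{CSP}^*(\mathcal F)$ is solvable in polynomial time (is in $\mathrm{FP}_{\mathbb C}$). Otherwise, $\#\mathrm{SAT}_{\mathbb C}$ is AP-reducible to $\#\mathrm{CSP}^*(\mathcal F)$. -/

import Mathlib

namespace ComplexCSP

noncomputable section

/-! ### Machine model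

Complex numbers are basic objects. A word is a finite list of complex numbers, and its size is its
length. A program works on finitely many stacks of complex numbers (the stacks that it mentions);
the primitive operations are field operations, tests for zero or emptiness, pushes and pops, fair
coin flips, and oracle calls. One step of the machine performs at most one primitive operation. -/

/-- Field operations. Division by zero yields `0` (programs can test for it). -/
inductive ArithOp
  | plus
  | minus
  | times
  | over

/-- Meaning of a field operation. -/
def ArithOp.apply : ArithOp → ℂ → ℂ → ℂ
  | .plus, a, b => a + b
  | .minus, a, b => a - b
  | .times, a, b => a * b
  | .over, a, b => a / b

/-- The contents of the stacks; the head of a list is the top of the stack. -/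
abbrev Store := ℕ → List ℂ

/-- The top of stack `i`, read as `0` when the stack is empty. -/
def Store.top (s : Store) (i : ℕ) : ℂ := (s i).headD 0

/-- Push `a` onto stack `i`. -/
def Store.push (s : Store) (i : ℕ) (a : ℂ) : Store := Function.update s i (a :: s i)

/-- Remove the top of stack `i`, if there is one. -/
def Store.pop (s : Store) (i : ℕ) : Store := Function.update s i (s i).tail

/-- Conditions that a program may branch on. -/
inductive Test
  | nonempty (i : ℕ)
  | nonzero (i : ℕ)

/-- Truth of a condition. -/
def Test.Holds : Test → Store → Prop
  | .nonempty i, s => s i ≠ []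
  | .nonzero i, s => s.top i ≠ 0

/-- Programs. Every program contains finitely many complex constants and mentions finitely many
stacks. -/
inductive Prog
  | skip
  /-- Push the constant `a` onto stack `i`. -/
  | push (i : ℕ) (a : ℂ)
  /-- Pop stack `i`. -/
  | pop (i : ℕ)
  /-- Push the top of stack `i` onto stack `j`. -/
  | copy (i j : ℕ)
  /-- Push the result of the operation on the tops of stacks `i` and `j` onto stack `k`. -/
  | arith (op : ArithOp) (i j k : ℕ)
  /-- Push a uniformly random element of `{0, 1}` onto stack `i`. -/
  | flip (i : ℕ)
  /-- Call the oracle on the word in stack `i` with the top of stack `j` as error tolerance, and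
  push the answer onto stack `k`. -/
  | query (i j k : ℕ)
  | seq (p q : Prog)
  | ite (t : Test) (p q : Prog)
  | loop (t : Test) (p : Prog)

/-- A configuration: the programs that remain to be run, in this order, and the store. -/
structure Cfg where
  todo : List Prog
  store : Store

/-- What a configuration does next. -/
inductive Action
  | halt
  | next (c : Cfg)
  | coin (k : Bool → Cfg)
  | ask (w : List ℂ) (d : ℂ) (k : ℂ → Cfg)

open Classical in
/-- One step of the machine. -/
def Cfg.step : Cfg → Action
  | ⟨[], _⟩ => .halt
  | ⟨.skip :: r, s⟩ => .next ⟨r, s⟩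
  | ⟨.push i a :: r, s⟩ => .next ⟨r, s.push i a⟩
  | ⟨.pop i :: r, s⟩ => .next ⟨r, s.pop i⟩
  | ⟨.copy i j :: r, s⟩ => .next ⟨r, s.push j (s.top i)⟩
  | ⟨.arith op i j k :: r, s⟩ => .next ⟨r, s.push k (op.apply (s.top i) (s.top j))⟩
  | ⟨.flip i :: r, s⟩ => .coin fun b => ⟨r, s.push i (if b then 1 else 0)⟩
  | ⟨.query i j k :: r, s⟩ => .ask (s i) (s.top j) fun z => ⟨r, s.push k z⟩
  | ⟨.seq p q :: r, s⟩ => .next ⟨p :: q :: r, s⟩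
  | ⟨.ite t p q :: r, s⟩ => .next ⟨(if t.Holds s then p else q) :: r, s⟩
  | ⟨.loop t p :: r, s⟩ => .next ⟨if t.Holds s then p :: .loop t p :: r else r, s⟩

/-- The configuration has halted. -/
def Cfg.Halted (c : Cfg) : Prop := c.step = .halt

/-- The output of a configuration is the top of stack `0`. -/
def Cfg.output (c : Cfg) : ℂ := c.store.top 0

/-- Start of `p` on the word `w`, which is placed on stack `0`. -/
def Prog.start (p : Prog) (w : List ℂ) : Cfg :=
  ⟨[p], fun i => if i = 0 then w else []⟩

/-- Start of `p` on the word `w` (on stack `0`) and the error tolerance `ε` (on stack `1`). -/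
def Prog.startApprox (p : Prog) (w : List ℂ) (ε : ℝ) : Cfg :=
  ⟨[p], fun i => if i = 0 then w else if i = 1 then [(ε : ℂ)] else []⟩

/-- `DetReaches t c d`: exactly `t` steps, none of them a coin flip or an oracle call, lead from
`c` to `d`. -/
inductive DetReaches : ℕ → Cfg → Cfg → Prop
  | refl (c : Cfg) : DetReaches 0 c c
  | step {t : ℕ} {c c' d : Cfg} (h : c.step = .next c') (h' : DetReaches t c' d) :
      DetReaches (t + 1) c d

/-- A randomized procedure that maps a word and an error tolerance to a random complex number. -/
abbrev RandProc := List ℂ → ℝ → PMF ℂ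

/-- The random configuration after `t` steps with oracle `M` (halted configurations stay put).
Coin flips and oracle answers are independent of everything that happened before. -/
def run (M : RandProc) : ℕ → Cfg → PMF Cfg
  | 0, c => PMF.pure c
  | t + 1, c =>
    match c.step with
    | .halt => PMF.pure c
    | .next c' => run M t c'
    | .coin k => (PMF.uniformOfFintype Bool).bind fun b => run M t (k b)
    | .ask w d k => (M w d.re).bind fun z => run M t (k z)

/-! ### Counting problems, polynomial time, approximation, AP-reductions -/

/-- A complex-valued counting problem: instances, their representation as words, their values. -/
structure CountingProblem where
  Inst : Type
  code : Inst → List ℂ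
  code_injective : Function.Injective code
  value : Inst → ℂ

/-- Membership in `FP_ℂ`: the problem is solved exactly by a deterministic program whose number of
steps is polynomial in the size of the input. -/
def CountingProblem.PolyTime (P : CountingProblem) : Prop :=
  ∃ (p : Prog) (b : Polynomial ℕ), ∀ x : P.Inst, ∃ t ≤ b.eval (P.code x).length, ∃ c : Cfg,
    DetReaches t (p.start (P.code x)) c ∧ c.Halted ∧ c.output = P.value x

/-- `w` is a `2 ^ ε`-approximate solution for the value `v`. -/
def IsApprox (ε : ℝ) (w v : ℂ) : Prop :=
  (v = 0 → w = 0) ∧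
  (v ≠ 0 → (2 : ℝ) ^ (-ε) ≤ ‖w / v‖ ∧ ‖w / v‖ ≤ (2 : ℝ) ^ ε ∧ |(w / v).arg| ≤ ε)

/-- `A` is a randomized approximation scheme for `P`. -/
def IsRAS (P : CountingProblem) (A : RandProc) : Prop :=
  ∀ (x : P.Inst) (ε : ℝ), 0 < ε → ε < 1 →
    3 / 4 ≤ (A (P.code x) ε).toOuterMeasure {w | IsApprox ε w (P.value x)}

/-- The value of a bivariate polynomial at `(|w|, 1 / ε)`. -/
def polyAt (b : MvPolynomial (Fin 2) ℝ) (w : List ℂ) (ε : ℝ) : ℝ :=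
  MvPolynomial.eval ![(w.length : ℝ), 1 / ε] b

/-- The random output of `p` with oracle `M` after `⌊b (|w|, 1 / ε)⌋` steps on input `(w, ε)`. -/
def Prog.outcome (p : Prog) (b : MvPolynomial (Fin 2) ℝ) (M : RandProc) : RandProc :=
  fun w ε => (run M ⌊polyAt b w ε⌋₊ (p.startApprox w ε)).map Cfg.output

/-- `P` is AP-reducible to `Q`: there is a randomized oracle program `p` such that for every
randomized approximation scheme `M` for `Q`, used as oracle,
(1) `p` is a randomized approximation scheme for `P`;
(2) each oracle call made by `p` on input `(x, ε)`, along any random choices, has an error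
tolerance `δ ∈ (0, 1)` with `1 / δ ≤ q (|x|, 1 / ε)`;
(3) `p` halts within `b (|x|, 1 / ε)` steps, along any random choices.
The polynomials `q` and `b` depend on nothing but `p`. -/
def APReducible (P Q : CountingProblem) : Prop :=
  ∃ (p : Prog) (q b : MvPolynomial (Fin 2) ℝ), ∀ M : RandProc, IsRAS Q M →
    IsRAS P (p.outcome b M) ∧
    ∀ (x : P.Inst) (ε : ℝ), 0 < ε → ε < 1 →
      (∀ (t : ℕ) (c : Cfg) (w : List ℂ) (d : ℂ) (k : ℂ → Cfg),
        c ∈ (run M t (p.startApprox (P.code x) ε)).support → c.step = .ask w d k →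
        ∃ δ : ℝ, d = (δ : ℂ) ∧ 0 < δ ∧ δ < 1 ∧ 1 / δ ≤ polyAt q (P.code x) ε) ∧
      (∃ T : ℕ, (T : ℝ) ≤ polyAt b (P.code x) ε ∧
        ∀ c ∈ (run M T (p.startApprox (P.code x) ε)).support, c.Halted)

/-! ### Constraints -/

/-- Complex-valued constraints on Boolean variables, of arity at least one. -/
structure Constraint where
  arity : ℕ
  arity_pos : 1 ≤ arity
  val : (Fin arity → Bool) → ℂ

/-- The set of all unary constraints. -/
def unaryConstraints : Set Constraint := {f | f.arity = 1}

/-- Binary equality. -/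
def binEQ (a b : Bool) : ℂ := if a = b then 1 else 0

/-- Binary disequality. -/
def binXOR (a b : Bool) : ℂ := if a = b then 0 else 1

/-- Products of unary constraints, equalities and disequalities. -/
def ED : Set Constraint :=
  {f | ∃ (l₁ l₂ : ℕ) (h : Fin l₁ → Bool → ℂ) (j : Fin l₁ → Fin f.arity)
      (g : Fin l₂ → Bool → Bool → ℂ) (m n : Fin l₂ → Fin f.arity),
      1 ≤ l₁ + l₂ ∧ (∀ i, g i = binEQ ∨ g i = binXOR) ∧
      ∀ x, f.val x = (∏ i, h i (x (j i))) * ∏ i, g i (x (m i)) (x (n i))}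

/-! ### Counting CSPs -/

/-- A constraint applied to a tuple of variables among `x_0, …, x_{n-1}` (repetitions allowed). -/
structure Application (n : ℕ) where
  con : Constraint
  scope : Fin con.arity → Fin n

/-- An instance: the number of variables, and a finite list of applied constraints from `F`. -/
structure CSPInst (F : Set Constraint) where
  n : ℕ
  apps : List (Application n)
  mem : ∀ a ∈ apps, a.con ∈ F

/-- The sum over all variable assignments of the product of all constraint values. -/
def CSPInst.value {F : Set Constraint} (I : CSPInst F) : ℂ :=
  ∑ σ : Fin I.n → Bool, (I.apps.map fun a => a.con.val fun i => σ (a.scope i)).prod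

/-- The `2 ^ k` values of a `k`-ary function in lexicographic order of the arguments. -/
def table : (k : ℕ) → ((Fin k → Bool) → ℂ) → List ℂ
  | 0, f => [f Fin.elim0]
  | k + 1, f => table k (fun x => f (Fin.cons false x)) ++ table k (fun x => f (Fin.cons true x))

/-- The arity, the indices of the variables, and the table of values. -/
def Application.code {n : ℕ} (a : Application n) : List ℂ :=
  (a.con.arity : ℂ) :: (List.ofFn (fun i => ((a.scope i : ℕ) : ℂ)) ++ table a.con.arity a.con.val)

/-- The number of variables in unary, followed by the codes of the applied constraints. -/
def CSPInst.code {F : Set Constraint} (I : CSPInst F) : List ℂ :=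
  List.replicate I.n 1 ++ 0 :: I.apps.flatMap Application.code

theorem table_length (k : ℕ) (f : (Fin k → Bool) → ℂ) : (table k f).length = 2 ^ k := by
  induction k with
  | zero => rfl
  | succ k ih => simp [table, ih, pow_succ, mul_two]

theorem table_injective (k : ℕ) : Function.Injective (table k) := by
  induction k with
  | zero =>
    intro f g h
    funext x
    rw [Subsingleton.elim x Fin.elim0]
    simpa [table] using h
  | succ k ih =>
    intro f g h
    obtain ⟨h0, h1⟩ := List.append_inj h (by simp [table_length])
    funext x
    rw [← Fin.cons_self_tail x]
    cases x 0
    · exact congrFun (ih h0) (Fin.tail x)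
    · exact congrFun (ih h1) (Fin.tail x)

theorem Application.code_append_inj {n : ℕ} (a b : Application n) (l l' : List ℂ)
    (h : a.code ++ l = b.code ++ l') : a = b ∧ l = l' := by
  obtain ⟨⟨k, hk, f⟩, s⟩ := a
  obtain ⟨⟨k', hk', f'⟩, s'⟩ := b
  simp only [Application.code, List.cons_append, List.cons.injEq, Nat.cast_inj,
    List.append_assoc] at h
  obtain ⟨rfl, h⟩ := h
  obtain ⟨h1, h⟩ := List.append_inj h (by simp)
  obtain ⟨h2, h3⟩ := List.append_inj h (by simp [table_length])
  have hf := table_injective k h2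
  subst hf
  have hs : s = s' := by
    funext i
    have := congrFun (List.ofFn_injective h1) i
    exact Fin.ext (by exact_mod_cast this)
  subst hs
  exact ⟨rfl, h3⟩

theorem replicate_one_append_inj (n m : ℕ) (l l' : List ℂ)
    (h : List.replicate n (1 : ℂ) ++ 0 :: l = List.replicate m 1 ++ 0 :: l') : n = m ∧ l = l' := by
  induction n generalizing m with
  | zero =>
    cases m with
    | zero => simpa using h
    | succ m => simp [List.replicate_succ] at h
  | succ n ih =>
    cases m with
    | zero => simp [List.replicate_succ] at h
    | succ m =>
      simp only [List.replicate_succ, List.cons_append, List.cons.injEq, true_and] at h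
      obtain ⟨h1, h2⟩ := ih m h
      exact ⟨congrArg _ h1, h2⟩

theorem flatMap_code_injective {n : ℕ} :
    Function.Injective fun l : List (Application n) => l.flatMap Application.code := by
  intro l l' h
  induction l generalizing l' with
  | nil =>
    cases l' with
    | nil => rfl
    | cons b l' => simp [Application.code] at h
  | cons a l ih =>
    cases l' with
    | nil => simp [Application.code] at h
    | cons b l' =>
      simp only [List.flatMap_cons] at h
      obtain ⟨h1, h2⟩ := Application.code_append_inj a b _ _ h
      rw [h1, ih h2]

theorem CSPInst.code_injective (F : Set Constraint) :
    Function.Injective (CSPInst.code (F := F)) := by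
  rintro ⟨n, l, hl⟩ ⟨m, l', hl'⟩ h
  obtain ⟨h1, h2⟩ := replicate_one_append_inj _ _ _ _ h
  dsimp only at h1 h2
  subst h1
  have := flatMap_code_injective h2
  subst this
  rfl

/-- The problem `#CSP(F)`. -/
def CSP (F : Set Constraint) : CountingProblem where
  Inst := CSPInst F
  code := CSPInst.code
  code_injective := CSPInst.code_injective F
  value := CSPInst.value

/-- The problem `#CSP*(F)`, in which all unary constraints are freely available. -/
def CSPStar (F : Set Constraint) : CountingProblem := CSP (F ∪ unaryConstraints)

/-! ### Weighted satisfiability -/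

/-- Propositional formulas with negation, disjunction and conjunction. -/
inductive Formula
  | var (i : ℕ)
  | neg (φ : Formula)
  | disj (φ ψ : Formula)
  | conj (φ ψ : Formula)

/-- The variables that appear in a formula. -/
def Formula.vars : Formula → Finset ℕ
  | .var i => {i}
  | .neg φ => φ.vars
  | .disj φ ψ => φ.vars ∪ ψ.vars
  | .conj φ ψ => φ.vars ∪ ψ.vars

/-- Truth value under an assignment. -/
def Formula.eval (σ : ℕ → Bool) : Formula → Bool
  | .var i => σ i
  | .neg φ => !(φ.eval σ)
  | .disj φ ψ => φ.eval σ || ψ.eval σ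
  | .conj φ ψ => φ.eval σ && ψ.eval σ

/-- Prefix notation. -/
def Formula.code : Formula → List ℂ
  | .var i => [0, (i : ℂ)]
  | .neg φ => 1 :: φ.code
  | .disj φ ψ => 2 :: (φ.code ++ ψ.code)
  | .conj φ ψ => 3 :: (φ.code ++ ψ.code)

/-- A formula with nonzero weights for the two values of each variable that appears in it. -/
structure SATInst where
  formula : Formula
  weight : formula.vars → Bool → ℂ
  weight_ne_zero : ∀ x b, weight x b ≠ 0

/-- An assignment of the variables of a formula, extended by `false` elsewhere. -/
def extend {V : Finset ℕ} (σ : V → Bool) (i : ℕ) : Bool :=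
  if h : i ∈ V then σ ⟨i, h⟩ else false

/-- The sum of the weights of all satisfying assignments. -/
def SATInst.value (I : SATInst) : ℂ :=
  ∑ σ : I.formula.vars → Bool,
    if I.formula.eval (extend σ) = true then ∏ x, I.weight x (σ x) else 0

/-- The formula in prefix notation, followed by each of its variables with its two weights, in
increasing order. -/
def SATInst.code (I : SATInst) : List ℂ :=
  I.formula.code ++ ((Finset.univ : Finset I.formula.vars).sort (· ≤ ·)).flatMap
    fun x : I.formula.vars => [((x : ℕ) : ℂ), I.weight x false, I.weight x true]

theorem Formula.code_append_inj (φ ψ : Formula) (l l' : List ℂ)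
    (h : φ.code ++ l = ψ.code ++ l') : φ = ψ ∧ l = l' := by
  induction φ generalizing ψ l l' with
  | var i =>
    cases ψ <;> simp [Formula.code] at h ⊢
    exact h
  | neg φ ih =>
    cases ψ <;> simp [Formula.code] at h ⊢
    exact ih _ _ _ h
  | disj φ χ ih1 ih2 =>
    cases ψ <;> simp [Formula.code] at h ⊢
    obtain ⟨h1, h2⟩ := ih1 _ _ _ h
    obtain ⟨h3, h4⟩ := ih2 _ _ _ h2
    exact ⟨⟨h1, h3⟩, h4⟩
  | conj φ χ ih1 ih2 =>
    cases ψ <;> simp [Formula.code] at h ⊢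
    obtain ⟨h1, h2⟩ := ih1 _ _ _ h
    obtain ⟨h3, h4⟩ := ih2 _ _ _ h2
    exact ⟨⟨h1, h3⟩, h4⟩

theorem flatMap_weight_inj {α : Type} (e : α → ℂ) (l : List α) (v w : α → Bool → ℂ)
    (h : (l.flatMap fun x => [e x, v x false, v x true])
      = l.flatMap fun x => [e x, w x false, w x true]) : ∀ x ∈ l, v x = w x := by
  induction l with
  | nil => simp
  | cons a l ih =>
    simp only [List.flatMap_cons, List.cons_append, List.nil_append, List.cons.injEq,
      true_and] at h
    intro x hx
    rcases List.mem_cons.1 hx with rfl | hx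
    · funext b
      cases b
      · exact h.1
      · exact h.2.1
    · exact ih h.2.2 x hx

theorem SATInst.code_injective : Function.Injective SATInst.code := by
  rintro ⟨φ, v, hv⟩ ⟨ψ, w, hw⟩ h
  obtain ⟨h1, h2⟩ := Formula.code_append_inj _ _ _ _ h
  dsimp only at h1 h2
  subst h1
  have : v = w := by
    funext x
    exact flatMap_weight_inj _ _ v w h2 x (by simp)
  subst this
  rfl

/-- The problem `#SAT_ℂ`. -/
def SATC : CountingProblem where
  Inst := SATInst
  code := SATInst.code
  code_injective := SATInst.code_injective
  value := SATInst.value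

end

end ComplexCSP

/-! Hardness. Let `f` lie outside `ED`. Unary constraints are free, so any argument of `f` can be
contracted with any vector, and contracting all arguments but `i` and `j` leaves a 2×2 matrix
`pairMatrix f i j v`. It is `Hard` if it is nonsingular and supported neither on the diagonal nor
off it. If no contraction is hard, then `f ∈ ED` (`mem_ED_of_not_hard`). Indeed, determinant and
entries are polynomials in `v`, and a product of nonzero polynomials over ℂ is nonzero; so for each
pair either the determinant, or the off-diagonal part, or the diagonal part vanishes identically
(`pairMatrix_trichotomy`). In the last two cases the two arguments are tied by an equality or a
disequality on the support of `f`. Between representatives of the classes of tied arguments all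
determinants vanish identically, and this makes `f` a rank-one tensor in them
(`contract_piecewise`).

So some contraction `M` is hard. Scalings and products `M D Mᵀ` with `D` diagonal turn it into
binary OR (`RealizesBin.or_of_hard`). A bit with weights 1 and -1 turns OR into a NAND gate
(`RealizesGate.nand`), and NAND yields all connectives. A formula becomes a circuit whose internal
wires have exactly one consistent assignment, so weighted counts are preserved exactly
(`SATInst.bsum_emit`). A deterministic quadratic-time program writes this instance, and one oracle
call with the original tolerance completes the AP-reduction (`apReducible_of_transform`).

Tractability. A constraint in `ED` is given only by its table, and the machine can only test numbers
for zero. The factors are recovered argument by argument: the first bit is either independent of the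
others or determined by one of them (`Splits.untied_or_tied`), and in both cases `f` is a function
of the other bits times a weighted `Tie` on at most two variables (`firstTie_spec`). If no row of
the table leaves the first bit free, each row assigns it a sign, or none if both values vanish. With
`N` signed rows, the correlation of the signs with another bit is `N` or `-N` exactly if that bit
agrees, up to a common sign, with all of them; hence equality tests suffice to find a partner.

The resulting product of ties is summed over one variable at a time (`collected_spec`). A variable
tied to another one is substituted; otherwise its weights multiply to `P + Q s` with `s = ±1`, and
the sum is `2 P`. Since the input contains the table with its `2 ^ k` values, time exponential in
the arity is harmless. -/

namespace ComplexCSP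

noncomputable section

/-! ### Reachability with time bounds -/

theorem DetReaches.trans {t u : ℕ} {c d e : Cfg} (h : DetReaches t c d) (h' : DetReaches u d e) :
    DetReaches (t + u) c e := by
  induction h with
  | refl c => simpa using h'
  | step h1 _ ih =>
    have := DetReaches.step h1 (ih h')
    rwa [Nat.add_right_comm] at this

/-- At most `T` deterministic steps lead from `c` to `d`. -/
def Reach (T : ℕ) (c d : Cfg) : Prop := ∃ t ≤ T, DetReaches t c d

theorem Reach.mono {T T' : ℕ} {c d : Cfg} (h : Reach T c d) (hT : T ≤ T') : Reach T' c d :=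
  let ⟨t, ht, h⟩ := h
  ⟨t, ht.trans hT, h⟩

theorem Reach.trans {T T' : ℕ} {c d e : Cfg} (h : Reach T c d) (h' : Reach T' d e) :
    Reach (T + T') c e :=
  let ⟨t, ht, h⟩ := h
  let ⟨u, hu, h'⟩ := h'
  ⟨t + u, add_le_add ht hu, h.trans h'⟩

theorem Reach.single {c d : Cfg} (h : c.step = .next d) : Reach 1 c d :=
  ⟨1, le_rfl, .step h (.refl d)⟩

/-- The program `p` turns the store `s` into `s'` in at most `T` steps. -/
def Runs (p : Prog) (T : ℕ) (s s' : Store) : Prop := ∀ r, Reach T ⟨p :: r, s⟩ ⟨r, s'⟩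

theorem Runs.mono {p : Prog} {T T' : ℕ} {s s' : Store} (h : Runs p T s s') (hT : T ≤ T') :
    Runs p T' s s' := fun r => (h r).mono hT

theorem Runs.seq {p q : Prog} {T T' : ℕ} {s s' s'' : Store} (h : Runs p T s s')
    (h' : Runs q T' s' s'') : Runs (.seq p q) (1 + T + T') s s'' := fun r =>
  ((Reach.single (by rfl)).trans (h (q :: r))).trans (h' r)

theorem Runs.loop_stop {t : Test} {p : Prog} {s : Store} (h : ¬ t.Holds s) :
    Runs (.loop t p) 1 s s := fun r => Reach.single (by simp [Cfg.step, h])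

/-- One or more rounds of a loop. -/
def LoopReach (t : Test) (p : Prog) (T : ℕ) (s s' : Store) : Prop :=
  ∀ r, Reach T ⟨.loop t p :: r, s⟩ ⟨.loop t p :: r, s'⟩

theorem LoopReach.mono {t : Test} {p : Prog} {T T' : ℕ} {s s' : Store} (h : LoopReach t p T s s')
    (hT : T ≤ T') : LoopReach t p T' s s' := fun r => (h r).mono hT

theorem LoopReach.trans {t : Test} {p : Prog} {T T' : ℕ} {s s' s'' : Store}
    (h : LoopReach t p T s s') (h' : LoopReach t p T' s' s'') : LoopReach t p (T + T') s s'' :=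
  fun r => (h r).trans (h' r)

theorem LoopReach.once {t : Test} {p : Prog} {T : ℕ} {s s' : Store} (h : t.Holds s)
    (hp : Runs p T s s') : LoopReach t p (1 + T) s s' := fun r =>
  (Reach.single (by simp [Cfg.step, h])).trans (hp (.loop t p :: r))

theorem LoopReach.finish {t : Test} {p : Prog} {T : ℕ} {s s' : Store} (h : LoopReach t p T s s')
    (hs : ¬ t.Holds s') : Runs (.loop t p) (T + 1) s s' := fun r =>
  (h r).trans (Runs.loop_stop hs r)

theorem Runs.loop_go {t : Test} {p : Prog} {T T' : ℕ} {s s' s'' : Store} (h : t.Holds s)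
    (hp : Runs p T s s') (h' : Runs (.loop t p) T' s' s'') :
    Runs (.loop t p) (1 + T + T') s s'' := fun r =>
  (LoopReach.once h hp r).trans (h' r)

/-! ### Programs without loops -/

open Classical in
/-- The effect of a program without loops, coin flips and queries. -/
def Prog.exec : Prog → Store → Store
  | .push i a, s => s.push i a
  | .pop i, s => s.pop i
  | .copy i j, s => s.push j (s.top i)
  | .arith op i j k, s => s.push k (op.apply (s.top i) (s.top j))
  | .seq p q, s => q.exec (p.exec s)
  | .ite t p q, s => if t.Holds s then p.exec s else q.exec s
  | _, s => s

/-- The program has no loops, coin flips and queries. -/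
def Prog.loopFree : Prog → Bool
  | .flip _ | .query _ _ _ | .loop _ _ => false
  | .seq p q | .ite _ p q => p.loopFree && q.loopFree
  | _ => true

/-- A bound for the number of steps of a program without loops. -/
def Prog.cost : Prog → ℕ
  | .seq p q => 1 + p.cost + q.cost
  | .ite _ p q => 1 + (p.cost + q.cost)
  | _ => 1

/-- Loop-free code is verified by evaluating `exec` with `simp`; only loops then need invariants and
inductions. -/
theorem runs_exec (p : Prog) (hp : p.loopFree = true) (s : Store) : Runs p p.cost s (p.exec s) := by
  induction p generalizing s with
  | skip | push | pop | copy | arith => exact fun r => Reach.single rfl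
  | flip | query | loop => simp [Prog.loopFree] at hp
  | seq p q ihp ihq =>
    simp only [Prog.loopFree, Bool.and_eq_true] at hp
    exact (ihp hp.1 s).seq (ihq hp.2 _)
  | ite t p q ihp ihq =>
    simp only [Prog.loopFree, Bool.and_eq_true] at hp
    intro r
    by_cases h : t.Holds s
    · simp only [Prog.exec, Prog.cost, h, if_true]
      exact (Reach.single (by simp [Cfg.step, h])).trans ((ihp hp.1 s).mono (by omega) r)
    · simp only [Prog.exec, Prog.cost, h, if_false]
      exact (Reach.single (by simp [Cfg.step, h])).trans ((ihq hp.2 s).mono (by omega) r)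

/-- Sequential composition. -/
def Prog.block : List Prog → Prog
  | [] => .skip
  | p :: l => .seq p (block l)

theorem Runs.nil (s : Store) : Runs (.block []) 1 s s := fun _ => Reach.single rfl

theorem Runs.cons {p : Prog} {l : List Prog} {T T' : ℕ} {s s' s'' : Store} (h : Runs p T s s')
    (h' : Runs (.block l) T' s' s'') : Runs (.block (p :: l)) (1 + T + T') s s'' := h.seq h'

@[simp] theorem Prog.exec_block_nil (s : Store) : (Prog.block []).exec s = s := rfl

@[simp] theorem Prog.exec_block_cons (p : Prog) (l : List Prog) (s : Store) :
    (Prog.block (p :: l)).exec s = (Prog.block l).exec (p.exec s) := rfl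

@[simp] theorem Prog.exec_push (i : ℕ) (a : ℂ) (s : Store) :
    (Prog.push i a).exec s = s.push i a := rfl

@[simp] theorem Prog.exec_pop (i : ℕ) (s : Store) : (Prog.pop i).exec s = s.pop i := rfl

@[simp] theorem Prog.exec_copy (i j : ℕ) (s : Store) :
    (Prog.copy i j).exec s = s.push j (s.top i) := rfl

@[simp] theorem Prog.exec_arith (op : ArithOp) (i j k : ℕ) (s : Store) :
    (Prog.arith op i j k).exec s = s.push k (op.apply (s.top i) (s.top j)) := rfl

@[simp] theorem Prog.exec_skip (s : Store) : Prog.skip.exec s = s := rfl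

theorem Prog.exec_ite_pos {t : Test} {p q : Prog} {s : Store} (h : t.Holds s) :
    (Prog.ite t p q).exec s = p.exec s := by simp [Prog.exec, h]

theorem Prog.exec_ite_neg {t : Test} {p q : Prog} {s : Store} (h : ¬ t.Holds s) :
    (Prog.ite t p q).exec s = q.exec s := by simp [Prog.exec, h]

open Classical in
@[simp] theorem Prog.exec_ite_nonzero (i : ℕ) (p q : Prog) (s : Store) :
    (Prog.ite (.nonzero i) p q).exec s = if s.top i = 0 then q.exec s else p.exec s := by
  by_cases h : s.top i = 0 <;> simp [Prog.exec, Test.Holds, h]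

@[simp] theorem ArithOp.apply_plus (a b : ℂ) : ArithOp.plus.apply a b = a + b := rfl
@[simp] theorem ArithOp.apply_minus (a b : ℂ) : ArithOp.minus.apply a b = a - b := rfl
@[simp] theorem ArithOp.apply_times (a b : ℂ) : ArithOp.times.apply a b = a * b := rfl
@[simp] theorem ArithOp.apply_over (a b : ℂ) : ArithOp.over.apply a b = a / b := rfl

@[simp] theorem Store.push_apply (s : Store) (i j : ℕ) (a : ℂ) :
    s.push i a j = if j = i then a :: s i else s j := by
  simp [Store.push, Function.update_apply]

@[simp] theorem Store.top_push (s : Store) (i j : ℕ) (a : ℂ) :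
    (s.push i a).top j = if j = i then a else s.top j := by
  by_cases h : j = i <;> simp [Store.top, h]

@[simp] theorem Store.pop_apply (s : Store) (i j : ℕ) :
    s.pop i j = if j = i then (s i).tail else s j := by
  simp [Store.pop, Function.update_apply]

@[simp] theorem Store.top_pop (s : Store) (i j : ℕ) :
    (s.pop i).top j = if j = i then (s i).tail.headD 0 else s.top j := by
  by_cases h : j = i <;> simp [Store.top, h]

theorem Store.top_eq {s : Store} {i : ℕ} {a : ℂ} {l : List ℂ} (h : s i = a :: l) :
    s.top i = a := by simp [Store.top, h]

@[simp] theorem Test.holds_nonempty (i : ℕ) (s : Store) :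
    (Test.nonempty i).Holds s ↔ s i ≠ [] := Iff.rfl

@[simp] theorem Test.holds_nonzero (i : ℕ) (s : Store) :
    (Test.nonzero i).Holds s ↔ s.top i ≠ 0 := Iff.rfl

/-! ### Stacks that a program leaves alone -/

/-- The program may change stack `i`. -/
def Prog.touches (i : ℕ) : Prog → Bool
  | .skip => false
  | .push j _ | .pop j | .copy _ j | .arith _ _ _ j | .flip j | .query _ _ j => i == j
  | .seq p q | .ite _ p q => p.touches i || q.touches i
  | .loop _ p => p.touches i

/-- Each step replaces an instruction by parts of itself or executes it, so a stack that no pending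
instruction writes to never changes. As `touches` is computable, loop invariants need to mention
only the stacks that the loop changes. -/
theorem DetReaches.frame {i t : ℕ} {c d : Cfg} (h : DetReaches t c d)
    (hc : ∀ p ∈ c.todo, p.touches i = false) : d.store i = c.store i := by
  induction h with
  | refl => rfl
  | @step t c c' d h _ ih =>
    obtain ⟨todo, s⟩ := c
    suffices H : c'.store i = s i ∧ ∀ p ∈ c'.todo, p.touches i = false from (ih H.2).trans H.1
    rcases todo with _ | ⟨p, r⟩
    · simp [Cfg.step] at h
    have hr : ∀ q ∈ r, q.touches i = false := fun q hq => hc q (by simp [hq])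
    have hp := hc p (by simp)
    cases p <;> simp only [Cfg.step, Action.next.injEq, reduceCtorEq] at h <;> subst h <;>
      simp only [Prog.touches, Bool.or_eq_false_iff, beq_eq_false_iff_ne] at hp
    case loop =>
      refine ⟨rfl, ?_⟩
      split_ifs
      · simpa [Prog.touches] using ⟨hp, hr⟩
      · exact hr
    case ite =>
      refine ⟨rfl, ?_⟩
      split_ifs
      · simpa using ⟨hp.1, hr⟩
      · simpa using ⟨hp.2, hr⟩
    all_goals simp_all

theorem Runs.frame {p : Prog} {T : ℕ} {s s' : Store} (h : Runs p T s s') (i : ℕ)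
    (hi : p.touches i = false) : s' i = s i := by
  obtain ⟨t, -, h⟩ := h []
  exact h.frame (by simpa using hi)

theorem Runs.frame_top {p : Prog} {T : ℕ} {s s' : Store} (h : Runs p T s s') (i : ℕ)
    (hi : p.touches i = false) : s'.top i = s.top i := by
  rw [Store.top, h.frame i hi, Store.top]

/-- Move the contents of stack `i` to stack `j`, in reverse order. -/
def Prog.move (i j : ℕ) : Prog := .loop (.nonempty i) (.block [.copy i j, .pop i])

theorem runs_move {i j : ℕ} (hij : i ≠ j) (l : List ℂ) (s : Store) (hs : s i = l) :
    ∃ s', Runs (.move i j) (6 * l.length + 1) s s' ∧ s' i = [] ∧ s' j = l.reverse ++ s j := by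
  induction l generalizing s with
  | nil => exact ⟨s, Runs.loop_stop (by simp [hs]), hs, by simp⟩
  | cons a l ih =>
    obtain ⟨s', h1, h2, h3⟩ := ih ((Prog.block [.copy i j, .pop i]).exec s) (by simp [hs, hij])
    refine ⟨s', (Runs.loop_go (by simp [hs]) (runs_exec _ rfl s) h1).mono ?_, h2, ?_⟩
    · simp [Prog.block, Prog.cost]; omega
    · simp [h3, Store.top_eq hs, hij.symm]

/-! ### Probabilistic runs of programs that make a single query at the end -/

theorem DetReaches.run_eq {t : ℕ} {c d : Cfg} (M : RandProc) (h : DetReaches t c d) (m : ℕ) :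
    run M (t + m) c = run M m d := by
  induction h with
  | refl => simp
  | @step t c c' d h _ ih =>
    rw [Nat.add_right_comm, run, h]
    exact ih

theorem run_of_halted (M : RandProc) {c : Cfg} (h : c.Halted) (t : ℕ) : run M t c = PMF.pure c := by
  cases t with
  | zero => rfl
  | succ t => rw [run, show c.step = .halt from h]

/-- The run is deterministic up to `d` and has halted after the answer, so no other configuration
can query. One computation thus controls the tolerance of every oracle call along all random
choices. -/
theorem DetReaches.ask_mem_support {t₀ : ℕ} {c d : Cfg} (M : RandProc) (h : DetReaches t₀ c d)
    {w : List ℂ} {δ : ℂ} {k : ℂ → Cfg} (hd : d.step = .ask w δ k) (hk : ∀ z, (k z).Halted) (t : ℕ)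
    {c' : Cfg} (hc' : c' ∈ (run M t c).support) {w' : List ℂ} {δ' : ℂ} {k' : ℂ → Cfg}
    (hs : c'.step = .ask w' δ' k') : δ' = δ := by
  induction h generalizing t with
  | refl d =>
    cases t with
    | zero =>
      simp only [run, PMF.support_pure, Set.mem_singleton_iff] at hc'
      subst hc'
      rw [hd] at hs
      cases hs
      rfl
    | succ t =>
      simp only [run, hd, PMF.mem_support_bind_iff] at hc'
      obtain ⟨z, -, hz⟩ := hc'
      rw [run_of_halted M (hk z)] at hz
      simp only [PMF.support_pure, Set.mem_singleton_iff] at hz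
      subst hz
      rw [show (k z).step = .halt from hk z] at hs
      cases hs
  | @step t₁ c c₁ d h _ ih =>
    cases t with
    | zero =>
      simp only [run, PMF.support_pure, Set.mem_singleton_iff] at hc'
      subst hc'
      rw [h] at hs
      cases hs
    | succ t =>
      rw [run, h] at hc'
      exact ih hd t hc'

/-- A deterministic polynomial-time transformation of instances that preserves values, followed by
a single oracle call, is an AP-reduction. -/
theorem apReducible_of_transform {P Q : CountingProblem} (p : Prog) (i : ℕ) (hp1 : p.touches 1 = false)
    (K e : ℕ) (f : P.Inst → Q.Inst) (hf : ∀ x, Q.value (f x) = P.value x)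
    (hrun : ∀ (x : P.Inst) (s : Store), s 0 = P.code x → (∀ j, 2 ≤ j → s j = []) →
      ∃ s', Runs p (K * ((P.code x).length + 1) ^ e) s s' ∧ s' i = Q.code (f x)) :
    APReducible P Q := by
  have key : ∀ (x : P.Inst) (ε : ℝ), ∃ t s', t + 1 ≤ (K + 2) * ((P.code x).length + 1) ^ e ∧
      DetReaches t ((Prog.seq p (.query i 1 0)).startApprox (P.code x) ε) ⟨[.query i 1 0], s'⟩ ∧
      s' i = Q.code (f x) ∧ s'.top 1 = (ε : ℂ) := by
    intro x ε
    obtain ⟨s', h1, h2⟩ := hrun x (fun i => if i = 0 then P.code x else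
      if i = 1 then [(ε : ℂ)] else []) (by simp)
      (fun j hj => by simp [show j ≠ 0 by omega, show j ≠ 1 by omega])
    obtain ⟨t, ht, h3⟩ := h1 [.query i 1 0]
    refine ⟨t + 1, s', ?_, .step rfl h3, h2, ?_⟩
    -- Two steps are added to the transformation, the unfolding of `seq` and the query; this is the
    -- 2 in `K + 2`.
    · have : 1 ≤ ((P.code x).length + 1) ^ e := Nat.one_le_pow _ _ (by omega)
      nlinarith
    · rw [h1.frame_top 1 hp1]
      simp [Store.top]
  have hb : ∀ (x : P.Inst) (ε : ℝ), polyAt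
      (MvPolynomial.C ((K : ℝ) + 2) * (MvPolynomial.X 0 + 1) ^ e) (P.code x) ε
      = (((K + 2) * ((P.code x).length + 1) ^ e : ℕ) : ℝ) := by
    intro x ε
    simp [polyAt]
  -- Values are preserved exactly, so the tolerance `ε` itself is passed on, and `1 / δ` is bounded
  -- by the coordinate `1 / ε`.
  refine ⟨.seq p (.query i 1 0), MvPolynomial.X 1,
    MvPolynomial.C ((K : ℝ) + 2) * (MvPolynomial.X 0 + 1) ^ e, fun M hM => ⟨?_, ?_⟩⟩
  · intro x ε h0 h1
    obtain ⟨t, s', ht, hr, hi, hε⟩ := key x ε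
    have hout : (Prog.seq p (.query i 1 0)).outcome
        (MvPolynomial.C ((K : ℝ) + 2) * (MvPolynomial.X 0 + 1) ^ e) M (P.code x) ε
        = M (Q.code (f x)) ε := by
      rw [Prog.outcome, hb, Nat.floor_natCast]
      obtain ⟨m, hm⟩ := Nat.exists_eq_add_of_le ht
      rw [hm, add_assoc, hr.run_eq]
      rw [add_comm 1 m, run]
      simp only [Cfg.step, hi, hε, Complex.ofReal_re]
      rw [PMF.map_bind]
      conv_rhs => rw [← PMF.bind_pure (M (Q.code (f x)) ε)]
      congr 1
      funext z
      rw [run_of_halted M (show (Cfg.mk [] _).Halted from rfl), PMF.pure_map]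
      simp [Cfg.output]
    rw [hout, ← hf]
    exact hM (f x) ε h0 h1
  · intro x ε h0 h1
    obtain ⟨t, s', ht, hr, hi, hε⟩ := key x ε
    refine ⟨fun u c w d k hc hs => ⟨ε, ?_, h0, h1, by simp [polyAt]⟩,
      t + 1, by rw [hb]; exact_mod_cast ht, ?_⟩
    · rw [hr.ask_mem_support M rfl (fun z => rfl) u hc hs, hε]
    · intro c hc
      rw [hr.run_eq M 1, run] at hc
      simp only [Cfg.step, PMF.mem_support_bind_iff] at hc
      obtain ⟨z, -, hz⟩ := hc
      rw [run_of_halted M (show (Cfg.mk [] _).Halted from rfl)] at hz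
      simp only [PMF.support_pure, Set.mem_singleton_iff] at hz
      subst hz
      rfl

/-! ### Contractions of a constraint by vectors -/

section Contract

open Function

variable {k : ℕ} {A B : Type*} [CommRing A] [Algebra ℂ A] [CommRing B] [Algebra ℂ B]

/-- The multilinear form with coefficients `f`. -/
def contract (f : (Fin k → Bool) → ℂ) (v : Fin k → Bool → A) : A :=
  ∑ y, (∏ l, v l (y l)) * algebraMap ℂ A (f y)

/-- Unit vectors. -/
def unitVec (s b : Bool) : A := if b = s then 1 else 0

theorem prod_update_apply {R : Type*} [CommRing R] (v : Fin k → Bool → R) (i : Fin k)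
    (a : Bool → R) (y : Fin k → Bool) :
    ∏ l, update v i a l (y l) = a (y i) * ∏ l ∈ Finset.univ \ {i}, v l (y l) := by
  rw [← Finset.prod_update_of_mem (Finset.mem_univ i)]
  exact Finset.prod_congr rfl fun l _ => apply_update (fun l (w : Bool → R) => w (y l)) v i a l

theorem contract_update (f : (Fin k → Bool) → ℂ) (v : Fin k → Bool → A) (i : Fin k)
    (a : Bool → A) :
    contract f (update v i a) = ∑ s, a s * contract f (update v i (unitVec s)) := by
  simp only [contract, prod_update_apply, Finset.mul_sum]
  rw [Finset.sum_comm]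
  refine Finset.sum_congr rfl fun y _ => ?_
  rw [Finset.sum_eq_single (y i)]
  · simp [unitVec, mul_assoc]
  · intro b _ hb
    simp [unitVec, hb.symm]
  · simp

theorem map_contract (f : (Fin k → Bool) → ℂ) (v : Fin k → Bool → A) (φ : A →ₐ[ℂ] B) :
    φ (contract f v) = contract f fun l b => φ (v l b) := by
  simp [contract]

theorem contract_unitVec (f : (Fin k → Bool) → ℂ) (x : Fin k → Bool) :
    contract (A := ℂ) f (fun l => unitVec (x l)) = f x := by
  rw [contract, Finset.sum_eq_single x]
  · simp [unitVec]
  · intro y _ hy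
    obtain ⟨l, hl⟩ := Function.ne_iff.1 hy
    rw [Finset.prod_eq_zero (Finset.mem_univ l) (by simp [unitVec, hl]), zero_mul]
  · simp

/-- The binary function of variables `i` and `j` obtained by contracting the others. -/
def pairMatrix (f : (Fin k → Bool) → ℂ) (i j : Fin k) (v : Fin k → Bool → A) (s t : Bool) : A :=
  contract f (update (update v i (unitVec s)) j (unitVec t))

/-- The determinant of a binary function. -/
def det2 (M : Bool → Bool → A) : A := M false false * M true true - M false true * M true false

/-- A binary function that is neither degenerate nor supported on an equality or a disequality. -/
def Hard (M : Bool → Bool → ℂ) : Prop :=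
  det2 M ≠ 0 ∧ (∃ s, M s (!s) ≠ 0) ∧ ∃ s, M s s ≠ 0

theorem contract_pair (f : (Fin k → Bool) → ℂ) {i j : Fin k} (hij : i ≠ j)
    (v : Fin k → Bool → A) (a b : Bool → A) :
    contract f (update (update v i a) j b)
      = ∑ s, ∑ t, a s * b t * pairMatrix f i j v s t := by
  rw [contract_update]
  simp only [update_comm hij]
  simp only [contract_update f _ i a, Finset.mul_sum]
  rw [Finset.sum_comm]
  refine Finset.sum_congr rfl fun s _ => Finset.sum_congr rfl fun t _ => ?_
  rw [pairMatrix, update_comm hij]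
  ring

/-- With the other vectors fixed, the form is bilinear. The difference of the two sides is the
determinant of its matrix times the 2×2 determinants formed from `a, a'` and from `b, b'`. -/
theorem contract_exchange (f : (Fin k → Bool) → ℂ) {i j : Fin k} (hij : i ≠ j)
    (v : Fin k → Bool → A) (h : det2 (pairMatrix f i j v) = 0) (a a' b b' : Bool → A) :
    contract f (update (update v i a) j b) * contract f (update (update v i a') j b')
      = contract f (update (update v i a) j b') * contract f (update (update v i a') j b) := by
  simp only [contract_pair f hij, Fintype.sum_bool]
  rw [det2] at h
  linear_combination (a false * a' true - a true * a' false) *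
    (b false * b' true - b true * b' false) * h

theorem update_map_unitVec (v : Fin k → Bool → A) (φ : A →ₐ[ℂ] B) (i : Fin k) (s : Bool) :
    (fun l b => φ (update v i (unitVec s) l b)) = update (fun l b => φ (v l b)) i (unitVec s) := by
  funext l b
  by_cases h : l = i
  · subst h
    by_cases hb : b = s <;> simp [unitVec, hb]
  · simp [h]

theorem map_pairMatrix (f : (Fin k → Bool) → ℂ) (i j : Fin k) (v : Fin k → Bool → A)
    (φ : A →ₐ[ℂ] B) (s t : Bool) :
    φ (pairMatrix f i j v s t) = pairMatrix f i j (fun l b => φ (v l b)) s t := by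
  rw [pairMatrix, map_contract, update_map_unitVec, update_map_unitVec, pairMatrix]

theorem map_det2 (M : Bool → Bool → A) (φ : A →ₐ[ℂ] B) :
    φ (det2 M) = det2 fun s t => φ (M s t) := by
  simp [det2]

/-- The ring of polynomials in the entries of generic vectors. -/
abbrev GenericRing (k : ℕ) : Type := MvPolynomial (Fin k × Bool) ℂ

/-- Evaluation of generic vectors. -/
def evalAt (w : Fin k → Bool → ℂ) : GenericRing k →ₐ[ℂ] ℂ :=
  MvPolynomial.aeval fun p => w p.1 p.2

/-- Generic vectors. -/
def genericVec (l : Fin k) (b : Bool) : GenericRing k := MvPolynomial.X (l, b)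

@[simp] theorem evalAt_genericVec (w : Fin k → Bool → ℂ) (l : Fin k) (b : Bool) :
    evalAt w (genericVec l b) = w l b := by simp [evalAt, genericVec]

/-- The field ℂ is infinite. This carries identities that hold for all concrete vectors over to
generic ones, where cancellation is available. -/
theorem generic_eq_zero {p : GenericRing k} (h : ∀ w, evalAt w p = 0) : p = 0 := by
  refine MvPolynomial.funext fun x => ?_
  have := h fun l b => x (l, b)
  simpa [evalAt, MvPolynomial.aeval_eq_eval] using this

/-- A contraction is generically hard, or identically degenerate, or identically supported on an
equality or a disequality. -/
theorem pairMatrix_trichotomy (f : (Fin k → Bool) → ℂ) (i j : Fin k)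
    (h : ∀ v : Fin k → Bool → ℂ, ¬ Hard (pairMatrix f i j v)) :
    (∀ v : Fin k → Bool → ℂ, det2 (pairMatrix f i j v) = 0) ∨
    (∀ (v : Fin k → Bool → ℂ) (s : Bool), pairMatrix f i j v s (!s) = 0) ∨
    (∀ (v : Fin k → Bool → ℂ) (s : Bool), pairMatrix f i j v s s = 0) := by
  by_contra! hc
  obtain ⟨⟨v₁, h₁⟩, ⟨v₂, s₂, h₂⟩, v₃, s₃, h₃⟩ := hc
  set M : Bool → Bool → GenericRing k := pairMatrix f i j genericVec with hM
  have hev : ∀ w s t, evalAt w (M s t) = pairMatrix f i j w s t := by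
    intro w s t
    simp [hM, map_pairMatrix]
  have hdet : ∀ w, evalAt w (det2 M) = det2 (pairMatrix f i j w) := by
    intro w
    rw [map_det2]
    simp [hev, det2]
  have n₁ : det2 M ≠ 0 := fun h0 => h₁ (by rw [← hdet, h0, map_zero])
  have n₂ : M s₂ (!s₂) ≠ 0 := fun h0 => h₂ (by rw [← hev, h0, map_zero])
  have n₃ : M s₃ s₃ ≠ 0 := fun h0 => h₃ (by rw [← hev, h0, map_zero])
  -- The polynomial ring is a domain, so the product of the three polynomials is nonzero; any point
  -- where it does not vanish gives a hard contraction.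
  refine mul_ne_zero (mul_ne_zero n₁ n₂) n₃ (generic_eq_zero fun w => ?_)
  by_contra hw
  simp only [map_mul, hdet, hev, mul_ne_zero_iff] at hw
  exact h w ⟨hw.1.1, ⟨s₂, hw.1.2⟩, ⟨s₃, hw.2⟩⟩

/-- The induction on `S` must cancel the contraction with `S.piecewise v w`, which may vanish for
particular `v`. For generic vectors it is a nonzero polynomial, because it specialises to `contract
f w` at `v = w`. Hence the identity is proved for generic vectors and then evaluated at `v`. -/
theorem piecewise_exchange (f : (Fin k → Bool) → ℂ) (w : Fin k → Bool → ℂ)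
    (hw : contract f w ≠ 0) (j : Fin k) (S : Finset (Fin k)) (hj : j ∉ S)
    (hdet : ∀ i ∈ S, ∀ v : Fin k → Bool → ℂ, det2 (pairMatrix f i j v) = 0)
    (v : Fin k → Bool → ℂ) :
    contract f ((insert j S).piecewise v w) * contract f w
      = contract f (S.piecewise v w) * contract f (update w j (v j)) := by
  set W : Fin k → Bool → GenericRing k := fun l b => MvPolynomial.C (w l b) with hW
  have hWe : ∀ u l b, evalAt u (W l b) = w l b := by
    intro u l b
    simp [hW, evalAt]
  suffices H : contract f ((insert j S).piecewise genericVec W) * contract f W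
      = contract f (S.piecewise genericVec W) * contract f (update W j (genericVec j)) by
    have h1 : ∀ T : Finset (Fin k), (fun l b => evalAt v (T.piecewise genericVec W l b))
        = T.piecewise v w := by
      intro T
      funext l b
      by_cases hl : l ∈ T <;> simp [hl, hWe]
    have h2 : (fun l b => evalAt v (update W j (genericVec j) l b)) = update w j (v j) := by
      funext l b
      by_cases hl : l = j
      · subst hl; simp
      · simp [hl, hWe]
    have h3 : (fun l b => evalAt v (W l b)) = w := by
      funext l b
      exact hWe v l b
    have := congrArg (evalAt v) H
    rwa [map_mul, map_mul, map_contract, map_contract, map_contract, map_contract, h1, h1, h2,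
      h3] at this
  induction S using Finset.induction_on with
  | empty =>
    rw [Finset.piecewise_insert]
    simp [mul_comm]
  | insert i S hi ih =>
    have hji : i ≠ j := fun h => hj (by simp [h])
    have hjS : j ∉ S := fun h => hj (by simp [h])
    have ih := ih hjS fun i hi => hdet i (by simp [hi])
    set P := S.piecewise genericVec W with hP
    have hPi : P i = W i := by simp [hP, hi]
    have hPj : P j = W j := by simp [hP, hjS]
    have e11 : (insert j (insert i S)).piecewise genericVec W
        = update (update P i (genericVec i)) j (genericVec j) := by
      rw [Finset.piecewise_insert, Finset.piecewise_insert]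
    have e10 : (insert i S).piecewise genericVec W
        = update (update P i (genericVec i)) j (W j) := by
      rw [Finset.piecewise_insert, ← hP, ← hPj]
      refine (update_eq_self_iff.2 ?_).symm
      simp [hji.symm]
    have e01 : (insert j S).piecewise genericVec W
        = update (update P i (W i)) j (genericVec j) := by
      rw [Finset.piecewise_insert, ← hP, ← hPi, update_eq_self]
    have e00 : P = update (update P i (W i)) j (W j) := by
      rw [← hPi, update_eq_self, ← hPj, update_eq_self]
    have hd : det2 (pairMatrix f i j P) = 0 := by
      refine generic_eq_zero fun u => ?_
      rw [map_det2]
      simp only [map_pairMatrix]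
      exact hdet i (by simp) _
    have hne : contract f P ≠ 0 := by
      intro h0
      apply hw
      have := congrArg (evalAt w) h0
      rw [map_contract, map_zero] at this
      rw [← this]
      congr 1
      funext l b
      by_cases hl : l ∈ S <;> simp [hP, hl, hWe]
    have hx := contract_exchange f hji P hd (genericVec i) (W i) (genericVec j) (W j)
    rw [← e11, ← e10, ← e01, ← e00] at hx
    -- Let `c₁₁`, `c₁₀`, `c₀₁`, `c₀₀` be the contractions, with indices telling whether `i` and `j`
    -- carry generic vectors. Then `hx` reads `c₁₁ c₀₀ = c₁₀ c₀₁`, the induction hypothesis replaces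
    -- `c₀₁`, and `c₀₀` cancels.
    refine mul_right_cancel₀ hne ?_
    linear_combination contract f W * hx + contract f ((insert i S).piecewise genericVec W) * ih

/-- Passing from `w` to `v` one position at a time, each change multiplies the contraction by a
factor that depends on that position alone. In other words, the tensor has rank one in the
directions of `S`. -/
theorem contract_piecewise (f : (Fin k → Bool) → ℂ) (w : Fin k → Bool → ℂ)
    (hw : contract f w ≠ 0) (S : Finset (Fin k))
    (hdet : ∀ i ∈ S, ∀ j ∈ S, i ≠ j → ∀ v : Fin k → Bool → ℂ, det2 (pairMatrix f i j v) = 0)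
    (v : Fin k → Bool → ℂ) :
    contract f (S.piecewise v w)
      = contract f w * ∏ i ∈ S, (contract f (update w i (v i)) / contract f w) := by
  induction S using Finset.induction_on with
  | empty => simp
  | insert j S hj ih =>
    have ih := ih fun i hi i' hi' => hdet i (by simp [hi]) i' (by simp [hi'])
    have := piecewise_exchange f w hw j S hj (fun i hi => hdet i (by simp [hi]) j (by simp)
      (fun h => hj (h ▸ hi))) v
    rw [Finset.prod_insert hj, mul_left_comm, ← ih]
    field_simp
    linear_combination this

end Contract

/-- A constraint all of whose binary contractions are easy is a product of unary constraints,
equalities and disequalities. -/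
theorem mem_ED_of_not_hard (f : Constraint)
    (h : ∀ i j, i ≠ j → ∀ v : Fin f.arity → Bool → ℂ, ¬ Hard (pairMatrix f.val i j v)) :
    f ∈ ED := by
  classical
  obtain ⟨k, hk, f⟩ := f
  dsimp only at h
  have i₀ : Fin k := ⟨0, hk⟩
  -- `ED` requires at least one factor; for the zero function it is a zero unary constraint.
  by_cases hf : ∀ x, f x = 0
  · exact ⟨1, 0, fun _ _ => 0, fun _ => i₀, Fin.elim0, Fin.elim0, Fin.elim0, by omega,
      fun i => i.elim0, fun x => by simp [hf x]⟩
  push Not at hf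
  obtain ⟨α, hα⟩ := hf
  -- Two arguments are tied if their sum modulo 2 is constant on the support of `f`; the constant is
  -- read off at the support point `α`.
  let tied : Setoid (Fin k) :=
    { r := fun i j => ∀ x, f x ≠ 0 → xor (x i) (x j) = xor (α i) (α j)
      iseqv :=
        { refl := fun i x _ => by simp
          symm := fun {i j} h x hx => by rw [Bool.xor_comm, h x hx, Bool.xor_comm]
          trans := fun {i j l} h h' x hx => by
            have h1 := h x hx
            have h2 := h' x hx
            revert h1 h2
            cases x i <;> cases x j <;> cases x l <;> cases α i <;> cases α j <;> cases α l <;>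
              simp } }
  have tied_of : ∀ i j, (∃ s, ∀ x, f x ≠ 0 → xor (x i) (x j) = s) → tied i j := by
    rintro i j ⟨s, hs⟩ x hx
    rw [hs x hx, hs α hα]
  let r : Fin k → Fin k := fun i => (Quotient.mk tied i).out
  have hr : ∀ i, tied (r i) i := fun i => Quotient.mk_out (s := tied) i
  have hrr : ∀ i, r (r i) = r i := fun i =>
    congrArg Quotient.out (Quotient.sound (hr i))
  let R : Finset (Fin k) := Finset.univ.filter fun i => r i = i
  -- Every value of `f` is an entry of a contraction by unit vectors. If all off-diagonal or all
  -- diagonal entries vanished identically, `i` and `j` would be tied; but distinct representatives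
  -- are not, so only degeneracy remains.
  have hdet : ∀ i ∈ R, ∀ j ∈ R, i ≠ j →
      ∀ v : Fin k → Bool → ℂ, det2 (pairMatrix f i j v) = 0 := by
    intro i hi j hj hij
    have hupd : ∀ x : Fin k → Bool, pairMatrix f i j (fun l => unitVec (x l)) (x i) (x j) = f x := by
      intro x
      rw [pairMatrix, ← contract_unitVec f x]
      congr 1
      rw [Function.update_eq_self_iff.2 rfl, Function.update_eq_self_iff.2 rfl]
    have hnt : ¬ tied i j := fun ht => hij <| by
      rw [← (Finset.mem_filter.1 hi).2, ← (Finset.mem_filter.1 hj).2]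
      exact congrArg Quotient.out (Quotient.sound ht)
    rcases pairMatrix_trichotomy f i j (h i j hij) with h | h | h
    · exact h
    · refine absurd (tied_of i j ⟨false, fun x hx => ?_⟩) hnt
      by_contra hne
      refine hx ?_
      rw [← hupd x, show x j = !(x i) by revert hne; cases x i <;> cases x j <;> simp]
      exact h _ _
    · refine absurd (tied_of i j ⟨true, fun x hx => ?_⟩) hnt
      by_contra hne
      refine hx ?_
      rw [← hupd x, show x j = x i by revert hne; cases x i <;> cases x j <;> simp]
      exact h _ _
  -- contract along the representatives
  have hrep : ∀ x : Fin k → Bool, (∀ i, xor (x i) (x (r i)) = xor (α i) (α (r i))) →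
      contract f (R.piecewise (fun l => unitVec (x l)) fun _ _ => (1 : ℂ)) = f x := by
    intro x hx
    rw [contract, Finset.sum_eq_single x]
    · rw [Finset.prod_eq_one, one_mul]
      · rfl
      · intro l _
        by_cases hl : l ∈ R <;> simp [hl, unitVec]
    · intro y _ hy
      by_cases hfy : f y = 0
      · simp [hfy]
      obtain ⟨l, hl⟩ := Function.ne_iff.1 hy
      -- Points of the support are determined by their values at representatives. So `y`, being
      -- different from `x`, differs from it at a representative, where the unit vector kills the
      -- term.
      have hrl : y (r l) ≠ x (r l) := by
        have h1 := hr l y hfy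
        have h2 := hx l
        revert h1 h2 hl
        cases y l <;> cases x l <;> cases y (r l) <;> cases x (r l) <;> cases α l <;>
          cases α (r l) <;> simp
      have : r l ∈ R := by simp [R, hrr]
      rw [Finset.prod_eq_zero (Finset.mem_univ (r l)) (by simp [this, unitVec, hrl]), zero_mul]
    · simp
  let w : Fin k → Bool → ℂ := R.piecewise (fun l => unitVec (α l)) fun _ _ => 1
  have hw : contract f w = f α := hrep α fun _ => rfl
  have hw0 : contract f w ≠ 0 := by rwa [hw]
  let u : Fin k → Bool → ℂ := fun i b =>
    if i ∈ R then contract f (Function.update w i (unitVec b)) / contract f w else 1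
  -- The unary factors are the constant `f α`, attached to an arbitrary argument, and the rank-one
  -- factors `u`. The binary factors link each argument to its representative; for a representative
  -- this is equality with itself, which is 1.
  refine ⟨k + 1, k, Fin.cons (fun _ => f α) u, Fin.cons i₀ id,
    fun i => if xor (α i) (α (r i)) then binXOR else binEQ, id, r, by omega,
    fun i => by dsimp only; split_ifs <;> simp, fun x => ?_⟩
  dsimp only [id]
  by_cases hx : ∀ i, xor (x i) (x (r i)) = xor (α i) (α (r i))
  · have hone : ∏ i, (if xor (α i) (α (r i)) = true then binXOR else binEQ) (x i) (x (r i)) = 1 := by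
      refine Finset.prod_eq_one fun i _ => ?_
      have := hx i
      revert this
      cases x i <;> cases x (r i) <;> cases α i <;> cases α (r i) <;> simp [binXOR, binEQ]
    rw [hone, mul_one, ← hrep x hx]
    have hpw : R.piecewise (fun l => unitVec (x l)) (fun _ _ => (1 : ℂ))
        = R.piecewise (fun l => unitVec (x l)) w := by
      funext l
      by_cases hl : l ∈ R <;> simp [hl, w]
    rw [hpw, contract_piecewise f w hw0 R hdet, hw, Fin.prod_univ_succ]
    simp only [Fin.cons_zero, Fin.cons_succ]
    congr 1
    rw [← Finset.prod_subset (Finset.subset_univ R)]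
    · refine Finset.prod_congr rfl fun i hi => ?_
      simp [u, hi, hw]
    · intro i _ hi
      simp [u, hi]
  · push Not at hx
    obtain ⟨i, hi⟩ := hx
    have hfx : f x = 0 := by
      by_contra hfx
      refine hi ?_
      have := hr i x hfx
      rw [Bool.xor_comm, this, Bool.xor_comm]
    rw [hfx, Finset.prod_eq_zero (Finset.mem_univ i), mul_zero]
    revert hi
    cases x i <;> cases x (r i) <;> cases α i <;> cases α (r i) <;> simp [binXOR, binEQ]

/-! ### Realizable functions -/

/-- A constraint applied to elements of a type of variables. -/
structure App (ι : Type) where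
  con : Constraint
  scope : Fin con.arity → ι

/-- The value of an applied constraint under an assignment. -/
def App.eval {ι : Type} (a : App ι) (σ : ι → Bool) : ℂ := a.con.val fun i => σ (a.scope i)

/-- Renaming of variables. -/
def App.map {ι κ : Type} (e : ι → κ) (a : App ι) : App κ := ⟨a.con, fun i => e (a.scope i)⟩

/-- The product of the values of applied constraints. -/
def prodApps {ι : Type} (L : List (App ι)) (σ : ι → Bool) : ℂ := (L.map fun a => a.eval σ).prod

theorem prodApps_map {ι κ : Type} (e : ι → κ) (L : List (App ι)) (σ : κ → Bool) :
    prodApps (L.map (App.map e)) σ = prodApps L fun i => σ (e i) := by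
  simp [prodApps, App.eval, App.map, Function.comp_def]

@[simp] theorem prodApps_nil {ι : Type} (σ : ι → Bool) : prodApps [] σ = 1 := rfl

@[simp] theorem prodApps_cons {ι : Type} (a : App ι) (L : List (App ι)) (σ : ι → Bool) :
    prodApps (a :: L) σ = a.eval σ * prodApps L σ := by simp [prodApps]

@[simp] theorem prodApps_append {ι : Type} (L L' : List (App ι)) (σ : ι → Bool) :
    prodApps (L ++ L') σ = prodApps L σ * prodApps L' σ := by simp [prodApps]

/-- The function `g` of variables in `ι` is a sum, over the values of auxiliary variables, of a
product of constraints from `S`. -/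
def Realizable (S : Set Constraint) {ι : Type} (g : (ι → Bool) → ℂ) : Prop :=
  ∃ (κ : Type) (_ : Fintype κ) (_ : DecidableEq κ) (L : List (App (ι ⊕ κ))), (∀ a ∈ L, a.con ∈ S) ∧
    ∀ σ, g σ = ∑ τ : κ → Bool, prodApps L (Sum.elim σ τ)

section Realizable

variable {S : Set Constraint} {ι : Type}

theorem Realizable.app (c : Constraint) (hc : c ∈ S) (e : Fin c.arity → ι) :
    Realizable S fun σ : ι → Bool => c.val fun i => σ (e i) :=
  ⟨Empty, inferInstance, inferInstance, [⟨c, fun i => .inl (e i)⟩], by simpa using hc,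
    fun σ => by simp [App.eval]⟩

theorem Realizable.one : Realizable S fun _ : ι → Bool => 1 :=
  ⟨Empty, inferInstance, inferInstance, [], by simp, fun σ => by simp⟩

theorem Realizable.mul {g h : (ι → Bool) → ℂ} (hg : Realizable S g) (hh : Realizable S h) :
    Realizable S fun σ => g σ * h σ := by
  obtain ⟨κ, _, _, L, hL, hg⟩ := hg
  obtain ⟨κ', _, _, L', hL', hh⟩ := hh
  refine ⟨κ ⊕ κ', inferInstance, inferInstance,
    L.map (App.map (Sum.map id Sum.inl)) ++ L'.map (App.map (Sum.map id Sum.inr)), ?_, fun σ => ?_⟩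
  · intro a ha
    rcases List.mem_append.1 ha with h | h <;> obtain ⟨b, hb, rfl⟩ := List.mem_map.1 h
    · exact hL b hb
    · exact hL' b hb
  · simp only [hg, hh]
    rw [Finset.sum_mul_sum, ← Fintype.sum_prod_type']
    refine Fintype.sum_equiv (Equiv.sumArrowEquivProdArrow κ κ' Bool).symm _ _ fun τ => ?_
    rw [prodApps_append, prodApps_map, prodApps_map]
    congr 2 <;> funext i <;> rcases i with i | i <;> rfl

theorem Realizable.sumOut {κ : Type} [Fintype κ] [DecidableEq κ] {g : (ι ⊕ κ → Bool) → ℂ}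
    (hg : Realizable S g) :
    Realizable S fun σ : ι → Bool => ∑ τ : κ → Bool, g (Sum.elim σ τ) := by
  obtain ⟨μ, _, _, L, hL, hg⟩ := hg
  refine ⟨κ ⊕ μ, inferInstance, inferInstance, L.map (App.map (Equiv.sumAssoc ι κ μ)), ?_,
    fun σ => ?_⟩
  · intro a ha
    obtain ⟨b, hb, rfl⟩ := List.mem_map.1 ha
    exact hL b hb
  · simp only [hg]
    rw [← Fintype.sum_prod_type']
    refine Fintype.sum_equiv (Equiv.sumArrowEquivProdArrow κ μ Bool).symm _ _ fun τ => ?_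
    rw [prodApps_map]
    congr 1
    funext i
    rcases i with (i | i) | i <;> rfl

theorem Realizable.sumBit {G : (ι → Bool) → Bool → ℂ}
    (hG : Realizable S fun σ : ι ⊕ Unit → Bool => G (fun i => σ (.inl i)) (σ (.inr ()))) :
    Realizable S fun σ : ι → Bool => ∑ b, G σ b := by
  convert hG.sumOut using 2 with σ
  exact Fintype.sum_equiv (Equiv.funUnique Unit Bool).symm _ _ fun b => rfl

theorem Realizable.unary (hU : unaryConstraints ⊆ S) (u : Bool → ℂ) (i : ι) :
    Realizable S fun σ : ι → Bool => u (σ i) :=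
  Realizable.app ⟨1, le_rfl, fun x => u (x 0)⟩ (hU rfl) fun _ => i

theorem Realizable.prod {α : Type} (s : Finset α) {g : α → (ι → Bool) → ℂ}
    (h : ∀ l ∈ s, Realizable S (g l)) : Realizable S fun σ => ∏ l ∈ s, g l σ := by
  classical
  induction s using Finset.induction_on with
  | empty => simpa using Realizable.one
  | insert a s ha ih =>
    simp only [Finset.prod_insert ha]
    exact (h a (by simp)).mul (ih fun l hl => h l (by simp [hl]))

end Realizable

/-! ### Realizable binary functions -/

/-- The binary function `M` is realizable on all pairs of variables. -/
def RealizesBin (S : Set Constraint) (M : Bool → Bool → ℂ) : Prop :=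
  ∀ (ι : Type) (i j : ι), Realizable S fun σ : ι → Bool => M (σ i) (σ j)

/-- Binary disjunction. -/
def binOR (x y : Bool) : ℂ := if x || y then 1 else 0

section Binary

variable {S : Set Constraint} {M : Bool → Bool → ℂ}

open Function in
-- The value `s` moves from the vector into the argument of `f`, by reindexing along a flip of bit
-- `i`. In a gadget the vectors have to be fixed unary constraints, while the free bits may only
-- enter through the scope of `f`.
theorem contract_update_unitVec {k : ℕ} (f : (Fin k → Bool) → ℂ) (v : Fin k → Bool → ℂ) (i : Fin k)
    (s : Bool) : contract f (update v i (unitVec s))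
      = contract (fun y => f (update y i s)) (update v i (unitVec false)) := by
  have hinv : Involutive fun y : Fin k → Bool => update y i (xor (y i) s) := by
    intro y
    simp
  refine Fintype.sum_equiv hinv.toPerm _ _ fun y => ?_
  simp only [prod_update_apply, Involutive.coe_toPerm, update_self, update_idem]
  have : ∏ l ∈ Finset.univ \ {i}, v l (update y i (xor (y i) s) l)
      = ∏ l ∈ Finset.univ \ {i}, v l (y l) := by
    refine Finset.prod_congr rfl fun l hl => ?_
    rw [update_of_ne (by simpa using hl)]
  rw [this]
  by_cases h : y i = s
  · subst h
    simp [unitVec]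
  · have h' : xor (y i) s = true := by revert h; cases y i <;> cases s <;> simp
    simp [unitVec, h, h']

theorem RealizesBin.pairMatrix (hU : unaryConstraints ⊆ S) {f : Constraint} (hf : f ∈ S)
    {i j : Fin f.arity} (hij : i ≠ j) (v : Fin f.arity → Bool → ℂ) :
    RealizesBin S (pairMatrix f.val i j v) := by
  intro _ a b
  -- There is an auxiliary bit for every argument of `f`, including `i` and `j`. The latter two do
  -- not occur in the scope and are pinned to `false` by unit vectors, so they contribute a factor
  -- 1.
  have h1 : Realizable S fun σ : _ ⊕ Fin f.arity → Bool =>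
      (∏ l, Function.update (Function.update v i (unitVec false)) j (unitVec false) l (σ (.inr l))) *
        f.val (fun l => σ (if l = j then .inl b else if l = i then .inl a else .inr l)) :=
    (Realizable.prod _ fun l _ => Realizable.unary hU _ _).mul (Realizable.app f hf _)
  convert h1.sumOut using 2 with σ
  rw [ComplexCSP.pairMatrix, contract_update_unitVec, Function.update_comm hij,
    contract_update_unitVec, Function.update_comm hij.symm]
  refine Finset.sum_congr rfl fun y _ => ?_
  simp only [Sum.elim_inr, Algebra.algebraMap_self, RingHom.id_apply]
  congr 2
  funext l
  by_cases hj : l = j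
  · subst hj; simp
  · by_cases hi : l = i
    · subst hi; simp [hij]
    · simp [hi, hj]

/-- Two copies of `M` joined at a weighted middle bit form the matrix `M D Mᵀ`, where `D` is
diagonal with entries `p`. -/
theorem RealizesBin.congruence (hU : unaryConstraints ⊆ S) (hM : RealizesBin S M)
    (p : Bool → ℂ) : RealizesBin S fun x y => ∑ z, M x z * p z * M y z := fun _ i j =>
  Realizable.sumBit (G := fun σ z => M (σ i) z * p z * M (σ j) z)
    (((hM _ _ _).mul (Realizable.unary hU p _)).mul (hM _ _ _))

theorem RealizesBin.weighted (hU : unaryConstraints ⊆ S) (hM : RealizesBin S M)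
    (u v : Bool → ℂ) : RealizesBin S fun x y => u x * v y * M x y := fun ι i j =>
  ((Realizable.unary hU u i).mul (Realizable.unary hU v j)).mul (hM ι i j)

/-- Row and column scalings suffice to normalise the three nonzero entries to 1, and they keep the
zero. -/
theorem RealizesBin.or_of_zero (hU : unaryConstraints ⊆ S) (hM : RealizesBin S M)
    (h00 : M false false = 0) (h01 : M false true ≠ 0) (h10 : M true false ≠ 0)
    (h11 : M true true ≠ 0) : RealizesBin S binOR := by
  convert hM.weighted hU
    (fun x => if x then 1 / M true false else M true true / (M false true * M true false))
    (fun y => if y then M true false / M true true else 1) using 1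
  funext x y
  cases x <;> cases y <;> simp [binOR, h00] <;> field_simp

/-- In `M D Mᵀ` with `D = (M₀₁², -M₀₀²)` the entry at `(0, 0)` cancels. The off-diagonal entries are
`-M₀₀ M₀₁ det M`, and the entry at `(1, 1)` is `-det M` times the permanent of `M`; this is why the
permanent must not vanish. -/
theorem RealizesBin.or_of_sum_ne (hU : unaryConstraints ⊆ S) (hM : RealizesBin S M)
    (h00 : M false false ≠ 0) (h01 : M false true ≠ 0) (hd : det2 M ≠ 0)
    (hs : M false false * M true true + M false true * M true false ≠ 0) :
    RealizesBin S binOR := by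
  have hd' : M false true * M true false - M false false * M true true ≠ 0 := by
    rw [det2] at hd
    intro h
    exact hd (by linear_combination -h)
  refine (hM.congruence hU fun z => if z then -M false false ^ 2 else M false true ^ 2).or_of_zero
    hU ?_ ?_ ?_ ?_
  · simp; ring
  · have := mul_ne_zero (mul_ne_zero h00 h01) hd'
    simp only [Fintype.sum_bool]
    convert this using 1
    simp; ring
  · have := mul_ne_zero (mul_ne_zero h00 h01) hd'
    simp only [Fintype.sum_bool]
    convert this using 1
    simp; ring
  · have := mul_ne_zero hs hd'
    simp only [Fintype.sum_bool]
    convert this using 1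
    simp; ring

/-- Apart from the case `M₀₀ = 0`, which is settled by scaling, a matrix with nonzero first row,
determinant and permanent is needed. A zero at `(0, 1)` or a vanishing permanent is repaired by one
preliminary congruence. -/
theorem RealizesBin.or_of_hard (hU : unaryConstraints ⊆ S) (hM : RealizesBin S M)
    (h : Hard M) : RealizesBin S binOR := by
  obtain ⟨hd, hoff, hdiag⟩ := h
  simp only [Bool.exists_bool, Bool.not_false, Bool.not_true] at hoff hdiag
  by_cases ha : M false false = 0
  · have hb : M false true ≠ 0 := fun h => hd (by simp [det2, ha, h])
    have hc : M true false ≠ 0 := fun h => hd (by simp [det2, ha, h])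
    exact hM.or_of_zero hU ha hb hc (hdiag.resolve_left fun h => h ha)
  by_cases hb : M false true = 0
  · have hc : M true false ≠ 0 := hoff.resolve_left fun h => h hb
    have hd0 : M true true ≠ 0 := fun h => hd (by simp [det2, hb, h])
    have h1 := mul_ne_zero (mul_ne_zero ha hc) (pow_ne_zero 2 hd0)
    -- These weights kill the entry at `(1, 1)`. The new matrix is symmetric, so its determinant and
    -- permanent are, up to sign, the square of the nonzero off-diagonal entry.
    refine (hM.congruence hU fun z => if z then -M true false ^ 2 else M true true ^ 2).or_of_sum_ne
      hU ?_ ?_ ?_ ?_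
    · simp [hb, ha, hd0]
    · simp [hb, ha, hc, hd0]
    · have := mul_ne_zero h1 h1
      simp only [det2, Fintype.sum_bool]
      refine fun h => this ?_
      simp [hb] at h
      linear_combination -h
    · have := mul_ne_zero h1 h1
      simp only [Fintype.sum_bool]
      refine fun h => this ?_
      simp only [hb, if_true] at h
      simp at h
      linear_combination h
  -- If the permanent vanishes, the weights `(2 M₀₁², M₀₀²)` are used. With `c = M₀₀ M₀₁² M₁₀`, the
  -- new off-diagonal entries are both `c` and the diagonal ones have product `9 c²`; so the
  -- determinant is `8 c²` and the permanent `10 c²`.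
  by_cases hs : M false false * M true true + M false true * M true false = 0
  · have hc : M true false ≠ 0 := by
      intro hc
      refine hd ?_
      rw [det2]
      linear_combination hs - 2 * M false true * hc
    have h1 := mul_ne_zero (mul_ne_zero ha (pow_ne_zero 2 hb)) hc
    have e00 : ∑ z, M false z * (if z then M false false ^ 2 else 2 * M false true ^ 2) * M false z
        = 3 * (M false false * M false true) ^ 2 := by
      simp; ring
    have e01 : ∑ z, M false z * (if z then M false false ^ 2 else 2 * M false true ^ 2) * M true z
        = M false false * M false true ^ 2 * M true false := by
      simp
      linear_combination M false false * M false true * hs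
    have e10 : ∑ z, M true z * (if z then M false false ^ 2 else 2 * M false true ^ 2) * M false z
        = M false false * M false true ^ 2 * M true false := by
      rw [← e01]
      exact Finset.sum_congr rfl fun z _ => by ring
    have e11 : ∑ z, M true z * (if z then M false false ^ 2 else 2 * M false true ^ 2) * M true z
        = 3 * (M false true * M true false) ^ 2 := by
      simp
      linear_combination (M false false * M true true - M false true * M true false) * hs
    refine (hM.congruence hU fun z =>
      if z then M false false ^ 2 else 2 * M false true ^ 2).or_of_sum_ne hU ?_ ?_ ?_ ?_
    · rw [e00]
      exact mul_ne_zero (by norm_num) (pow_ne_zero 2 (mul_ne_zero ha hb))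
    · rw [e01]
      exact h1
    · rw [det2, e00, e01, e10, e11]
      refine fun h => mul_ne_zero (by norm_num : (8 : ℂ) ≠ 0) (mul_ne_zero h1 h1) ?_
      linear_combination h
    · rw [e00, e01, e10, e11]
      refine fun h => mul_ne_zero (by norm_num : (10 : ℂ) ≠ 0) (mul_ne_zero h1 h1) ?_
      linear_combination h
  · exact hM.or_of_sum_ne hU ha hb hd hs

end Binary

/-! ### Logical gates -/

/-- The indicator function of `z = f x y`. -/
def gate (f : Bool → Bool → Bool) (x y z : Bool) : ℂ := if z = f x y then 1 else 0

/-- The gate for `f` is realizable on all triples of variables. -/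
def RealizesGate (S : Set Constraint) (f : Bool → Bool → Bool) : Prop :=
  ∀ (ι : Type) (x y z : ι), Realizable S fun σ : ι → Bool => gate f (σ x) (σ y) (σ z)

section Gates

variable {S : Set Constraint}

/-- The sum over `t` of OR with each of `x`, `y`, `z`, weighted 1 at `t = 1` and -1 at `t = 0`, is
`1 - xyz`. After multiplication by `(x ∨ z)(y ∨ z)` there remains `1 - xy` for `z = 1` and `xy` for
`z = 0`. -/
theorem RealizesGate.nand (hU : unaryConstraints ⊆ S) (h : RealizesBin S binOR) :
    RealizesGate S fun x y => !(x && y) := by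
  intro ι x y z
  have h1 := Realizable.sumBit (S := S) (ι := ι) (G := fun σ t => (if t then 1 else -1 : ℂ) *
    (binOR (σ x) t * binOR (σ y) t * binOR (σ z) t))
    ((Realizable.unary hU (fun t => if t then 1 else -1) _).mul
      (((h _ _ _).mul (h _ _ _)).mul (h _ _ _)))
  convert (h1.mul (h ι x z)).mul (h ι y z) using 2 with σ
  cases σ x <;> cases σ y <;> cases σ z <;> simp [gate, binOR]

theorem RealizesGate.not (h : RealizesGate S fun x y => !(x && y)) :
    RealizesGate S fun x _ => !x := by
  intro ι x y z
  convert h ι x x z using 2 with σ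
  cases σ x <;> cases σ z <;> simp [gate]

/-- A double negation is a copy, later used as equality. Composition of gates is exact: an
intermediate bit is a function of the inputs, so the sum over it has a single nonzero term. -/
theorem RealizesGate.fst (h : RealizesGate S fun x y => !(x && y)) :
    RealizesGate S fun x _ => x := by
  intro ι x y z
  convert Realizable.sumBit (S := S) (ι := ι)
    (G := fun σ t => gate (fun x _ => !x) (σ x) (σ x) t * gate (fun x _ => !x) t t (σ z))
    ((h.not _ _ _ _).mul (h.not _ _ _ _)) using 2 with σ
  cases σ x <;> cases σ z <;> simp [gate]

theorem RealizesGate.and (h : RealizesGate S fun x y => !(x && y)) :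
    RealizesGate S fun x y => x && y := by
  intro ι x y z
  convert Realizable.sumBit (S := S) (ι := ι)
    (G := fun σ t => gate (fun x y => !(x && y)) (σ x) (σ y) t * gate (fun x _ => !x) t t (σ z))
    ((h _ _ _ _).mul (h.not _ _ _ _)) using 2 with σ
  cases σ x <;> cases σ y <;> cases σ z <;> simp [gate]

theorem RealizesGate.or (h : RealizesGate S fun x y => !(x && y)) :
    RealizesGate S fun x y => x || y := by
  intro ι x y z
  have h1 : RealizesGate S fun x y => !x && y := by
    intro ι x y z
    convert Realizable.sumBit (S := S) (ι := ι)
      (G := fun σ t => gate (fun x _ => !x) (σ x) (σ x) t * gate (fun x y => x && y) t (σ y) (σ z))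
      ((h.not _ _ _ _).mul (h.and _ _ _ _)) using 2 with σ
    cases σ x <;> cases σ y <;> cases σ z <;> simp [gate]
  convert Realizable.sumBit (S := S) (ι := ι)
    (G := fun σ t => gate (fun x _ => !x) (σ y) (σ y) t *
      Finset.univ.sum fun s => gate (fun x y => !x && y) (σ x) t s * gate (fun x _ => !x) s s (σ z))
    ((h.not _ _ _ _).mul (Realizable.sumBit
      (G := fun σ s => gate (fun x y => !x && y) (σ (.inl x)) (σ (.inr ())) s *
        gate (fun x _ => !x) s s (σ (.inl z))) ((h1 _ _ _ _).mul (h.not _ _ _ _)))) using 2 with σ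
  cases σ x <;> cases σ y <;> cases σ z <;> simp [gate]

/-- Unary constraints together with a constraint outside `ED` realize all gates. -/
theorem realizesGate_nand_of_notMem_ED (hU : unaryConstraints ⊆ S) {f : Constraint} (hf : f ∈ S)
    (hED : f ∉ ED) : RealizesGate S fun x y => !(x && y) := by
  by_contra hn
  refine hED (mem_ED_of_not_hard f fun i j hij v hv => hn ?_)
  exact RealizesGate.nand hU ((RealizesBin.pairMatrix hU hf hij v).or_of_hard hU hv)

end Gates

/-! ### Sums over blocks of variables -/

/-- The sum of `G` over all values of the variables `c, …, c + m - 1`. -/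
def bsum (c : ℕ) : ℕ → ((ℕ → Bool) → ℂ) → (ℕ → Bool) → ℂ
  | 0, G, σ => G σ
  | m + 1, G, σ => ∑ b, bsum (c + 1) m G (Function.update σ c b)

theorem bsum_add (c m m' : ℕ) (G : (ℕ → Bool) → ℂ) (σ : ℕ → Bool) :
    bsum c (m + m') G σ = bsum c m (bsum (c + m) m' G) σ := by
  induction m generalizing c σ with
  | zero => simp [bsum]
  | succ m ih =>
    rw [Nat.add_right_comm]
    simp only [bsum, ih]
    rw [Nat.add_assoc c 1 m, Nat.add_comm 1 m]

/-- The value of `G` depends only on the variables below `n`. -/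
def Below (n : ℕ) (G : (ℕ → Bool) → ℂ) : Prop :=
  ∀ σ τ : ℕ → Bool, (∀ i < n, σ i = τ i) → G σ = G τ

theorem Below.mono {n n' : ℕ} {G : (ℕ → Bool) → ℂ} (h : Below n G) (hn : n ≤ n') : Below n' G :=
  fun σ τ hs => h σ τ fun i hi => hs i (hi.trans_le hn)

theorem Below.mul {n : ℕ} {G H : (ℕ → Bool) → ℂ} (hG : Below n G) (hH : Below n H) :
    Below n fun σ => G σ * H σ := fun σ τ h =>
  congrArg₂ (· * ·) (hG σ τ h) (hH σ τ h)

theorem below_apply {n i : ℕ} (hi : i < n) (g : Bool → ℂ) : Below n fun σ => g (σ i) :=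
  fun _ _ h => congrArg g (h i hi)

/-- New variables are always numbered upwards, so a nested construction is summed from its latest
block, with everything that does not see this block taken out. -/
theorem bsum_mul_left {c : ℕ} (m : ℕ) {H : (ℕ → Bool) → ℂ} (hH : Below c H)
    (G : (ℕ → Bool) → ℂ) (σ : ℕ → Bool) :
    bsum c m (fun σ => H σ * G σ) σ = H σ * bsum c m G σ := by
  induction m generalizing c σ with
  | zero => rfl
  | succ m ih =>
    simp only [bsum, ih (hH.mono (Nat.le_succ c)), Finset.mul_sum]
    refine Finset.sum_congr rfl fun b _ => ?_
    rw [hH (Function.update σ c b) σ fun i hi => Function.update_of_ne hi.ne _ _]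

theorem bsum_sum {α : Type} (s : Finset α) (c m : ℕ) (G : α → (ℕ → Bool) → ℂ) (σ : ℕ → Bool) :
    bsum c m (fun σ => ∑ a ∈ s, G a σ) σ = ∑ a ∈ s, bsum c m (G a) σ := by
  induction m generalizing c σ with
  | zero => rfl
  | succ m ih =>
    simp only [bsum, ih]
    exact Finset.sum_comm

theorem bsum_eq_sum (c m : ℕ) (G : (ℕ → Bool) → ℂ) (σ : ℕ → Bool) :
    bsum c m G σ = ∑ τ : Fin m → Bool,
      G fun i => if h : c ≤ i ∧ i - c < m then τ ⟨i - c, h.2⟩ else σ i := by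
  induction m generalizing c σ with
  | zero => simp [bsum]
  | succ m ih =>
    simp only [bsum, ih]
    rw [← Fintype.sum_prod_type']
    refine Fintype.sum_equiv (Fin.consEquiv fun _ => Bool) _ _ fun p => ?_
    obtain ⟨b, τ⟩ := p
    congr 1
    funext i
    simp only [Fin.consEquiv, Equiv.coe_fn_mk]
    rcases lt_trichotomy i c with h | rfl | h
    · rw [dif_neg (by omega), dif_neg (by omega), Function.update_of_ne h.ne]
    · rw [dif_neg (by omega), dif_pos (by omega), Function.update_self]
      simp
    · by_cases h' : i - c < m + 1
      · rw [dif_pos (by omega), dif_pos (by omega)]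
        have : (⟨i - c, by omega⟩ : Fin (m + 1)) = Fin.succ ⟨i - (c + 1), by omega⟩ :=
          Fin.ext (by simp; omega)
        simp only [this, Fin.cons_succ]
      · rw [dif_neg (by omega), dif_neg (by omega), Function.update_of_ne h.ne']

/-- All variables of the applied constraints are below `n`. -/
def AppsBelow (n : ℕ) (L : List (App ℕ)) : Prop := ∀ a ∈ L, ∀ i, a.scope i < n

theorem AppsBelow.mono {n n' : ℕ} {L : List (App ℕ)} (h : AppsBelow n L) (hn : n ≤ n') :
    AppsBelow n' L := fun a ha i => (h a ha i).trans_le hn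

theorem AppsBelow.append {n : ℕ} {L L' : List (App ℕ)} (h : AppsBelow n L) (h' : AppsBelow n L') :
    AppsBelow n (L ++ L') := fun a ha => (List.mem_append.1 ha).elim (h a) (h' a)

theorem AppsBelow.below {n : ℕ} {L : List (App ℕ)} (h : AppsBelow n L) : Below n (prodApps L) := by
  intro σ τ hs
  rw [prodApps, prodApps]
  congr 1
  refine List.map_congr_left fun a ha => ?_
  rw [App.eval, App.eval]
  congr 1
  funext i
  exact hs _ (h a ha i)

/-! ### Instances given by lists of constraints applied to natural numbers -/

/-- Forget the bound on the variables. -/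
def Application.toApp {n : ℕ} (a : Application n) : App ℕ := ⟨a.con, fun i => a.scope i⟩

/-- The code of an applied constraint. -/
def App.code (a : App ℕ) : List ℂ :=
  (a.con.arity : ℂ) :: (List.ofFn (fun i => (a.scope i : ℂ)) ++ table a.con.arity a.con.val)

/-- The assignment `σ` is a dummy: `bsum` overwrites every variable that a constraint of the
instance can see. -/
theorem CSPInst.value_eq {F : Set Constraint} (I : CSPInst F) (σ : ℕ → Bool) :
    I.value = bsum 0 I.n (prodApps (I.apps.map Application.toApp)) σ := by
  rw [bsum_eq_sum, CSPInst.value]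
  refine Finset.sum_congr rfl fun τ _ => ?_
  simp [prodApps, Function.comp_def, App.eval, Application.toApp]

theorem CSPInst.code_eq {F : Set Constraint} (I : CSPInst F) :
    I.code = List.replicate I.n 1 ++ 0 :: (I.apps.map Application.toApp).flatMap App.code := by
  rw [CSPInst.code, List.flatMap_map]
  rfl

/-- The instance with `n` variables and the given applied constraints. -/
def CSPInst.ofApps {F : Set Constraint} (n : ℕ) (L : List (App ℕ)) (hn : AppsBelow n L)
    (hL : ∀ a ∈ L, a.con ∈ F) : CSPInst F where
  n := n
  apps := L.attach.map fun a => ⟨a.1.con, fun i => ⟨a.1.scope i, hn a.1 a.2 i⟩⟩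
  mem := by
    intro a ha
    obtain ⟨b, -, rfl⟩ := List.mem_map.1 ha
    exact hL b.1 b.2

theorem CSPInst.ofApps_toApp {F : Set Constraint} (n : ℕ) (L : List (App ℕ)) (hn : AppsBelow n L)
    (hL : ∀ a ∈ L, a.con ∈ F) : (ofApps n L hn hL).apps.map Application.toApp = L := by
  simp [ofApps, Application.toApp, Function.comp_def]

/-- Weights as a unary constraint. -/
def unaryApp (v : ℕ) (w₀ w₁ : ℂ) : App ℕ :=
  ⟨⟨1, le_rfl, fun x => if x 0 then w₁ else w₀⟩, fun _ => v⟩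

theorem unaryApp_eval (v : ℕ) (w₀ w₁ : ℂ) (σ : ℕ → Bool) :
    (unaryApp v w₀ w₁).eval σ = if σ v then w₁ else w₀ := rfl

theorem unaryApp_code (v : ℕ) (w₀ w₁ : ℂ) : (unaryApp v w₀ w₁).code = [1, (v : ℂ), w₀, w₁] := by
  simp [unaryApp, App.code, table]

/-! ### Gadgets -/

/-- A gadget for the gate of `f`, with auxiliary variables. -/
structure Gadget (S : Set Constraint) (f : Bool → Bool → Bool) where
  m : ℕ
  apps : List (App (Fin 3 ⊕ Fin m))
  mem : ∀ a ∈ apps, a.con ∈ S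
  spec : ∀ σ, gate f (σ 0) (σ 1) (σ 2) = ∑ τ : Fin m → Bool, prodApps apps (Sum.elim σ τ)

theorem RealizesGate.gadget {S : Set Constraint} {f : Bool → Bool → Bool} (h : RealizesGate S f) :
    Nonempty (Gadget S f) := by
  obtain ⟨κ, _, _, L, hL, hspec⟩ := h (Fin 3) 0 1 2
  let e := Fintype.equivFin κ
  refine ⟨⟨Fintype.card κ, L.map (App.map (Sum.map id e)), ?_, fun σ => ?_⟩⟩
  · intro a ha
    obtain ⟨b, hb, rfl⟩ := List.mem_map.1 ha
    exact hL b hb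
  · refine (hspec σ).trans ?_
    refine Fintype.sum_equiv (Equiv.arrowCongr e (Equiv.refl Bool)) _ _ fun τ => ?_
    rw [prodApps_map]
    congr 1
    funext i
    rcases i with i | i <;> simp [Equiv.arrowCongr]

section Gadget

variable {S : Set Constraint} {f : Bool → Bool → Bool}

/-- The position of a gadget variable. -/
def place (x y z c : ℕ) {m : ℕ} : Fin 3 ⊕ Fin m → ℕ := Sum.elim ![x, y, z] fun j => c + j

/-- The gadget on the variables `x`, `y`, `z`, with auxiliary variables from `c` on. -/
def Gadget.inst (Γ : Gadget S f) (x y z c : ℕ) : List (App ℕ) :=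
  Γ.apps.map (App.map (place x y z c))

theorem Gadget.inst_mem (Γ : Gadget S f) (x y z c : ℕ) : ∀ a ∈ Γ.inst x y z c, a.con ∈ S := by
  intro a ha
  obtain ⟨b, hb, rfl⟩ := List.mem_map.1 ha
  exact Γ.mem b hb

theorem Gadget.inst_below (Γ : Gadget S f) {x y z c : ℕ} (hx : x < c) (hy : y < c) (hz : z < c) :
    AppsBelow (c + Γ.m) (Γ.inst x y z c) := by
  intro a ha i
  obtain ⟨b, hb, rfl⟩ := List.mem_map.1 ha
  simp only [App.map]
  rcases b.scope i with j | j
  · fin_cases j <;> simp [place] <;> omega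
  · simp [place]

theorem Gadget.bsum_inst (Γ : Gadget S f) {x y z c : ℕ} (hx : x < c) (hy : y < c) (hz : z < c)
    (σ : ℕ → Bool) :
    bsum c Γ.m (prodApps (Γ.inst x y z c)) σ = gate f (σ x) (σ y) (σ z) := by
  have := Γ.spec ![σ x, σ y, σ z]
  simp only [Matrix.cons_val] at this
  rw [this, bsum_eq_sum]
  refine Finset.sum_congr rfl fun τ _ => ?_
  rw [Gadget.inst, prodApps_map]
  congr 1
  funext j
  rcases j with j | j
  · fin_cases j <;> simp [place, hx.not_ge, hy.not_ge, hz.not_ge]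
  · simp [place]

end Gadget

/-- Gadgets for the logical connectives. -/
structure Kit (S : Set Constraint) where
  conj : Gadget S fun x y => x && y
  disj : Gadget S fun x y => x || y
  neg : Gadget S fun x _ => !x
  eq : Gadget S fun x _ => x

theorem RealizesGate.kit {S : Set Constraint} (h : RealizesGate S fun x y => !(x && y)) :
    Nonempty (Kit S) :=
  let ⟨a⟩ := h.and.gadget
  let ⟨b⟩ := h.or.gadget
  let ⟨c⟩ := h.not.gadget
  let ⟨d⟩ := h.fst.gadget
  ⟨⟨a, b, c, d⟩⟩

/-! ### Circuits of formulas -/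

section Circuit

variable {S : Set Constraint} (K : Kit S)

/-- The number of wires of the circuit of a formula, without the root. -/
def Formula.width : Formula → ℕ
  | .var _ => 0
  | .neg φ => 1 + K.neg.m + φ.width
  | .disj φ ψ => 2 + K.disj.m + φ.width + ψ.width
  | .conj φ ψ => 2 + K.conj.m + φ.width + ψ.width

/-- The constraints of the circuit of a formula with root `z` and other wires from `c` on. -/
def Formula.emit : Formula → ℕ → ℕ → List (App ℕ)
  | .var _, _, _ => []
  | .neg φ, z, c => φ.emit c (c + (1 + K.neg.m)) ++ K.neg.inst c c z (c + 1)
  | .disj φ ψ, z, c => ψ.emit (c + 1) (c + (2 + K.disj.m + φ.width K)) ++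
      (φ.emit c (c + (2 + K.disj.m)) ++ K.disj.inst c (c + 1) z (c + 2))
  | .conj φ ψ, z, c => ψ.emit (c + 1) (c + (2 + K.conj.m + φ.width K)) ++
      (φ.emit c (c + (2 + K.conj.m)) ++ K.conj.inst c (c + 1) z (c + 2))

/-- The occurrences of variables, with their wires. -/
def Formula.occ : Formula → ℕ → ℕ → List (ℕ × ℕ)
  | .var i, z, _ => [(i, z)]
  | .neg φ, _, c => φ.occ c (c + (1 + K.neg.m))
  | .disj φ ψ, _, c => ψ.occ (c + 1) (c + (2 + K.disj.m + φ.width K)) ++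
      φ.occ c (c + (2 + K.disj.m))
  | .conj φ ψ, _, c => ψ.occ (c + 1) (c + (2 + K.conj.m + φ.width K)) ++
      φ.occ c (c + (2 + K.conj.m))

/-- All occurrences carry the values prescribed by `ρ`. -/
def occMatch (ρ : ℕ → Bool) (O : List (ℕ × ℕ)) (σ : ℕ → Bool) : ℂ :=
  (O.map fun p => if σ p.2 = ρ p.1 then 1 else 0).prod

theorem occMatch_append (ρ : ℕ → Bool) (O O' : List (ℕ × ℕ)) (σ : ℕ → Bool) :
    occMatch ρ (O ++ O') σ = occMatch ρ O σ * occMatch ρ O' σ := by simp [occMatch]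

theorem occMatch_below (ρ : ℕ → Bool) {O : List (ℕ × ℕ)} {n : ℕ} (h : ∀ p ∈ O, p.2 < n) :
    Below n (occMatch ρ O) := by
  intro σ τ hs
  rw [occMatch, occMatch]
  congr 1
  exact List.map_congr_left fun p hp => by rw [hs _ (h p hp)]

theorem Formula.emit_mem (φ : Formula) (z c : ℕ) : ∀ a ∈ φ.emit K z c, a.con ∈ S := by
  induction φ generalizing z c with
  | var => simp [emit]
  | neg φ ih =>
    intro a ha
    simp only [emit, List.mem_append] at ha
    rcases ha with h | h
    · exact ih _ _ a h
    · exact K.neg.inst_mem _ _ _ _ a h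
  | disj φ ψ ih1 ih2 =>
    intro a ha
    simp only [emit, List.mem_append] at ha
    rcases ha with h | h | h
    · exact ih2 _ _ a h
    · exact ih1 _ _ a h
    · exact K.disj.inst_mem _ _ _ _ a h
  | conj φ ψ ih1 ih2 =>
    intro a ha
    simp only [emit, List.mem_append] at ha
    rcases ha with h | h | h
    · exact ih2 _ _ a h
    · exact ih1 _ _ a h
    · exact K.conj.inst_mem _ _ _ _ a h

theorem Formula.emit_below (φ : Formula) {z c : ℕ} (hz : z < c) :
    AppsBelow (c + φ.width K) (φ.emit K z c) := by
  induction φ generalizing z c with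
  | var => simp [emit, AppsBelow]
  | neg φ ih =>
    exact ((ih (by omega)).mono (by simp only [width]; omega)).append
      ((K.neg.inst_below (by omega) (by omega) (by omega)).mono (by simp only [width]; omega))
  | disj φ ψ ih1 ih2 =>
    exact ((ih2 (by omega)).mono (by simp only [width]; omega)).append
      (((ih1 (by omega)).mono (by simp only [width]; omega)).append
      ((K.disj.inst_below (by omega) (by omega) (by omega)).mono (by simp only [width]; omega)))
  | conj φ ψ ih1 ih2 =>
    exact ((ih2 (by omega)).mono (by simp only [width]; omega)).append
      (((ih1 (by omega)).mono (by simp only [width]; omega)).append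
      ((K.conj.inst_below (by omega) (by omega) (by omega)).mono (by simp only [width]; omega)))

theorem Formula.occ_below (φ : Formula) {z c : ℕ} (hz : z < c) :
    ∀ p ∈ φ.occ K z c, p.2 < c + φ.width K := by
  induction φ generalizing z c with
  | var => simpa [occ, width] using hz
  | neg φ ih =>
    intro p hp
    have := ih (by omega) p hp
    simp only [width]
    omega
  | disj φ ψ ih1 ih2 | conj φ ψ ih1 ih2 =>
    intro p hp
    simp only [width]
    rcases List.mem_append.1 hp with h | h
    · have := ih2 (by omega) p h
      omega
    · have := ih1 (by omega) p h
      omega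

theorem Formula.occ_mem_vars (φ : Formula) (z c : ℕ) : ∀ p ∈ φ.occ K z c, p.1 ∈ φ.vars := by
  induction φ generalizing z c with
  | var => simp [occ, vars]
  | neg φ ih => exact ih _ _
  | disj φ ψ ih1 ih2 | conj φ ψ ih1 ih2 =>
    intro p hp
    simp only [vars, Finset.mem_union]
    rcases List.mem_append.1 hp with h | h
    · exact Or.inr (ih2 _ _ p h)
    · exact Or.inl (ih1 _ _ p h)

/-- The indicator function of the event that a wire carries a given value. -/
def wireIs (z : ℕ) (b : Bool) (σ : ℕ → Bool) : ℂ := if σ z = b then 1 else 0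

theorem wireIs_below {z n : ℕ} (h : z < n) (b : Bool) : Below n (wireIs z b) :=
  below_apply h fun x => if x = b then 1 else 0

/-- The variables from `c` on are the two child wires, the auxiliary variables of the gadget, the
block of the first subformula and that of the second. Summation from the last block backwards forces
the child wires to `b₁` and `b₂`, and then the gate alone remains. -/
theorem bsum_binary_gate {f : Bool → Bool → Bool} (Γ : Gadget S f) {z c w₁ w₂ : ℕ} (hz : z < c)
    (b₁ b₂ : Bool) (G₁ G₂ : (ℕ → Bool) → ℂ) (hG₁ : Below (c + (2 + Γ.m) + w₁) G₁)
    (h₁ : ∀ σ, bsum (c + (2 + Γ.m)) w₁ G₁ σ = wireIs c b₁ σ)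
    (h₂ : ∀ σ, bsum (c + (2 + Γ.m + w₁)) w₂ G₂ σ = wireIs (c + 1) b₂ σ) (σ : ℕ → Bool) :
    bsum c (2 + Γ.m + w₁ + w₂)
      (fun σ => prodApps (Γ.inst c (c + 1) z (c + 2)) σ * G₁ σ * G₂ σ) σ = wireIs z (f b₁ b₂) σ := by
  have hΓ : AppsBelow (c + (2 + Γ.m)) (Γ.inst c (c + 1) z (c + 2)) :=
    (Γ.inst_below (by omega) (by omega) (by omega)).mono (by omega)
  rw [bsum_add]
  have e₂ : bsum (c + (2 + Γ.m + w₁)) w₂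
      (fun σ => prodApps (Γ.inst c (c + 1) z (c + 2)) σ * G₁ σ * G₂ σ)
      = fun σ => (wireIs (c + 1) b₂ σ * prodApps (Γ.inst c (c + 1) z (c + 2)) σ) * G₁ σ := by
    funext σ
    rw [bsum_mul_left _ ((hΓ.below.mono (by omega)).mul (hG₁.mono (by omega))), h₂]
    ring
  rw [e₂, bsum_add]
  have e₁ : bsum (c + (2 + Γ.m)) w₁
      (fun σ => (wireIs (c + 1) b₂ σ * prodApps (Γ.inst c (c + 1) z (c + 2)) σ) * G₁ σ)
      = fun σ => (wireIs c b₁ σ * wireIs (c + 1) b₂ σ) *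
          prodApps (Γ.inst c (c + 1) z (c + 2)) σ := by
    funext σ
    rw [bsum_mul_left _ ((wireIs_below (by omega) _).mul hΓ.below), h₁]
    ring
  rw [e₁, bsum_add]
  have e₀ : bsum (c + 2) Γ.m (fun σ => (wireIs c b₁ σ * wireIs (c + 1) b₂ σ) *
          prodApps (Γ.inst c (c + 1) z (c + 2)) σ)
      = fun σ => (wireIs c b₁ σ * wireIs (c + 1) b₂ σ) * gate f (σ c) (σ (c + 1)) (σ z) := by
    funext σ
    rw [bsum_mul_left _ ((wireIs_below (by omega) _).mul (wireIs_below (by omega) _)),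
      Γ.bsum_inst (by omega) (by omega) (by omega)]
  rw [e₀]
  have hz1 : z ≠ c + 1 := by omega
  cases b₁ <;> cases b₂ <;> simp [bsum, wireIs, gate, hz.ne, hz1]

/-- Once the leaves are prescribed by `ρ`, every wire is forced, so the sum over the internal wires
has one term of weight 1. Occurrences of the same variable are separate leaves here; they are
identified only when the weights are added. -/
theorem Formula.bsum_emit (φ : Formula) (ρ : ℕ → Bool) {z c : ℕ} (hz : z < c) (σ : ℕ → Bool) :
    bsum c (φ.width K) (fun σ => prodApps (φ.emit K z c) σ * occMatch ρ (φ.occ K z c) σ) σ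
      = wireIs z (φ.eval ρ) σ := by
  induction φ generalizing z c σ with
  | var i =>
    simp only [bsum, width, emit, occ, occMatch, wireIs, eval, prodApps_nil, one_mul, List.map_cons,
      List.map_nil, List.prod_singleton]
    rfl
  | neg φ ih =>
    have hΓ : AppsBelow (c + (1 + K.neg.m)) (K.neg.inst c c z (c + 1)) :=
      (K.neg.inst_below (by omega) (by omega) (by omega)).mono (by omega)
    have e₁ : bsum (c + (1 + K.neg.m)) (φ.width K)
        (fun σ => prodApps ((Formula.neg φ).emit K z c) σ *
          occMatch ρ ((Formula.neg φ).occ K z c) σ)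
        = fun σ => wireIs c (φ.eval ρ) σ * prodApps (K.neg.inst c c z (c + 1)) σ := by
      funext σ
      simp only [emit, occ, prodApps_append]
      rw [mul_comm (wireIs _ _ _), ← ih (z := c) (c := c + (1 + K.neg.m)) (by omega),
        ← bsum_mul_left _ hΓ.below]
      congr 1
      funext σ
      ring
    rw [width, bsum_add, e₁, bsum_add]
    have e₀ : bsum (c + 1) K.neg.m
        (fun σ => wireIs c (φ.eval ρ) σ * prodApps (K.neg.inst c c z (c + 1)) σ)
        = fun σ => wireIs c (φ.eval ρ) σ * gate (fun x _ => !x) (σ c) (σ c) (σ z) := by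
      funext σ
      rw [bsum_mul_left _ (wireIs_below (by omega) _),
        K.neg.bsum_inst (by omega) (by omega) (by omega)]
    rw [e₀]
    cases h : φ.eval ρ <;> simp [bsum, wireIs, gate, hz.ne, eval, h]
  | disj φ ψ ih1 ih2 =>
    rw [eval, width, ← bsum_binary_gate K.disj hz (φ.eval ρ) (ψ.eval ρ) _ _
      (((φ.emit_below K (by omega)).below).mul (occMatch_below ρ (φ.occ_below K (by omega))))
      (ih1 (by omega)) (ih2 (by omega))]
    congr 1
    funext σ
    simp only [emit, occ, prodApps_append, occMatch_append]
    ring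
  | conj φ ψ ih1 ih2 =>
    rw [eval, width, ← bsum_binary_gate K.conj hz (φ.eval ρ) (ψ.eval ρ) _ _
      (((φ.emit_below K (by omega)).below).mul (occMatch_below ρ (φ.occ_below K (by omega))))
      (ih1 (by omega)) (ih2 (by omega))]
    congr 1
    funext σ
    simp only [emit, occ, prodApps_append, occMatch_append]
    ring

/-! ### Weights -/

/-- The number of auxiliary variables of the equalities for the occurrences of variable `i`. -/
def eqWidth (i : ℕ) : List (ℕ × ℕ) → ℕ
  | [] => 0
  | p :: O => (if i = p.1 then K.eq.m else 0) + eqWidth i O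

/-- Equality of `v` with all occurrences of variable `i`. -/
def eqEmit (i v : ℕ) : List (ℕ × ℕ) → ℕ → List (App ℕ)
  | [], _ => []
  | p :: O, c => if i = p.1 then eqEmit i v O (c + K.eq.m) ++ K.eq.inst v v p.2 c
      else eqEmit i v O c

theorem eqEmit_mem (i v : ℕ) (O : List (ℕ × ℕ)) (c : ℕ) : ∀ a ∈ eqEmit K i v O c, a.con ∈ S := by
  induction O generalizing c with
  | nil => simp [eqEmit]
  | cons p O ih =>
    intro a ha
    rw [eqEmit] at ha
    split_ifs at ha
    · rcases List.mem_append.1 ha with h | h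
      · exact ih _ a h
      · exact K.eq.inst_mem _ _ _ _ a h
    · exact ih _ a ha

theorem eqEmit_below (i : ℕ) {v : ℕ} {O : List (ℕ × ℕ)} {c : ℕ} (hv : v < c)
    (hO : ∀ p ∈ O, p.2 < c) : AppsBelow (c + eqWidth K i O) (eqEmit K i v O c) := by
  induction O generalizing c with
  | nil => simp [eqEmit, AppsBelow]
  | cons p O ih =>
    have hp := hO p (by simp)
    have hO' : ∀ p ∈ O, p.2 < c := fun q hq => hO q (by simp [hq])
    rw [eqEmit, eqWidth]
    split_ifs
    · exact ((ih (hv.trans_le (by omega)) fun q hq => (hO' q hq).trans_le (by omega)).mono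
        (by omega)).append ((K.eq.inst_below hv hv hp).mono (by omega))
    · exact (ih hv hO').mono (by omega)

/-- Each copy gadget sums to the condition that its occurrence agrees with `v`. These conditions
involve only variables below `c`, so they leave the remaining sums. -/
theorem bsum_eqEmit (i : ℕ) {v : ℕ} {O : List (ℕ × ℕ)} {c : ℕ} (hv : v < c)
    (hO : ∀ p ∈ O, p.2 < c) (σ : ℕ → Bool) :
    bsum c (eqWidth K i O) (prodApps (eqEmit K i v O c)) σ
      = (O.map fun p => if i = p.1 then wireIs p.2 (σ v) σ else 1).prod := by
  induction O generalizing c σ with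
  | nil => simp [eqEmit, eqWidth, bsum]
  | cons p O ih =>
    have hp := hO p (by simp)
    have hO' : ∀ p ∈ O, p.2 < c := fun q hq => hO q (by simp [hq])
    rw [eqEmit, eqWidth, List.map_cons, List.prod_cons]
    split_ifs with h
    · rw [bsum_add]
      have e : bsum (c + K.eq.m) (eqWidth K i O)
          (prodApps (eqEmit K i v O (c + K.eq.m) ++ K.eq.inst v v p.2 c))
          = fun σ => (O.map fun p => if i = p.1 then wireIs p.2 (σ v) σ else 1).prod *
            prodApps (K.eq.inst v v p.2 c) σ := by
        funext σ
        have := ih (c := c + K.eq.m) (by omega) (fun q hq => (hO' q hq).trans_le (by omega)) σ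
        rw [mul_comm, ← this, ← bsum_mul_left _ (K.eq.inst_below hv hv hp).below]
        congr 1
        funext σ
        simp [mul_comm]
      have hb : Below c fun σ => (O.map fun p => if i = p.1 then wireIs p.2 (σ v) σ else 1).prod := by
        intro σ τ hs
        dsimp only
        congr 1
        refine List.map_congr_left fun q hq => ?_
        rw [wireIs, wireIs, hs v hv, hs _ (hO' q hq)]
      rw [e, bsum_mul_left _ hb, K.eq.bsum_inst hv hv hp, mul_comm]
      rfl
    · rw [zero_add, ih hv hO', one_mul]

/-- The number of variables for the weights `T` and occurrences `O`. -/
def weightWidth (O : List (ℕ × ℕ)) : List (ℕ × ℂ × ℂ) → ℕ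
  | [] => 0
  | t :: T => 1 + eqWidth K t.1 O + weightWidth O T

/-- The constraints for the weights `T` and occurrences `O`. -/
def weightEmit (O : List (ℕ × ℕ)) : List (ℕ × ℂ × ℂ) → ℕ → List (App ℕ)
  | [], _ => []
  | t :: T, c => weightEmit O T (c + (1 + eqWidth K t.1 O)) ++
      (eqEmit K t.1 c O (c + 1) ++ [unaryApp c t.2.1 t.2.2])

theorem weightEmit_mem (hU : unaryConstraints ⊆ S) (O : List (ℕ × ℕ)) (T : List (ℕ × ℂ × ℂ))
    (c : ℕ) : ∀ a ∈ weightEmit K O T c, a.con ∈ S := by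
  induction T generalizing c with
  | nil => simp [weightEmit]
  | cons t T ih =>
    intro a ha
    simp only [weightEmit, List.mem_append, List.mem_singleton] at ha
    rcases ha with h | h | rfl
    · exact ih _ a h
    · exact eqEmit_mem K _ _ _ _ a h
    · exact hU rfl

theorem unaryApp_below {v n : ℕ} (h : v < n) (w₀ w₁ : ℂ) : AppsBelow n [unaryApp v w₀ w₁] := by
  intro a ha i
  rw [List.mem_singleton] at ha
  subst ha
  exact h

theorem weightEmit_below {O : List (ℕ × ℕ)} (T : List (ℕ × ℂ × ℂ)) {c : ℕ}
    (hO : ∀ p ∈ O, p.2 < c) : AppsBelow (c + weightWidth K O T) (weightEmit K O T c) := by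
  induction T generalizing c with
  | nil => simp [weightEmit, AppsBelow]
  | cons t T ih =>
    rw [weightEmit, weightWidth]
    refine ((ih fun q hq => (hO q hq).trans_le (by omega)).mono (by omega)).append (AppsBelow.append
      ((eqEmit_below K t.1 (by omega) fun q hq => (hO q hq).trans_le (by omega)).mono (by omega))
      (unaryApp_below (by omega) _ _))

/-- The contribution of one weighted variable. -/
def weightTerm (O : List (ℕ × ℕ)) (t : ℕ × ℂ × ℂ) (b : Bool) (σ : ℕ → Bool) : ℂ :=
  (if b then t.2.2 else t.2.1) * (O.map fun p => if t.1 = p.1 then wireIs p.2 b σ else 1).prod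

theorem weightTerm_below {O : List (ℕ × ℕ)} (t : ℕ × ℂ × ℂ) (b : Bool) {n : ℕ}
    (hO : ∀ p ∈ O, p.2 < n) : Below n (weightTerm O t b) := by
  intro σ τ hs
  rw [weightTerm, weightTerm]
  congr 2
  refine List.map_congr_left fun q hq => ?_
  rw [wireIs, wireIs, hs _ (hO q hq)]

/-- Given the leaves, distinct formula variables do not interact, so the sum is a product. In each
factor, `b` is the value of the new variable `c` that carries the weight. -/
theorem bsum_weightEmit {O : List (ℕ × ℕ)} (T : List (ℕ × ℂ × ℂ)) {c : ℕ}
    (hO : ∀ p ∈ O, p.2 < c) (σ : ℕ → Bool) :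
    bsum c (weightWidth K O T) (prodApps (weightEmit K O T c)) σ
      = (T.map fun t => ∑ b, weightTerm O t b σ).prod := by
  induction T generalizing c σ with
  | nil => simp [weightEmit, weightWidth, bsum]
  | cons t T ih =>
    have hO1 : ∀ p ∈ O, p.2 < c + 1 := fun q hq => (hO q hq).trans_le (by omega)
    rw [weightEmit, weightWidth, bsum_add, List.map_cons, List.prod_cons]
    have hb : ∀ n, (∀ p ∈ O, p.2 < n) →
        Below n fun σ => (T.map fun t => ∑ b, weightTerm O t b σ).prod := by
      intro n hn σ τ hs
      dsimp only
      congr 1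
      refine List.map_congr_left fun t _ => Finset.sum_congr rfl fun b _ => ?_
      exact weightTerm_below t b hn σ τ hs
    have e : bsum (c + (1 + eqWidth K t.1 O)) (weightWidth K O T)
        (prodApps (weightEmit K O T (c + (1 + eqWidth K t.1 O)) ++
          (eqEmit K t.1 c O (c + 1) ++ [unaryApp c t.2.1 t.2.2])))
        = fun σ => (T.map fun t => ∑ b, weightTerm O t b σ).prod *
          ((unaryApp c t.2.1 t.2.2).eval σ * prodApps (eqEmit K t.1 c O (c + 1)) σ) := by
      funext σ
      have hu : Below (c + (1 + eqWidth K t.1 O)) fun σ =>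
          (unaryApp c t.2.1 t.2.2).eval σ * prodApps (eqEmit K t.1 c O (c + 1)) σ :=
        (below_apply (i := c) (by omega) fun b => if b then t.2.2 else t.2.1).mul
          (((eqEmit_below K t.1 (v := c) (by omega) hO1).mono (by omega)).below)
      rw [← ih (c := c + (1 + eqWidth K t.1 O)) (fun q hq => (hO q hq).trans_le (by omega)) σ,
        mul_comm, ← bsum_mul_left _ hu]
      congr 1
      funext σ
      simp only [prodApps_append, prodApps_cons, prodApps_nil]
      ring
    rw [e, bsum_mul_left _ (hb c hO), bsum_add, mul_comm]
    congr 1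
    have e₀ : bsum (c + 1) (eqWidth K t.1 O)
        (fun σ => (unaryApp c t.2.1 t.2.2).eval σ * prodApps (eqEmit K t.1 c O (c + 1)) σ)
        = fun σ => weightTerm O t (σ c) σ := by
      funext σ
      have hu : Below (c + 1) fun σ => (unaryApp c t.2.1 t.2.2).eval σ :=
        below_apply (i := c) (by omega) fun b => if b then t.2.2 else t.2.1
      rw [bsum_mul_left _ hu, bsum_eqEmit K _ (by omega) hO1]
      rfl
    rw [e₀]
    simp only [bsum, Function.update_self]
    refine Finset.sum_congr rfl fun b _ => ?_
    exact weightTerm_below t b hO _ _ fun i hi => Function.update_of_ne hi.ne _ _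

end Circuit

/-! ### The value of the circuit of a weighted formula -/

/-- The variables of an instance with their weights. -/
def SATInst.triples (I : SATInst) : List (ℕ × ℂ × ℂ) :=
  ((Finset.univ : Finset I.formula.vars).sort (· ≤ ·)).map fun x : I.formula.vars =>
    ((x : ℕ), I.weight x false, I.weight x true)

theorem SATInst.code_eq (I : SATInst) : I.code = I.formula.code ++
    I.triples.flatMap fun t => [(t.1 : ℂ), t.2.1, t.2.2] := by
  rw [SATInst.code, SATInst.triples, List.flatMap_map]

/-- The product of sums expands into a sum over assignments `ρ`. Each occurrence belongs to exactly
one variable, so the product of the conditions over all variables collapses to `occMatch`. -/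
theorem SATInst.prod_triples (I : SATInst) {O : List (ℕ × ℕ)} (hO : ∀ p ∈ O, p.1 ∈ I.formula.vars)
    (σ : ℕ → Bool) : (I.triples.map fun t => ∑ b, weightTerm O t b σ).prod
      = ∑ ρ : I.formula.vars → Bool, (∏ x, I.weight x (ρ x)) * occMatch (extend ρ) O σ := by
  have h1 : (I.triples.map fun t => ∑ b, weightTerm O t b σ).prod
      = ∏ x : I.formula.vars, ∑ b,
        weightTerm O ((x : ℕ), I.weight x false, I.weight x true) b σ := by
    rw [SATInst.triples, List.map_map, Finset.prod, ← Finset.sort_eq _ (· ≤ ·), Multiset.map_coe,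
      Multiset.prod_coe]
    rfl
  rw [h1, Finset.prod_univ_sum, Fintype.piFinset_univ]
  refine Finset.sum_congr rfl fun ρ _ => ?_
  simp only [weightTerm]
  rw [Finset.prod_mul_distrib]
  congr 1
  · refine Finset.prod_congr rfl fun x _ => ?_
    cases ρ x <;> rfl
  · clear h1
    induction O with
    | nil => simp [occMatch]
    | cons p O ih =>
      simp only [List.map_cons, List.prod_cons, Finset.prod_mul_distrib, occMatch]
      rw [ih fun q hq => hO q (by simp [hq])]
      congr 1
      have hp := hO p (by simp)
      rw [Finset.prod_eq_single ⟨p.1, hp⟩]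
      · simp [wireIs, extend, hp]
      · intro x _ hx
        rw [if_neg fun h => hx (Subtype.ext h)]
      · simp

section Value

variable {S : Set Constraint} (K : Kit S)

/-- The constraints that represent an instance. -/
def SATInst.emit (I : SATInst) : List (App ℕ) :=
  weightEmit K (I.formula.occ K 0 1) I.triples (1 + I.formula.width K) ++
    (I.formula.emit K 0 1 ++ [unaryApp 0 0 1])

/-- The number of variables of the constraints that represent an instance. -/
def SATInst.width (I : SATInst) : ℕ :=
  1 + I.formula.width K + weightWidth K (I.formula.occ K 0 1) I.triples

theorem SATInst.emit_below (I : SATInst) : AppsBelow (I.width K) (I.emit K) := by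
  have h : 1 + I.formula.width K ≤ I.width K := Nat.le_add_right _ _
  exact (weightEmit_below K I.triples (I.formula.occ_below K Nat.one_pos)).append
    (((I.formula.emit_below K Nat.one_pos).mono h).append (unaryApp_below (by omega) _ _))

theorem SATInst.emit_mem (hU : unaryConstraints ⊆ S) (I : SATInst) :
    ∀ a ∈ I.emit K, a.con ∈ S := by
  intro a ha
  simp only [emit, List.mem_append, List.mem_singleton] at ha
  rcases ha with h | h | rfl
  · exact weightEmit_mem K hU _ _ _ a h
  · exact I.formula.emit_mem K _ _ a h
  · exact hU rfl

/-- Summing the weight block turns the constraints into a sum over assignments `ρ` of the formula.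
For each `ρ` the circuit forces the root to the truth value, and the unary constraint `(0, 1)` on
wire 0 keeps the satisfying ones. -/
theorem SATInst.bsum_emit (I : SATInst) (σ : ℕ → Bool) :
    bsum 0 (I.width K) (prodApps (I.emit K)) σ = I.value := by
  set O := I.formula.occ K 0 1 with hOdef
  have hO : ∀ p ∈ O, p.2 < 1 + I.formula.width K := I.formula.occ_below K Nat.one_pos
  rw [width, bsum_add, zero_add]
  have e : bsum (1 + I.formula.width K) (weightWidth K O I.triples) (prodApps (I.emit K))
      = fun σ => ∑ ρ : I.formula.vars → Bool, (∏ x, I.weight x (ρ x)) *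
        (wireIs 0 true σ * (prodApps (I.formula.emit K 0 1) σ * occMatch (extend ρ) O σ)) := by
    funext σ
    have hb : Below (1 + I.formula.width K) fun σ =>
        wireIs 0 true σ * prodApps (I.formula.emit K 0 1) σ :=
      (wireIs_below (by omega) _).mul (I.formula.emit_below K Nat.one_pos).below
    have h2 : prodApps (I.emit K) = fun σ => (wireIs 0 true σ * prodApps (I.formula.emit K 0 1) σ) *
        prodApps (weightEmit K O I.triples (1 + I.formula.width K)) σ := by
      funext σ
      simp only [emit, prodApps_append, prodApps_cons, prodApps_nil, unaryApp_eval, wireIs]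
      ring
    rw [h2, bsum_mul_left _ hb, bsum_weightEmit K _ hO,
      I.prod_triples (I.formula.occ_mem_vars K 0 1), Finset.mul_sum]
    refine Finset.sum_congr rfl fun ρ _ => ?_
    ring
  rw [e, bsum_sum, SATInst.value]
  refine Finset.sum_congr rfl fun ρ _ => ?_
  rw [bsum_mul_left _ fun _ _ _ => rfl, bsum_add]
  have e₁ : bsum (0 + 1) (I.formula.width K) (fun σ => wireIs 0 true σ *
        (prodApps (I.formula.emit K 0 1) σ * occMatch (extend ρ) O σ))
      = fun σ => wireIs 0 true σ * wireIs 0 (I.formula.eval (extend ρ)) σ := by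
    funext σ
    rw [zero_add, bsum_mul_left _ (wireIs_below Nat.one_pos _),
      I.formula.bsum_emit K _ Nat.one_pos]
  rw [e₁]
  cases h : I.formula.eval (extend ρ) <;> simp [bsum, wireIs]

end Value

/-! ### Writing gadgets

The reduction uses the following stacks: `0` input, `2` output, `3` number of variables, `4` pending
wires, `5` occurrences, `6` scanned occurrences, `7`, `8`, `9` wires of the current gate, `10`
scratch, `11` current variable, `12` current symbol. -/

/-- Push a constant, one of the wires in registers `7`, `8`, `9`, or an auxiliary variable. -/
def emitSym {m : ℕ} : ℂ ⊕ (Fin 3 ⊕ Fin m) → Prog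
  | .inl a => .push 2 a
  | .inr (.inl j) => .copy (7 + j) 2
  | .inr (.inr j) => .block [.push 10 ((j : ℕ) : ℂ), .arith .plus 3 10 2]

/-- Push the given symbols, the first one last. -/
def emitWord {m : ℕ} : List (ℂ ⊕ (Fin 3 ⊕ Fin m)) → Prog
  | [] => .skip
  | a :: w => .seq (emitWord w) (emitSym a)

/-- The symbol that `emitSym` pushes. -/
def symVal {m : ℕ} (x y z c : ℕ) : ℂ ⊕ (Fin 3 ⊕ Fin m) → ℂ
  | .inl a => a
  | .inr i => (place x y z c i : ℕ)

/-- The registers hold the numbers of three wires and the number of variables. -/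
structure Wires (s : Store) (x y z c : ℕ) : Prop where
  h7 : s.top 7 = x
  h8 : s.top 8 = y
  h9 : s.top 9 = z
  h3 : s.top 3 = c

theorem emitSym_exec {m : ℕ} (a : ℂ ⊕ (Fin 3 ⊕ Fin m)) {s : Store} {x y z c : ℕ}
    (h : Wires s x y z c) : (emitSym a).exec s 2 = symVal x y z c a :: s 2 ∧
      ∀ i, i ≠ 2 → i ≠ 10 → (emitSym a).exec s i = s i := by
  obtain ⟨h7, h8, h9, h3⟩ := h
  rcases a with a | j | j
  · simp +contextual [emitSym, symVal]
  · fin_cases j <;> simp +contextual [emitSym, symVal, place, h7, h8, h9]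
  · simp +contextual [emitSym, symVal, place, h3]

theorem emitWord_exec {m : ℕ} (w : List (ℂ ⊕ (Fin 3 ⊕ Fin m))) {s : Store} {x y z c : ℕ}
    (h : Wires s x y z c) : (emitWord w).exec s 2 = w.map (symVal x y z c) ++ s 2 ∧
      ∀ i, i ≠ 2 → i ≠ 10 → (emitWord w).exec s i = s i := by
  induction w with
  | nil => simp [emitWord]
  | cons a w ih =>
    have hw : Wires ((emitWord w).exec s) x y z c := by
      obtain ⟨h7, h8, h9, h3⟩ := h
      constructor <;> rw [Store.top, ih.2 _ (by decide) (by decide)] <;> assumption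
    obtain ⟨h1, h2⟩ := emitSym_exec a hw
    refine ⟨?_, fun i hi hi' => ?_⟩
    · simp only [emitWord, Prog.exec]
      rw [h1, ih.1]
      rfl
    · simp only [emitWord, Prog.exec]
      rw [h2 i hi hi', ih.2 i hi hi']

theorem emitWord_loopFree {m : ℕ} (w : List (ℂ ⊕ (Fin 3 ⊕ Fin m))) :
    (emitWord w).loopFree = true := by
  induction w with
  | nil => rfl
  | cons a w ih =>
    rcases a with a | j | j <;> simp [emitWord, emitSym, Prog.loopFree, ih, Prog.block]

theorem emitWord_touches {m : ℕ} (w : List (ℂ ⊕ (Fin 3 ⊕ Fin m))) {i : ℕ} (h2 : i ≠ 2)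
    (h10 : i ≠ 10) : (emitWord w).touches i = false := by
  induction w with
  | nil => rfl
  | cons a w ih =>
    rcases a with a | j | j <;> simp [emitWord, emitSym, Prog.touches, ih, Prog.block, h2, h10]

/-- The code of an applied constraint of a gadget. -/
def App.word {m : ℕ} (a : App (Fin 3 ⊕ Fin m)) : List (ℂ ⊕ (Fin 3 ⊕ Fin m)) :=
  .inl a.con.arity :: ((List.ofFn fun i => .inr (a.scope i)) ++
    (table a.con.arity a.con.val).map .inl)

theorem App.word_symVal {m : ℕ} (a : App (Fin 3 ⊕ Fin m)) (x y z c : ℕ) :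
    a.word.map (symVal x y z c) = (a.map (place x y z c)).code := by
  simp [App.word, App.code, App.map, symVal, Function.comp_def, List.map_ofFn]

section Gadget

variable {S : Set Constraint} {f : Bool → Bool → Bool}

/-- Write the gadget for the wires in registers `7`, `8`, `9`. -/
def Gadget.prog (Γ : Gadget S f) : Prog :=
  .block [emitWord (Γ.apps.flatMap App.word), .push 10 (Γ.m : ℂ), .arith .plus 3 10 3]

theorem Gadget.prog_loopFree (Γ : Gadget S f) : Γ.prog.loopFree = true := by
  simp [prog, Prog.block, Prog.loopFree, emitWord_loopFree]

theorem Gadget.prog_touches (Γ : Gadget S f) {i : ℕ} (h2 : i ≠ 2) (h3 : i ≠ 3) (h10 : i ≠ 10) :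
    Γ.prog.touches i = false := by
  simp [prog, Prog.block, Prog.touches, emitWord_touches, h2, h3, h10]

/-- The gadget does not depend on the input, so its tables are constants of the program; only
variable indices are computed at run time. -/
theorem Gadget.prog_exec (Γ : Gadget S f) {s : Store} {x y z c : ℕ} (h : Wires s x y z c) :
    Γ.prog.exec s 2 = (Γ.inst x y z c).flatMap App.code ++ s 2 ∧
    (Γ.prog.exec s).top 3 = ((c + Γ.m : ℕ) : ℂ) ∧
    ∀ i, i ≠ 2 → i ≠ 3 → i ≠ 10 → Γ.prog.exec s i = s i := by
  obtain ⟨h1, h2⟩ := emitWord_exec (Γ.apps.flatMap App.word) h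
  have h3 : ((emitWord (Γ.apps.flatMap App.word)).exec s).top 3 = c := by
    rw [Store.top, h2 3 (by decide) (by decide)]
    exact h.h3
  refine ⟨?_, ?_, fun i hi2 hi3 hi10 => ?_⟩
  · simp [prog, h1, Gadget.inst, List.map_flatMap, App.word_symVal, List.flatMap_map]
  · simp [prog, h3]
  · simp [prog, hi3, hi10, h2 i hi2 hi10]

end Gadget

/-! ### Writing the circuit of a formula -/

section Circuit

variable {S : Set Constraint} (K : Kit S)

/-- Process one symbol of the formula. -/
def formulaBody : Prog :=
  .block [.copy 4 9, .pop 4, .copy 0 12, .pop 0,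
    -- Symbols are decoded by decrementing and testing for zero: 0 is a variable, 1 negation, 2
    -- disjunction, 3 conjunction.
    .ite (.nonzero 12)
      (.block [.push 10 1, .arith .minus 12 10 12, .copy 3 7, .push 10 1, .arith .plus 3 10 3,
        .ite (.nonzero 12)
          (.block [.push 10 1, .arith .minus 12 10 12, .copy 3 8, .push 10 1, .arith .plus 3 10 3,
            .ite (.nonzero 12) K.conj.prog K.disj.prog, .copy 8 4, .copy 7 4])
          (.block [.copy 7 8, K.neg.prog, .copy 7 4])])
      (.block [.copy 9 5, .copy 0 5, .pop 0])]

theorem formulaBody_loopFree : (formulaBody K).loopFree = true := by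
  simp [formulaBody, Prog.block, Prog.loopFree, Gadget.prog_loopFree]

/-- The occurrences of variables as a word. -/
def occCode (O : List (ℕ × ℕ)) : List ℂ := O.flatMap fun p => [(p.1 : ℂ), (p.2 : ℂ)]

/-- The state of the translation of a formula: the remaining input, the pending wires, the
constraints and occurrences found so far, and the number of variables. -/
structure FormulaState (s : Store) (rest : List ℂ) (pend : List ℕ) (L : List (App ℕ))
    (O : List (ℕ × ℕ)) (c : ℕ) : Prop where
  h0 : s 0 = rest
  h4 : s 4 = pend.map Nat.cast
  h2 : s 2 = L.flatMap App.code
  h5 : s 5 = occCode O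
  h3 : s.top 3 = c

theorem formulaBody_var {s : Store} {i z : ℕ} {rest : List ℂ} {pend : List ℕ} {L : List (App ℕ)}
    {O : List (ℕ × ℕ)} {c : ℕ}
    (h : FormulaState s ((0 : ℂ) :: (i : ℂ) :: rest) (z :: pend) L O c) :
    FormulaState ((formulaBody K).exec s) rest pend L ((i, z) :: O) c := by
  obtain ⟨h0, h4, h2, h5, h3⟩ := h
  have t0 := Store.top_eq h0
  have t4 := Store.top_eq h4
  constructor <;> simp [formulaBody, t0, t4, h0, h4, h2, h5, h3, occCode]

theorem formulaBody_neg {s : Store} {z : ℕ} {rest : List ℂ} {pend : List ℕ} {L : List (App ℕ)}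
    {O : List (ℕ × ℕ)} {c : ℕ} (h : FormulaState s ((1 : ℂ) :: rest) (z :: pend) L O c) :
    FormulaState ((formulaBody K).exec s) rest (c :: pend) (K.neg.inst c c z (c + 1) ++ L) O
      (c + (1 + K.neg.m)) := by
  obtain ⟨h0, h4, h2, h5, h3⟩ := h
  have t0 := Store.top_eq h0
  have t4 := Store.top_eq h4
  have key : ∃ s₁, (formulaBody K).exec s = (K.neg.prog.exec s₁).push 4 ((K.neg.prog.exec s₁).top 7) ∧
      s₁ 0 = rest ∧ s₁ 4 = pend.map Nat.cast ∧ s₁ 2 = s 2 ∧ s₁ 5 = s 5 ∧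
      Wires s₁ c c z (c + 1) := by
    simp only [formulaBody, Prog.exec_block_cons, Prog.exec_block_nil, Prog.exec_ite_nonzero]
    simp [t0, t4]
    refine ⟨_, rfl, ?_, ?_, ?_, ?_, ?_⟩
    · simp [h0]
    · simp [h4]
    · simp
    · simp
    · constructor <;> simp [h3]
  obtain ⟨s₁, e, e0, e4, e2, e5, hw⟩ := key
  obtain ⟨g2, g3, gf⟩ := K.neg.prog_exec hw
  rw [e]
  constructor
  · simp [gf, e0]
  · simp [gf, e4, Store.top, ← hw.h7]
  · simp [g2, e2, h2]
  · simp [gf, e5, h5]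
  · simp [g3]; ring

/-- The two binary connectives share all code except the branch after the second decrement; `ha`
records which branch the symbol selects. -/
theorem formulaBody_binary {f : Bool → Bool → Bool} (Γ : Gadget S f) {a : ℂ}
    (ha : (a = 2 ∧ ∀ s : Store, s.top 12 = 0 →
        (Prog.ite (.nonzero 12) K.conj.prog K.disj.prog).exec s = Γ.prog.exec s) ∨
      (a = 3 ∧ ∀ s : Store, s.top 12 ≠ 0 →
        (Prog.ite (.nonzero 12) K.conj.prog K.disj.prog).exec s = Γ.prog.exec s))
    {s : Store} {z : ℕ} {rest : List ℂ} {pend : List ℕ} {L : List (App ℕ)} {O : List (ℕ × ℕ)}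
    {c : ℕ} (h : FormulaState s (a :: rest) (z :: pend) L O c) :
    FormulaState ((formulaBody K).exec s) rest (c :: (c + 1) :: pend)
      (Γ.inst c (c + 1) z (c + 2) ++ L) O (c + (2 + Γ.m)) := by
  obtain ⟨h0, h4, h2, h5, h3⟩ := h
  have t0 := Store.top_eq h0
  have t4 := Store.top_eq h4
  have ha0 : a ≠ 0 := by rcases ha with ⟨rfl, -⟩ | ⟨rfl, -⟩ <;> norm_num
  have ha1 : a - 1 ≠ 0 := by rcases ha with ⟨rfl, -⟩ | ⟨rfl, -⟩ <;> norm_num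
  have key : ∃ s₁, (formulaBody K).exec s = (Prog.block [.copy 8 4, .copy 7 4]).exec
        ((Prog.ite (.nonzero 12) K.conj.prog K.disj.prog).exec s₁) ∧
      s₁ 0 = rest ∧ s₁ 4 = pend.map Nat.cast ∧ s₁ 2 = s 2 ∧ s₁ 5 = s 5 ∧ s₁.top 12 = a - 1 - 1 ∧
      Wires s₁ c (c + 1) z (c + 2) := by
    refine ⟨(Prog.block [.copy 4 9, .pop 4, .copy 0 12, .pop 0, .push 10 1, .arith .minus 12 10 12,
      .copy 3 7, .push 10 1, .arith .plus 3 10 3, .push 10 1, .arith .minus 12 10 12, .copy 3 8,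
      .push 10 1, .arith .plus 3 10 3]).exec s, ?_, ?_, ?_, ?_, ?_, ?_, ?_⟩
    · rw [formulaBody]
      simp only [Prog.exec_block_cons, Prog.exec_block_nil]
      rw [Prog.exec_ite_pos (by simpa [t0] using ha0)]
      simp only [Prog.exec_block_cons, Prog.exec_block_nil]
      rw [Prog.exec_ite_pos (by simpa [t0] using ha1)]
      simp only [Prog.exec_block_cons, Prog.exec_block_nil]
    · simp [h0]
    · simp [h4]
    · simp
    · simp
    · simp [t0]
    · constructor <;> simp [h3, t4]
      ring
  obtain ⟨s₁, e, e0, e4, e2, e5, e12, hw⟩ := key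
  have eΓ : (Prog.ite (.nonzero 12) K.conj.prog K.disj.prog).exec s₁ = Γ.prog.exec s₁ := by
    rcases ha with ⟨rfl, ha⟩ | ⟨rfl, ha⟩
    · exact ha _ (by rw [e12]; norm_num)
    · exact ha _ (by rw [e12]; norm_num)
  obtain ⟨g2, g3, gf⟩ := Γ.prog_exec hw
  have g7 : (Γ.prog.exec s₁).top 7 = c := by
    rw [Store.top, gf 7 (by decide) (by decide) (by decide)]; exact hw.h7
  have g8 : (Γ.prog.exec s₁).top 8 = ((c + 1 : ℕ) : ℂ) := by
    rw [Store.top, gf 8 (by decide) (by decide) (by decide)]; exact hw.h8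
  rw [e, eΓ]
  constructor
  · simp [gf, e0]
  · simp [gf, e4, g7, g8]
  · simp [g2, e2, h2]
  · simp [gf, e5, h5]
  · simp [g3]; ring

/-- Prefix notation is self-delimiting: a formula consumes its own code and one pending root, having
pushed the roots of its children in the meantime. So the parser needs no recursion, and the loop
stops by itself when no root is pending. -/
theorem formula_reach (φ : Formula) {s : Store} {z : ℕ} {rest : List ℂ} {pend : List ℕ}
    {L : List (App ℕ)} {O : List (ℕ × ℕ)} {c : ℕ}
    (h : FormulaState s (φ.code ++ rest) (z :: pend) L O c) :
    ∃ s', LoopReach (.nonempty 4) (formulaBody K) ((1 + (formulaBody K).cost) * φ.code.length) s s' ∧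
      FormulaState s' rest pend (φ.emit K z c ++ L) (φ.occ K z c ++ O) (c + φ.width K) := by
  have one : ∀ {s : Store} {rest : List ℂ} {z : ℕ} {pend : List ℕ}
      {L : List (App ℕ)} {O : List (ℕ × ℕ)} {c : ℕ}, FormulaState s rest (z :: pend) L O c →
      LoopReach (.nonempty 4) (formulaBody K) (1 + (formulaBody K).cost) s
        ((formulaBody K).exec s) := fun h =>
    LoopReach.once (by simp [h.h4]) (runs_exec _ (formulaBody_loopFree K) _)
  induction φ generalizing s z rest pend L O c with
  | var i =>
    refine ⟨_, (one h).mono ?_, formulaBody_var K h⟩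
    simp only [Formula.code, List.length_cons, List.length_nil]
    omega
  | neg φ ih =>
    obtain ⟨s', h1, h2⟩ := ih (formulaBody_neg K h)
    refine ⟨s', ((one h).trans h1).mono ?_, ?_⟩
    · simp only [Formula.code, List.length_cons]
      rw [Nat.mul_add, Nat.mul_one, Nat.add_comm]
    · convert h2 using 1
      · simp [Formula.emit]
      · rfl
      · simp only [Formula.width]; omega
  | disj φ ψ ih1 ih2 =>
    have hb := formulaBody_binary K K.disj
      (Or.inl ⟨rfl, fun s hs => Prog.exec_ite_neg (by simp [hs])⟩) (by
        simpa [Formula.code] using h)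
    obtain ⟨s₁, h1, h2⟩ := ih1 hb
    obtain ⟨s₂, h3, h4⟩ := ih2 h2
    refine ⟨s₂, ((one h).trans (h1.trans h3)).mono ?_, ?_⟩
    · simp only [Formula.code, List.length_cons, List.length_append]
      exact le_of_eq (by ring)
    · convert h4 using 1
      · simp [Formula.emit, Nat.add_assoc]
      · simp [Formula.occ, Nat.add_assoc]
      · simp only [Formula.width]; omega
  | conj φ ψ ih1 ih2 =>
    have hb := formulaBody_binary K K.conj
      (Or.inr ⟨rfl, fun s hs => Prog.exec_ite_pos (by simp [hs])⟩) (by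
        simpa [Formula.code] using h)
    obtain ⟨s₁, h1, h2⟩ := ih1 hb
    obtain ⟨s₂, h3, h4⟩ := ih2 h2
    refine ⟨s₂, ((one h).trans (h1.trans h3)).mono ?_, ?_⟩
    · simp only [Formula.code, List.length_cons, List.length_append]
      exact le_of_eq (by ring)
    · convert h4 using 1
      · simp [Formula.emit, Nat.add_assoc]
      · simp [Formula.occ, Nat.add_assoc]
      · simp only [Formula.width]; omega

/-! ### Writing the weights -/

/-- Compare the current variable with one occurrence. -/
def eqBody : Prog :=
  .block [.copy 5 12, .pop 5, .copy 5 9, .pop 5, .copy 12 6, .copy 9 6, .arith .minus 11 12 10,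
    .ite (.nonzero 10) .skip K.eq.prog]

theorem eqBody_loopFree : (eqBody K).loopFree = true := by
  simp [eqBody, Prog.block, Prog.loopFree, Gadget.prog_loopFree]

/-- The occurrences pass to stack `6` in reverse order, to be restored for the next variable.
Registers `7` and `8` both hold `v` because the copy gate has an idle second input. -/
theorem runs_eqLoop (i v : ℕ) (O : List (ℕ × ℕ)) {s : Store} {L : List (App ℕ)} {c : ℕ}
    (h5 : s 5 = occCode O) (h2 : s 2 = L.flatMap App.code) (h3 : s.top 3 = c) (h11 : s.top 11 = i)
    (h7 : s.top 7 = v) (h8 : s.top 8 = v) :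
    ∃ s', Runs (.loop (.nonempty 5) (eqBody K)) ((1 + (eqBody K).cost) * O.length + 1) s s' ∧
      s' 5 = [] ∧ s' 6 = (occCode O).reverse ++ s 6 ∧
      s' 2 = (eqEmit K i v O c ++ L).flatMap App.code ∧
      s'.top 3 = ((c + eqWidth K i O : ℕ) : ℂ) := by
  induction O generalizing s L c with
  | nil => exact ⟨s, Runs.loop_stop (by simp [h5, occCode]), h5, by simp [occCode],
      by simp [eqEmit, h2], by simp [eqWidth, h3]⟩
  | cons p O ih =>
    have h5' : s 5 = (p.1 : ℂ) :: (p.2 : ℂ) :: occCode O := by rw [h5]; simp [occCode]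
    have t5 := Store.top_eq h5'
    have go := runs_exec _ (eqBody_loopFree K) s
    have hold : (Test.nonempty 5).Holds s := by simp [h5']
    set s₀ := (Prog.block [.copy 5 12, .pop 5, .copy 5 9, .pop 5, .copy 12 6, .copy 9 6,
      .arith .minus 11 12 10]).exec s with hs₀
    have a5 : s₀ 5 = occCode O := by simp [hs₀, h5']
    have a2 : s₀ 2 = L.flatMap App.code := by simp [hs₀, h2]
    have a6 : s₀ 6 = (p.2 : ℂ) :: (p.1 : ℂ) :: s 6 := by simp [hs₀, t5, h5']
    have a11 : s₀.top 11 = i := by simp [hs₀, h11]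
    have a10 : s₀.top 10 = (i : ℂ) - p.1 := by simp [hs₀, h11, t5]
    have hw : Wires s₀ v v p.2 c := by constructor <;> simp [hs₀, h7, h8, h3, h5']
    have hexec : (eqBody K).exec s = (Prog.ite (.nonzero 10) .skip K.eq.prog).exec s₀ := rfl
    by_cases hi : i = p.1
    · rw [Prog.exec_ite_neg (by simp [a10, hi])] at hexec
      obtain ⟨g2, g3, gf⟩ := K.eq.prog_exec hw
      rw [hexec] at go
      obtain ⟨s', r1, r2, r3, r4, r5⟩ := ih (s := K.eq.prog.exec s₀)
        (L := K.eq.inst v v p.2 c ++ L) (by simp [gf, a5]) (by simp [g2, a2]) g3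
        (by rw [Store.top, gf 11 (by decide) (by decide) (by decide)]; exact a11)
        (by rw [Store.top, gf 7 (by decide) (by decide) (by decide)]; exact hw.h7)
        (by rw [Store.top, gf 8 (by decide) (by decide) (by decide)]; exact hw.h8)
      refine ⟨s', (Runs.loop_go hold go r1).mono ?_, r2, ?_, ?_, ?_⟩
      · rw [List.length_cons]
        exact le_of_eq (by ring)
      · rw [r3, gf 6 (by decide) (by decide) (by decide), a6]
        simp [occCode]
      · rw [r4, eqEmit, if_pos hi, List.append_assoc]
      · rw [r5, eqWidth, if_pos hi, Nat.add_assoc]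
    · have hne : (i : ℂ) - p.1 ≠ 0 := by
        rw [sub_ne_zero]
        exact_mod_cast hi
      rw [Prog.exec_ite_pos (by simpa [a10] using hne)] at hexec
      rw [hexec] at go
      obtain ⟨s', r1, r2, r3, r4, r5⟩ := ih (s := s₀) a5 a2 hw.h3 a11 hw.h7 hw.h8
      refine ⟨s', (Runs.loop_go hold go r1).mono ?_, r2, ?_, ?_, ?_⟩
      · rw [List.length_cons]
        exact le_of_eq (by ring)
      · rw [r3, a6]
        simp [occCode]
      · rw [r4, eqEmit, if_neg hi]
      · rw [r5, eqWidth, if_neg hi, Nat.zero_add]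

/-- Read the weights of one variable. -/
def weightHead : Prog :=
  .block [.copy 0 11, .pop 0, .copy 3 7, .copy 3 8, .push 10 1, .arith .plus 3 10 3,
    -- The output is built from its end, so the weight of `true` is written before that of `false`,
    -- which waits in register `12`.
    .copy 0 12, .pop 0, .copy 0 2, .pop 0, .copy 12 2, .copy 7 2, .push 2 1]

/-- Process one weighted variable. -/
def weightBody : Prog :=
  .block [weightHead, .loop (.nonempty 5) (eqBody K), .move 6 5]

/-- A bound for the number of steps of `weightBody` with `m` occurrences. -/
def weightCost (m : ℕ) : ℕ :=
  weightHead.cost + (1 + (eqBody K).cost) * m + 6 * (2 * m) + 6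

theorem occCode_length (O : List (ℕ × ℕ)) : (occCode O).length = 2 * O.length := by
  simp [occCode, List.length_flatMap, mul_comm]

/-- After each round the occurrences are back in stack `5` and stack `6` is empty; only the
remaining weights, the output and the variable counter have changed. -/
theorem runs_weightLoop (O : List (ℕ × ℕ)) (T : List (ℕ × ℂ × ℂ)) {s : Store} {L : List (App ℕ)}
    {c : ℕ} (h0 : s 0 = T.flatMap fun t => [(t.1 : ℂ), t.2.1, t.2.2]) (h5 : s 5 = occCode O)
    (h6 : s 6 = []) (h2 : s 2 = L.flatMap App.code) (h3 : s.top 3 = c) :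
    ∃ s', Runs (.loop (.nonempty 0) (weightBody K)) ((1 + weightCost K O.length) * T.length + 1) s s' ∧
      s' 2 = (weightEmit K O T c ++ L).flatMap App.code ∧
      s'.top 3 = ((c + weightWidth K O T : ℕ) : ℂ) := by
  induction T generalizing s L c with
  | nil => exact ⟨s, Runs.loop_stop (by simp [h0]), by simp [weightEmit, h2],
      by simp [weightWidth, h3]⟩
  | cons t T ih =>
    have h0' : s 0 = (t.1 : ℂ) :: t.2.1 :: t.2.2 :: T.flatMap fun t => [(t.1 : ℂ), t.2.1, t.2.2] := by
      rw [h0]; simp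
    have t0 := Store.top_eq h0'
    have hold : (Test.nonempty 0).Holds s := by simp [h0']
    have go := runs_exec weightHead rfl s
    set s₀ := weightHead.exec s with hs₀
    have a0 : s₀ 0 = T.flatMap fun t => [(t.1 : ℂ), t.2.1, t.2.2] := by simp [hs₀, weightHead, h0']
    have a2 : s₀ 2 = (unaryApp c t.2.1 t.2.2 :: L).flatMap App.code := by
      simp [hs₀, weightHead, h0', h2, h3, unaryApp_code]
    have a6 : s₀ 6 = [] := by simp [hs₀, weightHead, h6]
    obtain ⟨s₁, b1, b5, b6, b2, b3⟩ := runs_eqLoop K t.1 c O (s := s₀)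
      (L := unaryApp c t.2.1 t.2.2 :: L) (c := c + 1)
      (by simp [hs₀, weightHead, h5]) a2 (by simp [hs₀, weightHead, h3])
      (by simp [hs₀, weightHead, t0]) (by simp [hs₀, weightHead, h3])
      (by simp [hs₀, weightHead, h3])
    obtain ⟨s₂, c1, c2, c3⟩ := runs_move (i := 6) (j := 5) (by decide) _ s₁ (by rw [b6, a6])
    have e0 : (Prog.loop (.nonempty 5) (eqBody K)).touches 0 = false := by
      simp [Prog.touches, eqBody, Prog.block, Gadget.prog_touches]
    obtain ⟨s', r1, r2, r3⟩ := ih (s := s₂)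
      (L := eqEmit K t.1 c O (c + 1) ++ unaryApp c t.2.1 t.2.2 :: L)
      (c := c + 1 + eqWidth K t.1 O)
      (by rw [c1.frame 0 (by decide), b1.frame 0 e0, a0])
      (by rw [c3, b5]; simp) c2 (by rw [c1.frame 2 (by decide), b2])
      (by rw [c1.frame_top 3 (by decide), b3])
    refine ⟨s', (Runs.loop_go hold (go.cons (b1.cons (c1.cons (Runs.nil _)))) r1).mono ?_, ?_, ?_⟩
    · simp only [List.length_append, List.length_reverse, List.length_nil, occCode_length,
        List.length_cons, weightCost]
      exact le_of_eq (by ring)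
    · rw [r2]
      simp [weightEmit, Nat.add_assoc]
    · rw [r3, weightWidth]
      congr 1
      omega

/-! ### The reduction -/

/-- Write the number of variables in unary. -/
def unaryBody : Prog := .block [.push 2 1, .push 10 1, .arith .minus 3 10 3]

theorem runs_unaryLoop (n : ℕ) {s : Store} (h : s.top 3 = n) :
    ∃ s', Runs (.loop (.nonzero 3) unaryBody) ((1 + unaryBody.cost) * n + 1) s s' ∧
      s' 2 = List.replicate n 1 ++ s 2 := by
  induction n generalizing s with
  | zero => exact ⟨s, Runs.loop_stop (by simp [h]), by simp⟩
  | succ n ih =>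
    obtain ⟨s', h1, h2⟩ := ih (s := unaryBody.exec s) (by simp [unaryBody, h])
    have hold : (Test.nonzero 3).Holds s := by
      simp only [Test.holds_nonzero, h]
      exact_mod_cast n.succ_ne_zero
    refine ⟨s', (Runs.loop_go hold (runs_exec _ rfl s) h1).mono (le_of_eq (by ring)), ?_⟩
    rw [h2, List.replicate_succ']
    simp [unaryBody]

/-- Write the constraint on the root. -/
def reductionHead : Prog :=
  .block [.push 3 1, .push 4 0, .push 2 1, .push 2 0, .push 2 0, .push 2 1]

/-- The program that translates a weighted formula to an instance of a counting CSP. -/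
def reduction : Prog :=
  .block [reductionHead, .loop (.nonempty 4) (formulaBody K), .loop (.nonempty 0) (weightBody K),
    .push 2 0, .loop (.nonzero 3) unaryBody]

theorem reduction_touches : (reduction K).touches 1 = false := by
  simp [Prog.touches, reduction, reductionHead, unaryBody, weightBody, weightHead, formulaBody,
    eqBody, Prog.move, Prog.block, Gadget.prog_touches]

theorem runs_reduction (I : SATInst) {s : Store} (h0 : s 0 = I.code)
    (hs : ∀ j, 2 ≤ j → s j = []) :
    ∃ s', Runs (reduction K) (reductionHead.cost +
        (1 + (formulaBody K).cost) * I.formula.code.length +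
        (1 + weightCost K (I.formula.occ K 0 1).length) * I.triples.length +
        (1 + unaryBody.cost) * I.width K + 10) s s' ∧
      s' 2 = List.replicate (I.width K) 1 ++ 0 :: (I.emit K).flatMap App.code := by
  have go := runs_exec reductionHead rfl s
  set s₀ := reductionHead.exec s with hs₀
  -- At the start, wire 0 is allocated and pending as the root, and the constraint that makes it
  -- true has been written.
  have st : FormulaState s₀ (I.formula.code ++ I.triples.flatMap fun t => [(t.1 : ℂ), t.2.1, t.2.2])
      [0] [unaryApp 0 0 1] [] 1 := by
    constructor <;> simp [hs₀, reductionHead, h0, hs, I.code_eq, unaryApp_code, occCode]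
  obtain ⟨s₁, a1, a2⟩ := formula_reach K I.formula st
  have a1 := a1.finish (by simp [a2.h4])
  have e6 : (Prog.loop (.nonempty 4) (formulaBody K)).touches 6 = false := by
    simp [Prog.touches, formulaBody, Prog.block, Gadget.prog_touches]
  obtain ⟨s₂, b1, b2, b3⟩ := runs_weightLoop K _ _ a2.h0 a2.h5
    (by rw [a1.frame 6 e6]; simp [hs₀, reductionHead, hs]) a2.h2 a2.h3
  obtain ⟨s₃, c1, c2⟩ := runs_unaryLoop _ (s := s₂.push 2 0)
    (by rw [Store.top_push, if_neg (by decide)]; exact b3)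
  refine ⟨s₃, (go.cons (a1.cons (b1.cons ((runs_exec (.push 2 0) rfl s₂).cons
    (c1.cons (Runs.nil _)))))).mono ?_, ?_⟩
  · simp only [SATInst.width, List.append_nil, Prog.cost]
    exact le_of_eq (by ring)
  · rw [c2]
    simp [b2, SATInst.emit, SATInst.width]

end Circuit

/-! ### Size of the circuit and running time of the reduction -/

section Bounds

variable {S : Set Constraint} (K : Kit S)

theorem Formula.occ_length_le (φ : Formula) (z c : ℕ) :
    (φ.occ K z c).length ≤ φ.code.length := by
  induction φ generalizing z c with
  | var => simp [occ, code]
  | neg φ ih =>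
    have := ih c (c + (1 + K.neg.m))
    simp only [occ, code, List.length_cons]
    omega
  | disj φ ψ ih1 ih2 =>
    have := ih1 c (c + (2 + K.disj.m))
    have := ih2 (c + 1) (c + (2 + K.disj.m + φ.width K))
    simp only [occ, code, List.length_cons, List.length_append]
    omega
  | conj φ ψ ih1 ih2 =>
    have := ih1 c (c + (2 + K.conj.m))
    have := ih2 (c + 1) (c + (2 + K.conj.m + φ.width K))
    simp only [occ, code, List.length_cons, List.length_append]
    omega

theorem Formula.width_le (φ : Formula) :
    φ.width K ≤ (2 + K.neg.m + K.disj.m + K.conj.m) * φ.code.length := by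
  induction φ with
  | var => simp [width]
  | neg φ ih =>
    simp only [width, code, List.length_cons, Nat.mul_add]
    omega
  | disj φ ψ ih1 ih2 | conj φ ψ ih1 ih2 =>
    simp only [width, code, List.length_cons, List.length_append, Nat.mul_add]
    omega

theorem eqWidth_le (i : ℕ) (O : List (ℕ × ℕ)) : eqWidth K i O ≤ K.eq.m * O.length := by
  induction O with
  | nil => simp [eqWidth]
  | cons p O ih =>
    simp only [eqWidth, List.length_cons, Nat.mul_add]
    split_ifs <;> omega

theorem weightWidth_le (O : List (ℕ × ℕ)) (T : List (ℕ × ℂ × ℂ)) :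
    weightWidth K O T ≤ (1 + K.eq.m * O.length) * T.length := by
  induction T with
  | nil => simp [weightWidth]
  | cons t T ih =>
    have := eqWidth_le K t.1 O
    rw [weightWidth, List.length_cons, Nat.mul_add]
    omega

/-- The leading coefficient of a bound for the number of steps of the reduction. -/
def reductionFactor : ℕ :=
  reductionHead.cost + (1 + (formulaBody K).cost) +
    (7 + weightHead.cost) + (13 + (eqBody K).cost) + (1 + unaryBody.cost) *
    (1 + (2 + K.neg.m + K.disj.m + K.conj.m) + 1 + K.eq.m) + 10

/-- The time is quadratic because every variable is compared with every occurrence; all other work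
is linear in the input or in the number of variables written. -/
theorem runs_reduction_poly (I : SATInst) {s : Store} (h0 : s 0 = I.code)
    (hs : ∀ j, 2 ≤ j → s j = []) :
    ∃ s', Runs (reduction K) (reductionFactor K * (I.code.length + 1) ^ 2) s s' ∧
      s' 2 = List.replicate (I.width K) 1 ++ 0 :: (I.emit K).flatMap App.code := by
  obtain ⟨s', h1, h2⟩ := runs_reduction K I h0 hs
  refine ⟨s', h1.mono ?_, h2⟩
  set N := I.code.length with hN
  have hlen : N = I.formula.code.length + I.triples.length * 3 := by
    rw [hN, I.code_eq]
    simp [List.length_flatMap]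
  set W := 2 + K.neg.m + K.disj.m + K.conj.m
  set F := I.formula.code.length
  set O := (I.formula.occ K 0 1).length
  set T := I.triples.length
  have hO : O ≤ F := I.formula.occ_length_le K 0 1
  have hw : I.width K ≤ 1 + W * F + (1 + K.eq.m * O) * T :=
    add_le_add (add_le_add le_rfl (I.formula.width_le K)) (weightWidth_le K _ _)
  -- This single quantity dominates 1, `F`, `T` and `O * T`, the monomials of the bound.
  set M := (N + 1) ^ 2 with hM
  have m1 : 1 ≤ M := Nat.one_le_pow _ _ (by omega)
  have mF : F ≤ M := by nlinarith
  have mT : T ≤ M := by nlinarith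
  have mOT : O * T ≤ M := by
    have : O * T ≤ N * N := Nat.mul_le_mul (by omega) (by omega)
    nlinarith
  calc _ ≤ reductionHead.cost + (1 + (formulaBody K).cost) * F + (1 + weightCost K O) * T +
        (1 + unaryBody.cost) * (1 + W * F + (1 + K.eq.m * O) * T) + 10 := by gcongr
    _ = reductionHead.cost * 1 + (1 + (formulaBody K).cost) * F + (7 + weightHead.cost) * T +
        (13 + (eqBody K).cost) * (O * T) +
        (1 + unaryBody.cost) * (1 + W * F + T + K.eq.m * (O * T)) + 10 * 1 := by
      rw [weightCost]; ring
    _ ≤ reductionHead.cost * M + (1 + (formulaBody K).cost) * M + (7 + weightHead.cost) * M +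
        (13 + (eqBody K).cost) * M +
        (1 + unaryBody.cost) * (M + W * M + M + K.eq.m * M) + 10 * M := by gcongr
    _ = _ := by rw [reductionFactor]; ring

end Bounds

/-- If `F` is not contained in `ED`, then weighted satisfiability is AP-reducible to `#CSP*(F)`. -/
theorem apReducible_of_not_subset_ED {F : Set Constraint} (hF : ¬ F ⊆ ED) :
    APReducible SATC (CSPStar F) := by
  obtain ⟨f, hf, hED⟩ := Set.not_subset.1 hF
  have hU : unaryConstraints ⊆ F ∪ unaryConstraints := Set.subset_union_right
  obtain ⟨K⟩ := (realizesGate_nand_of_notMem_ED hU (Or.inl hf) hED).kit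
  let T : SATInst → CSPInst (F ∪ unaryConstraints) := fun I =>
    .ofApps (I.width K) (I.emit K) (I.emit_below K) (I.emit_mem K hU)
  refine apReducible_of_transform (P := SATC) (Q := CSPStar F) (reduction K) 2
    (reduction_touches K) (reductionFactor K) 2 T (fun I => ?_) fun I s h0 hs => ?_
  · change (T I).value = I.value
    rw [CSPInst.value_eq _ fun _ => false, CSPInst.ofApps_toApp]
    exact I.bsum_emit K _
  · obtain ⟨s', h1, h2⟩ := runs_reduction_poly K I h0 hs
    refine ⟨s', h1, h2.trans ?_⟩
    change _ = (T I).code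
    rw [CSPInst.code_eq, CSPInst.ofApps_toApp]
    rfl

/-! ### Weighted ties -/

/-- The character of `Bool`. -/
def sgn (b : Bool) : ℂ := if b then -1 else 1

theorem sgn_mul_self (b : Bool) : sgn b * sgn b = 1 := by cases b <;> simp [sgn]

theorem sgn_eq_or (b : Bool) : sgn b = 1 ∨ sgn b = -1 := by cases b <;> simp [sgn]

/-- The constraint that `a` and `b` are equal (`t = 1`) or different (`t = -1`), with weight
`p + q * sgn a`. -/
structure Tie where
  a : ℕ
  b : ℕ
  t : ℂ
  p : ℂ
  q : ℂ

/-- The value of a tie. -/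
def Tie.val (r : Tie) (σ : ℕ → Bool) : ℂ :=
  (1 + r.t * sgn (σ r.a) * sgn (σ r.b)) / 2 * (r.p + r.q * sgn (σ r.a))

/-- A tie between variables below `n`. -/
structure Tie.Good (n : ℕ) (r : Tie) : Prop where
  ha : r.a < n
  hb : r.b < n
  ht : r.t = 1 ∨ r.t = -1

/-- The product of the values of ties. -/
def tieProd (l : List Tie) (σ : ℕ → Bool) : ℂ := (l.map fun r => r.val σ).prod

@[simp] theorem tieProd_nil (σ : ℕ → Bool) : tieProd [] σ = 1 := rfl

@[simp] theorem tieProd_cons (r : Tie) (l : List Tie) (σ : ℕ → Bool) :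
    tieProd (r :: l) σ = r.val σ * tieProd l σ := by simp [tieProd]

@[simp] theorem tieProd_append (l l' : List Tie) (σ : ℕ → Bool) :
    tieProd (l ++ l') σ = tieProd l σ * tieProd l' σ := by simp [tieProd]

theorem tieProd_reverse (l : List Tie) (σ : ℕ → Bool) : tieProd l.reverse σ = tieProd l σ := by
  simp [tieProd, List.map_reverse, List.prod_reverse]

/-- Look for a tie between `v` and another variable. -/
def findStep (v : ℕ) (acc : ℕ × ℂ × ℂ) (r : Tie) : ℕ × ℂ × ℂ :=
  if r.a = v then if r.b = v then acc else (r.b, r.t, 1)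
  else if r.b = v then (r.a, r.t, 1) else acc

/-- Substitute `τ * u` for `v`. -/
def Tie.subst (v u : ℕ) (τ : ℂ) (r : Tie) : Tie where
  a := if r.a = v then u else r.a
  b := if r.b = v then u else r.b
  t := (if r.a = v then τ else 1) * (if r.b = v then τ else 1) * r.t
  p := r.p
  q := (if r.a = v then τ else 1) * r.q

/-- Collect the weights of `v`, and keep the other ties. -/
def collectStep (v : ℕ) (acc : ℂ × ℂ × List Tie) (r : Tie) : ℂ × ℂ × List Tie :=
  if r.a = v then
    ((acc.1 * r.p + acc.2.1 * r.q) * ((1 + r.t) / 2),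
      (acc.1 * r.q + acc.2.1 * r.p) * ((1 + r.t) / 2), acc.2.2)
  else (acc.1, acc.2.1, r :: acc.2.2)

/-- Later hits overwrite earlier ones, and any tie to another variable will do. If there is no hit,
the default survives and every tie that involves `v` joins `v` to itself. -/
theorem foldl_findStep (v : ℕ) (acc : ℕ × ℂ × ℂ) (l : List Tie) :
    (l.foldl (findStep v) acc = acc ∧ ∀ r ∈ l, r.a = v ↔ r.b = v) ∨
    (∃ r ∈ l, (l.foldl (findStep v) acc).2.1 = r.t ∧ (l.foldl (findStep v) acc).2.2 = 1 ∧
      (l.foldl (findStep v) acc).1 ≠ v ∧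
      ((r.a = v ∧ r.b = (l.foldl (findStep v) acc).1) ∨
        (r.b = v ∧ r.a = (l.foldl (findStep v) acc).1))) := by
  induction l generalizing acc with
  | nil => simp
  | cons r l ih =>
    rw [List.foldl_cons]
    rcases ih (findStep v acc r) with ⟨h1, h2⟩ | ⟨r', hr', h⟩
    · rw [h1]
      by_cases ha : r.a = v <;> by_cases hb : r.b = v
      · exact Or.inl ⟨by simp [findStep, ha, hb], by simpa [ha, hb] using h2⟩
      · exact Or.inr ⟨r, by simp, by simp [findStep, ha, hb]⟩
      · exact Or.inr ⟨r, by simp, by simp [findStep, ha, hb]⟩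
      · exact Or.inl ⟨by simp [findStep, ha, hb], by simpa [ha, hb] using h2⟩
    · exact Or.inr ⟨r', by simp [hr'], h⟩

/-- Weights `P + Q s` multiply modulo `s² = 1`, and a tie of `v` with itself contributes the
constant `(1 + t) / 2`. -/
theorem foldl_collectStep (v : ℕ) (acc : ℂ × ℂ × List Tie) (l : List Tie)
    (h : ∀ r ∈ l, r.a = v → r.b = v) (σ : ℕ → Bool) :
    ((l.foldl (collectStep v) acc).1 + (l.foldl (collectStep v) acc).2.1 * sgn (σ v)) *
        tieProd (l.foldl (collectStep v) acc).2.2 σ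
      = (acc.1 + acc.2.1 * sgn (σ v)) * tieProd acc.2.2 σ * tieProd l σ := by
  induction l generalizing acc with
  | nil => simp
  | cons r l ih =>
    rw [List.foldl_cons, ih _ fun r hr => h r (by simp [hr]), tieProd_cons]
    by_cases ha : r.a = v
    · have hb := h r (by simp) ha
      have e : r.val σ = (1 + r.t) / 2 * (r.p + r.q * sgn (σ v)) := by
        rw [Tie.val, ha, hb, mul_assoc, sgn_mul_self, mul_one]
      simp only [collectStep, ha, if_true, e]
      linear_combination (acc.2.1 * r.q * ((1 + r.t) / 2) * tieProd acc.2.2 σ * tieProd l σ) *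
        -sgn_mul_self (σ v)
    · simp only [collectStep, ha, if_false, tieProd_cons]
      ring

theorem foldl_collectStep_of_ne (v : ℕ) (acc : ℂ × ℂ × List Tie) (l : List Tie)
    (h : ∀ r ∈ l, r.a ≠ v) :
    l.foldl (collectStep v) acc = (acc.1, acc.2.1, l.reverse ++ acc.2.2) := by
  induction l generalizing acc with
  | nil => simp
  | cons r l ih =>
    rw [List.foldl_cons, ih _ fun r hr => h r (by simp [hr])]
    simp [collectStep, h r (by simp)]

theorem mem_foldl_collectStep (v : ℕ) (acc : ℂ × ℂ × List Tie) (l : List Tie) (r : Tie)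
    (hr : r ∈ (l.foldl (collectStep v) acc).2.2) : r ∈ acc.2.2 ∨ r ∈ l ∧ r.a ≠ v := by
  induction l generalizing acc with
  | nil => exact Or.inl hr
  | cons r' l ih =>
    rcases ih _ hr with h | h
    · by_cases ha : r'.a = v
      · simp only [collectStep, ha, if_true] at h
        exact Or.inl h
      · simp only [collectStep, ha, if_false, List.mem_cons] at h
        rcases h with rfl | h
        · exact Or.inr ⟨by simp, ha⟩
        · exact Or.inl h
    · exact Or.inr ⟨by simp [h.1], h.2⟩

/-- The tie for `v` found in `l`. -/
def found (v : ℕ) (l : List Tie) : ℕ × ℂ × ℂ := l.foldl (findStep v) (v, 1, 2)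

/-- The result of the elimination of `v` from `l`. -/
def collected (v : ℕ) (l : List Tie) : ℂ × ℂ × List Tie :=
  (l.reverse.map (Tie.subst v (found v l).1 (found v l).2.1)).foldl (collectStep v) (1, 0, [])

theorem Tie.val_congr {r : Tie} {σ τ : ℕ → Bool} (ha : σ r.a = τ r.a) (hb : σ r.b = τ r.b) :
    r.val σ = r.val τ := by
  rw [Tie.val, Tie.val, ha, hb]

theorem tieProd_congr {l : List Tie} {σ τ : ℕ → Bool} {n : ℕ} (hl : ∀ r ∈ l, r.Good n)
    (h : ∀ i < n, σ i = τ i) : tieProd l σ = tieProd l τ := by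
  rw [tieProd, tieProd]
  congr 1
  exact List.map_congr_left fun r hr => Tie.val_congr (h _ (hl r hr).ha) (h _ (hl r hr).hb)

theorem Tie.val_subst (v u : ℕ) (τ : ℂ) (r : Tie) {σ : ℕ → Bool} (h : sgn (σ v) = τ * sgn (σ u)) :
    (r.subst v u τ).val σ = r.val σ := by
  simp only [Tie.val, Tie.subst]
  by_cases ha : r.a = v <;> by_cases hb : r.b = v <;> simp only [ha, hb, if_true, if_false, h] <;>
    ring

theorem tieProd_map_subst (v u : ℕ) (τ : ℂ) (l : List Tie) {σ : ℕ → Bool}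
    (h : sgn (σ v) = τ * sgn (σ u)) : tieProd (l.map (Tie.subst v u τ)) σ = tieProd l σ := by
  induction l with
  | nil => rfl
  | cons r l ih => rw [List.map_cons, tieProd_cons, tieProd_cons, ih, Tie.val_subst v u τ r h]

theorem Tie.subst_self (v : ℕ) (r : Tie) : r.subst v v 1 = r := by
  obtain ⟨a, b, t, p, q⟩ := r
  simp only [Tie.subst, ite_self, one_mul, Tie.mk.injEq, and_true]
  constructor <;> split_ifs with h <;> simp [h]

/-- Elimination of the variable `v`. -/
theorem collected_spec {v : ℕ} {l : List Tie} (hl : ∀ r ∈ l, r.Good (v + 1)) (σ : ℕ → Bool) :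
    (∀ r ∈ (collected v l).2.2, r.Good v) ∧
    ∑ b, tieProd l (Function.update σ v b)
      = (found v l).2.2 * (collected v l).1 * tieProd (collected v l).2.2 σ := by
  rcases foldl_findStep v (v, 1, 2) l with ⟨h1, h2⟩ | ⟨r, hr, h1, h2, h3, h4⟩
  · have hf : found v l = (v, 1, 2) := h1
    have hs : l.reverse.map (Tie.subst v (found v l).1 (found v l).2.1) = l.reverse := by
      rw [hf, List.map_congr_left fun r _ => Tie.subst_self v r, List.map_id']
    have hmem : ∀ r ∈ (collected v l).2.2, r.Good v := by
      intro r hr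
      rw [collected, hs] at hr
      rcases mem_foldl_collectStep _ _ _ _ hr with h | ⟨h, ha⟩
      · simp at h
      · have hg := hl r (by simpa using h)
        have hb : r.b ≠ v := fun hb => ha ((h2 r (by simpa using h)).2 hb)
        exact ⟨by have := hg.ha; omega, by have := hg.hb; omega, hg.ht⟩
    refine ⟨hmem, ?_⟩
    have key : ∀ b, tieProd l (Function.update σ v b)
        = ((collected v l).1 + (collected v l).2.1 * sgn b) * tieProd (collected v l).2.2 σ := by
      intro b
      have := foldl_collectStep v (1, 0, []) l.reverse
        (fun r hr => (h2 r (by simpa using hr)).1) (Function.update σ v b)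
      rw [tieProd_reverse] at this
      rw [← tieProd_congr hmem (σ := Function.update σ v b)
        fun i hi => Function.update_of_ne hi.ne _ _]
      simp only [Function.update_self, zero_mul, add_zero, tieProd_nil, one_mul] at this
      rw [← this, collected, hs]
    simp only [key, Fintype.sum_bool, hf, sgn]
    norm_num
    ring
  · set u := (found v l).1 with hu
    set τ := (found v l).2.1 with hτ
    have hu' : u ≠ v := h3
    have huv : u < v := by
      have hg := hl r hr
      have := hg.ha
      have := hg.hb
      rcases h4 with ⟨-, h⟩ | ⟨-, h⟩ <;> change _ = u at h <;> omega
    have hτr : τ = r.t := h1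
    have hτ1 : τ = 1 ∨ τ = -1 := hτr ▸ (hl r hr).ht
    -- After the substitution no tie mentions `v`, so the second pass collects nothing.
    have hc : collected v l = (1, 0, l.map (Tie.subst v u τ)) := by
      rw [collected, foldl_collectStep_of_ne]
      · simp [← List.map_reverse, hu, hτ]
      · intro r' hr'
        obtain ⟨r'', -, rfl⟩ := List.mem_map.1 hr'
        simp only [Tie.subst]
        split_ifs with h
        · exact hu'
        · exact h
    rw [hc, show (found v l).2.2 = 1 from h2]
    constructor
    · intro r' hr'
      obtain ⟨r'', hr'', rfl⟩ := List.mem_map.1 hr'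
      have hg := hl r'' hr''
      refine ⟨?_, ?_, ?_⟩
      · simp only [Tie.subst]
        split_ifs with h
        · exact huv
        · have := hg.ha; omega
      · simp only [Tie.subst]
        split_ifs with h
        · exact huv
        · have := hg.hb; omega
      · simp only [Tie.subst]
        rcases hg.ht with h | h <;> rcases hτ1 with h' | h' <;> rw [h, h'] <;> split_ifs <;> simp
    -- The tie that was found leaves one admissible value of `v`. There the substitution does not
    -- change the product; at the other value this very tie vanishes.
    · obtain ⟨b₀, hb₀⟩ : ∃ b₀, sgn b₀ = τ * sgn (σ u) := by
        rcases hτ1 with h | h <;> rw [h]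
        · exact ⟨σ u, by simp⟩
        · exact ⟨!σ u, by cases σ u <;> simp [sgn]⟩
      have hg : ∀ r ∈ l.map (Tie.subst v u τ), r.a ≠ v ∧ r.b ≠ v := by
        intro r' hr'
        obtain ⟨r'', -, rfl⟩ := List.mem_map.1 hr'
        simp only [Tie.subst]
        constructor <;> split_ifs with h <;> first | exact hu' | exact h
      rw [Finset.sum_eq_single b₀]
      · rw [← tieProd_map_subst v u τ l]
        · simp only [one_mul]
          rw [tieProd, tieProd]
          congr 1
          refine List.map_congr_left fun r hr => Tie.val_congr ?_ ?_
          · exact Function.update_of_ne (hg r hr).1 _ _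
          · exact Function.update_of_ne (hg r hr).2 _ _
        · rw [Function.update_self, Function.update_of_ne hu', hb₀]
      · intro b _ hb
        have hz : r.val (Function.update σ v b) = 0 := by
          have hne : sgn b = -(τ * sgn (σ u)) := by
            rw [← hb₀]
            revert hb
            cases b <;> cases b₀ <;> simp [sgn]
          have hab : sgn (Function.update σ v b r.a) * sgn (Function.update σ v b r.b)
              = -τ := by
            have e1 := sgn_mul_self (σ u)
            rcases h4 with ⟨h, h'⟩ | ⟨h, h'⟩ <;> change _ = u at h' <;>
              rw [h, h', Function.update_self, Function.update_of_ne hu', hne] <;>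
              linear_combination -τ * e1
          have e2 : τ * τ = 1 := by rcases hτ1 with h | h <;> rw [h] <;> norm_num
          rw [Tie.val, mul_assoc, hab, ← hτr]
          linear_combination (-(r.p + r.q * sgn (Function.update σ v b r.a)) / 2) * e2
        rw [tieProd]
        exact List.prod_eq_zero (List.mem_map.2 ⟨r, hr, hz⟩)
      · simp

/-- The number of ties never grows during the elimination, which keeps its running time polynomial.
-/
theorem collected_length (v : ℕ) (l : List Tie) : (collected v l).2.2.length ≤ l.length := by
  have : ∀ (m : List Tie) (acc : ℂ × ℂ × List Tie),
      (m.foldl (collectStep v) acc).2.2.length ≤ m.length + acc.2.2.length := by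
    intro m
    induction m with
    | nil => simp
    | cons r m ih =>
      intro acc
      refine (ih _).trans ?_
      rw [collectStep]
      split_ifs
      · simp
      · simp
        omega
  simpa [collected] using this (l.reverse.map (Tie.subst v (found v l).1 (found v l).2.1)) (1, 0, [])

/-- The result of the elimination of all variables. -/
def eliminate : ℕ → List Tie → ℂ
  | 0, _ => 1
  | v + 1, l => (found v l).2.2 * (collected v l).1 * eliminate v (collected v l).2.2

/-- The highest variable is the innermost one in `bsum` and is eliminated first. The remaining ties
lie below it, and the factor it leaves is a constant. -/
theorem eliminate_spec (n : ℕ) {l : List Tie} (hl : ∀ r ∈ l, r.Good n) (σ : ℕ → Bool) :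
    bsum 0 n (tieProd l) σ = eliminate n l := by
  induction n generalizing l with
  | zero =>
    cases l with
    | nil => rfl
    | cons r l => exact absurd (hl r (by simp)).ha (by omega)
  | succ n ih =>
    have e : bsum n 1 (tieProd l) = fun σ =>
        (found n l).2.2 * (collected n l).1 * tieProd (collected n l).2.2 σ := by
      funext σ
      exact (collected_spec hl σ).2
    rw [bsum_add, zero_add, e, bsum_mul_left n (fun _ _ _ => rfl), ih (collected_spec hl σ).1,
      eliminate]

/-! ### The elimination program

Stacks: `2` result, `3` ties, `4` scanned ties, `5` number of variables, `10`, `11`, `12` the tie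
found, `13`, `14` collected weights, `15` to `19` the current tie, `20` to `24` scratch. -/

/-- The code of a tie. -/
def Tie.code (r : Tie) : List ℂ := [(r.a : ℂ), (r.b : ℂ), r.t, r.p, r.q]

/-- Read a tie from stack `i`. -/
def readTie (i : ℕ) : Prog :=
  .block [.copy i 15, .pop i, .copy i 16, .pop i, .copy i 17, .pop i, .copy i 18, .pop i,
    .copy i 19, .pop i]

/-- Write a tie to stack `i`. -/
def writeTie (i : ℕ) : Prog :=
  .block [.copy 19 i, .copy 18 i, .copy 17 i, .copy 16 i, .copy 15 i]

/-- The registers hold the tie `r`. -/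
structure TieRegs (s : Store) (r : Tie) : Prop where
  h15 : s.top 15 = r.a
  h16 : s.top 16 = r.b
  h17 : s.top 17 = r.t
  h18 : s.top 18 = r.p
  h19 : s.top 19 = r.q

theorem readTie_exec {i : ℕ} (hi : i < 15) {s : Store} {r : Tie} {l : List ℂ}
    (h : s i = r.code ++ l) : TieRegs ((readTie i).exec s) r ∧ (readTie i).exec s i = l ∧
      ∀ j, j ≠ i → j < 15 ∨ 20 ≤ j → (readTie i).exec s j = s j := by
  simp only [Tie.code, List.cons_append, List.nil_append] at h
  have t := Store.top_eq h
  refine ⟨?_, ?_, fun j hj hj' => ?_⟩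
  · constructor <;> simp [readTie, h, t, (show i ≠ 15 by omega), (show i ≠ 16 by omega),
      (show i ≠ 17 by omega), (show i ≠ 18 by omega),
      (show 15 ≠ i by omega), (show 16 ≠ i by omega), (show 17 ≠ i by omega),
      (show 18 ≠ i by omega), (show 19 ≠ i by omega)]
  · simp [readTie, h, (show i ≠ 15 by omega), (show i ≠ 16 by omega),
      (show i ≠ 17 by omega), (show i ≠ 18 by omega), (show i ≠ 19 by omega)]
  · simp [readTie, hj, (show j ≠ 15 by omega), (show j ≠ 16 by omega),
      (show j ≠ 17 by omega), (show j ≠ 18 by omega), (show j ≠ 19 by omega)]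

theorem writeTie_exec {i : ℕ} (hi : i < 15) {s : Store} {r : Tie} (h : TieRegs s r) :
    (writeTie i).exec s i = r.code ++ s i ∧ ∀ j, j ≠ i → (writeTie i).exec s j = s j := by
  obtain ⟨h15, h16, h17, h18, h19⟩ := h
  refine ⟨?_, fun j hj => ?_⟩
  · simp [writeTie, h15, h16, h17, h18, h19, Tie.code, (show 15 ≠ i by omega),
      (show 16 ≠ i by omega), (show 17 ≠ i by omega), (show 18 ≠ i by omega)]
  · simp [writeTie, hj]

/-- Search for a tie of the current variable. -/
def findBody : Prog :=
  .block [readTie 3, writeTie 4, .arith .minus 15 5 20, .arith .minus 16 5 21,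
    .ite (.nonzero 20)
      (.ite (.nonzero 21) .skip (.block [.copy 15 10, .copy 17 11, .push 12 1]))
      (.ite (.nonzero 21) (.block [.copy 16 10, .copy 17 11, .push 12 1]) .skip)]

theorem findBody_exec {s : Store} {r : Tie} {l : List ℂ} {v : ℕ} {acc : ℕ × ℂ × ℂ}
    (h : s 3 = r.code ++ l) (h5 : s.top 5 = v) (h10 : s.top 10 = acc.1) (h11 : s.top 11 = acc.2.1)
    (h12 : s.top 12 = acc.2.2) :
    findBody.exec s 3 = l ∧ findBody.exec s 4 = r.code ++ s 4 ∧
    (findBody.exec s).top 10 = (findStep v acc r).1 ∧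
    (findBody.exec s).top 11 = (findStep v acc r).2.1 ∧
    (findBody.exec s).top 12 = (findStep v acc r).2.2 := by
  obtain ⟨a1, a2, a3⟩ := readTie_exec (by decide) h
  set s₁ := (readTie 3).exec s with hs₁
  obtain ⟨b1, b2⟩ := writeTie_exec (i := 4) (by decide) a1
  set s₂ := (writeTie 4).exec s₁ with hs₂
  have c : ∀ j, j ≠ 4 → s₂.top j = s₁.top j := fun j hj => by rw [Store.top, b2 j hj, Store.top]
  have d : ∀ j, j ≠ 3 → j < 15 → s₁.top j = s.top j := fun j hj hj' => by
    rw [Store.top, a3 j hj (Or.inl hj'), Store.top]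
  have e5 : s₂.top 5 = v := by rw [c 5 (by decide), d 5 (by decide) (by decide), h5]
  have e10 : s₂.top 10 = acc.1 := by rw [c 10 (by decide), d 10 (by decide) (by decide), h10]
  have e11 : s₂.top 11 = acc.2.1 := by rw [c 11 (by decide), d 11 (by decide) (by decide), h11]
  have e12 : s₂.top 12 = acc.2.2 := by rw [c 12 (by decide), d 12 (by decide) (by decide), h12]
  have e15 : s₂.top 15 = r.a := by rw [c 15 (by decide), a1.h15]
  have e16 : s₂.top 16 = r.b := by rw [c 16 (by decide), a1.h16]
  have e17 : s₂.top 17 = r.t := by rw [c 17 (by decide), a1.h17]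
  have f3 : s₂ 3 = l := by rw [b2 3 (by decide), a2]
  have f4 : s₂ 4 = r.code ++ s 4 := by rw [b1, a3 4 (by decide) (by decide)]
  simp only [findBody, Prog.exec_block_cons, Prog.exec_block_nil, ← hs₁, ← hs₂]
  by_cases ha : r.a = v <;> by_cases hb : r.b = v <;>
    simp [findStep, ha, hb, e5, e10, e11, e12, e15, e16, e17, f3, f4, sub_eq_zero]

theorem runs_findLoop (v : ℕ) (l : List Tie) {s : Store} {acc : ℕ × ℂ × ℂ}
    (h : s 3 = l.flatMap Tie.code) (h5 : s.top 5 = v) (h10 : s.top 10 = acc.1)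
    (h11 : s.top 11 = acc.2.1) (h12 : s.top 12 = acc.2.2) :
    ∃ s', Runs (.loop (.nonempty 3) findBody) ((1 + findBody.cost) * l.length + 1) s s' ∧
      s' 3 = [] ∧ s' 4 = l.reverse.flatMap Tie.code ++ s 4 ∧
      s'.top 10 = (l.foldl (findStep v) acc).1 ∧ s'.top 11 = (l.foldl (findStep v) acc).2.1 ∧
      s'.top 12 = (l.foldl (findStep v) acc).2.2 := by
  induction l generalizing s acc with
  | nil => exact ⟨s, Runs.loop_stop (by simp [h]), by simpa using h, by simp, h10, h11, h12⟩
  | cons r l ih =>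
    rw [List.flatMap_cons] at h
    obtain ⟨a1, a2, a3, a4, a5⟩ := findBody_exec h h5 h10 h11 h12
    have go := runs_exec findBody rfl s
    obtain ⟨s', r1, r2, r3, r4⟩ := ih (s := findBody.exec s) (acc := findStep v acc r) a1
      (by rw [go.frame_top 5 rfl, h5]) a3 a4 a5
    refine ⟨s', (Runs.loop_go (by simp [h, Tie.code]) go r1).mono (le_of_eq ?_), r2, ?_, r4⟩
    · rw [List.length_cons]; ring
    · rw [r3, a2]; simp

/-- Substitute in a tie. -/
def substProg : Prog :=
  .block [.arith .minus 15 5 20, .arith .minus 16 5 21,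
    .ite (.nonzero 20) .skip
      (.block [.copy 10 15, .arith .times 11 17 17, .arith .times 11 19 19]),
    .ite (.nonzero 21) .skip (.block [.copy 10 16, .arith .times 11 17 17])]

theorem substProg_exec {s : Store} {r : Tie} {v u : ℕ} {τ : ℂ} (h : TieRegs s r)
    (h5 : s.top 5 = v) (h10 : s.top 10 = u) (h11 : s.top 11 = τ) :
    TieRegs (substProg.exec s) (r.subst v u τ) ∧ ∀ j, j < 15 → substProg.exec s j = s j := by
  obtain ⟨h15, h16, h17, h18, h19⟩ := h
  refine ⟨?_, fun j hj => (runs_exec substProg rfl s).frame j ?_⟩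
  · by_cases ha : r.a = v <;> by_cases hb : r.b = v <;> constructor <;>
      simp [substProg, Tie.subst, ha, hb, h5, h10, h11, h15, h16, h17, h18, h19, sub_eq_zero,
        mul_assoc]
  · interval_cases j <;> rfl

/-- Collect a weight. -/
def collectProg : Prog :=
  .block [.arith .times 13 18 22, .arith .times 14 19 23, .arith .plus 22 23 22,
    .arith .times 13 19 23, .arith .times 14 18 24, .arith .plus 23 24 23, .push 20 1,
    .arith .plus 20 17 20, .push 21 2, .arith .over 20 21 20, .arith .times 22 20 13,
    .arith .times 23 20 14]

/-- Process a tie in the second pass. -/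
def collectBody : Prog :=
  .block [readTie 4, substProg, .arith .minus 15 5 20,
    .ite (.nonzero 20) (writeTie 3) collectProg]

theorem collectBody_exec {s : Store} {r : Tie} {l : List ℂ} {v u : ℕ} {τ : ℂ}
    {acc : ℂ × ℂ × List Tie} (h : s 4 = r.code ++ l) (h5 : s.top 5 = v) (h10 : s.top 10 = u)
    (h11 : s.top 11 = τ) (h13 : s.top 13 = acc.1) (h14 : s.top 14 = acc.2.1)
    (h3 : s 3 = acc.2.2.flatMap Tie.code) :
    collectBody.exec s 4 = l ∧
    (collectBody.exec s).top 13 = (collectStep v acc (r.subst v u τ)).1 ∧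
    (collectBody.exec s).top 14 = (collectStep v acc (r.subst v u τ)).2.1 ∧
    collectBody.exec s 3 = (collectStep v acc (r.subst v u τ)).2.2.flatMap Tie.code := by
  obtain ⟨a1, a2, a3⟩ := readTie_exec (by decide) h
  set s₁ := (readTie 4).exec s with hs₁
  have d : ∀ j, j ≠ 4 → j < 15 → s₁.top j = s.top j := fun j hj hj' => by
    rw [Store.top, a3 j hj (Or.inl hj'), Store.top]
  obtain ⟨b1, b2⟩ := substProg_exec (v := v) (u := u) (τ := τ) a1
    (by rw [d 5 (by decide) (by decide), h5]) (by rw [d 10 (by decide) (by decide), h10])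
    (by rw [d 11 (by decide) (by decide), h11])
  set s₂ := substProg.exec s₁ with hs₂
  set r' := r.subst v u τ with hr'
  have c : ∀ j, j ≠ 4 → j < 15 → s₂.top j = s.top j := fun j hj hj' => by
    rw [← d j hj hj', Store.top, b2 j hj', Store.top]
  set s₃ := (Prog.arith .minus 15 5 20).exec s₂ with hs₃
  have e5 : s₂.top 5 = v := by rw [c 5 (by decide) (by decide), h5]
  have e13 : s₃.top 13 = acc.1 := by simp [hs₃, c, h13]
  have e14 : s₃.top 14 = acc.2.1 := by simp [hs₃, c, h14]
  have e20 : s₃.top 20 = (r'.a : ℂ) - v := by simp [hs₃, e5, b1.h15]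
  have e : TieRegs s₃ r' := by
    obtain ⟨k15, k16, k17, k18, k19⟩ := b1
    constructor <;> simp [hs₃, k15, k16, k17, k18, k19]
  have f3 : s₃ 3 = acc.2.2.flatMap Tie.code := by
    simp [hs₃, b2, a3, h3]
  have f4 : s₃ 4 = l := by simp [hs₃, b2, a2]
  simp only [collectBody, Prog.exec_block_cons, Prog.exec_block_nil, ← hs₁, ← hs₂, ← hs₃]
  by_cases ha : r'.a = v
  · rw [Prog.exec_ite_neg (by simp [e20, ha])]
    obtain ⟨k15, k16, k17, k18, k19⟩ := e
    simp [collectProg, collectStep, ha, f3, f4, e13, e14, k17, k18, k19]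
  · rw [Prog.exec_ite_pos (by simp [e20, sub_eq_zero, ha])]
    obtain ⟨g1, g2⟩ := writeTie_exec (i := 3) (by decide) e
    have g : ∀ j, j ≠ 3 → ((writeTie 3).exec s₃).top j = s₃.top j := fun j hj => by
      rw [Store.top, g2 j hj, Store.top]
    simp [collectStep, ha, f3, f4, e13, e14, g, g1, g2]

theorem runs_collectLoop (v u : ℕ) (τ : ℂ) (l : List Tie) {s : Store} {acc : ℂ × ℂ × List Tie}
    (h : s 4 = l.flatMap Tie.code) (h5 : s.top 5 = v) (h10 : s.top 10 = u) (h11 : s.top 11 = τ)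
    (h13 : s.top 13 = acc.1) (h14 : s.top 14 = acc.2.1) (h3 : s 3 = acc.2.2.flatMap Tie.code) :
    ∃ s', Runs (.loop (.nonempty 4) collectBody) ((1 + collectBody.cost) * l.length + 1) s s' ∧
      s' 4 = [] ∧ s'.top 13 = ((l.map (Tie.subst v u τ)).foldl (collectStep v) acc).1 ∧
      s' 3 = ((l.map (Tie.subst v u τ)).foldl (collectStep v) acc).2.2.flatMap Tie.code := by
  induction l generalizing s acc with
  | nil => exact ⟨s, Runs.loop_stop (by simp [h]), by simpa using h, h13, h3⟩
  | cons r l ih =>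
    rw [List.flatMap_cons] at h
    obtain ⟨a1, a2, a3, a4⟩ := collectBody_exec h h5 h10 h11 h13 h14 h3
    have go := runs_exec collectBody rfl s
    obtain ⟨s', r1, r2⟩ := ih (s := collectBody.exec s) (acc := collectStep v acc (r.subst v u τ))
      a1 (by rw [go.frame_top 5 rfl, h5]) (by rw [go.frame_top 10 rfl, h10])
      (by rw [go.frame_top 11 rfl, h11]) a2 a3 a4
    refine ⟨s', (Runs.loop_go (by simp [h, Tie.code]) go r1).mono (le_of_eq ?_), r2⟩
    rw [List.length_cons]; ring

/-- Start the elimination of the next variable. -/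
def elimHead : Prog :=
  -- Registers `10` to `12` receive the default `(v, 1, 2)` of the search, and `13`, `14` the empty
  -- product `1 + 0 s`.
  .block [.push 20 1, .arith .minus 5 20 5, .copy 5 10, .push 11 1, .push 12 2, .push 13 1,
    .push 14 0]

/-- Finish the elimination of a variable. -/
def elimTail : Prog := .block [.arith .times 2 12 2, .arith .times 2 13 2]

/-- Eliminate a variable. -/
def elimBody : Prog :=
  .block [elimHead, .loop (.nonempty 3) findBody, .loop (.nonempty 4) collectBody, elimTail]

/-- A bound for the number of steps of the elimination of a variable from `m` ties. -/
def elimCost (m : ℕ) : ℕ :=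
  elimHead.cost + (1 + findBody.cost) * m + (1 + collectBody.cost) * m + elimTail.cost + 7

/-- The bound `m` is kept fixed while the list of ties changes, so that each round has the same
cost. -/
theorem runs_elimLoop (n : ℕ) (m : ℕ) {l : List Tie} (hm : l.length ≤ m) {s : Store}
    (h3 : s 3 = l.flatMap Tie.code) (h4 : s 4 = []) (h5 : s.top 5 = n) :
    ∃ s', Runs (.loop (.nonzero 5) elimBody) ((1 + elimCost m) * n + 1) s s' ∧
      s'.top 2 = s.top 2 * eliminate n l := by
  induction n generalizing s l with
  | zero => exact ⟨s, Runs.loop_stop (by simp [h5]), by simp [eliminate]⟩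
  | succ v ih =>
    have hold : (Test.nonzero 5).Holds s := by
      simp only [Test.holds_nonzero, h5]
      exact_mod_cast v.succ_ne_zero
    have go := runs_exec elimHead rfl s
    set s₀ := elimHead.exec s with hs₀
    have a5 : s₀.top 5 = v := by simp [hs₀, elimHead, h5]
    have a4 : s₀ 4 = [] := by simp [hs₀, elimHead, h4]
    obtain ⟨s₁, b1, b3, b4, b10, b11, b12⟩ := runs_findLoop v l (s := s₀) (acc := (v, 1, 2))
      (by simp [hs₀, elimHead, h3]) a5 (by simp [hs₀, elimHead, h5])
      (by simp [hs₀, elimHead]) (by simp [hs₀, elimHead])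
    rw [a4, List.append_nil] at b4
    obtain ⟨s₂, c1, c4, c13, c3⟩ := runs_collectLoop v _ _ l.reverse (s := s₁) (acc := (1, 0, []))
      b4 (by rw [b1.frame_top 5 rfl, a5]) b10 b11
      (by rw [b1.frame_top 13 rfl]; simp [hs₀, elimHead])
      (by rw [b1.frame_top 14 rfl]; simp [hs₀, elimHead]) (by simpa using b3)
    have go' := runs_exec elimTail rfl s₂
    obtain ⟨s', r1, r2⟩ := ih (s := elimTail.exec s₂) (l := (collected v l).2.2)
      ((collected_length v l).trans hm)
      (by rw [go'.frame 3 rfl]; exact c3) (by rw [go'.frame 4 rfl]; exact c4)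
      (by rw [go'.frame_top 5 rfl, c1.frame_top 5 rfl, b1.frame_top 5 rfl, a5])
    refine ⟨s', (Runs.loop_go hold (go.cons (b1.cons (c1.cons (go'.cons (Runs.nil _))))) r1).mono ?_,
      ?_⟩
    · have h1 : (1 + findBody.cost) * l.length ≤ (1 + findBody.cost) * m := by gcongr
      have h2 : (1 + collectBody.cost) * l.length ≤ (1 + collectBody.cost) * m := by gcongr
      rw [List.length_reverse]
      rw [Nat.mul_succ]
      have h3 : elimCost m = elimHead.cost + (1 + findBody.cost) * m + (1 + collectBody.cost) * m +
        elimTail.cost + 7 := rfl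
      omega
    · have e2 : s₂.top 2 = s.top 2 := by
        rw [c1.frame_top 2 rfl, b1.frame_top 2 rfl, go.frame_top 2 rfl]
      have e12 : s₂.top 12 = (found v l).2.2 := by rw [c1.frame_top 12 rfl]; exact b12
      have e13 : s₂.top 13 = (collected v l).1 := c13
      rw [r2, eliminate]
      simp [elimTail, e2, e12, e13]
      ring

/-! ### Products of unary constraints, equalities and disequalities, in terms of lists of bits -/

/-- Products of constants and of unary, equality and disequality constraints on `k` bits. -/
inductive Splits (k : ℕ) : (List Bool → ℂ) → Prop
  | const (c : ℂ) : Splits k fun _ => c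
  | un (j : ℕ) (hj : j < k) (h : Bool → ℂ) : Splits k fun y => h (y.getD j false)
  | bin (i j : ℕ) (hi : i < k) (hj : j < k) (b : Bool) :
      Splits k fun y => if y.getD i false = (y.getD j false ^^ b) then 1 else 0
  | mul (f g : List Bool → ℂ) (hf : Splits k f) (hg : Splits k g) : Splits k fun y => f y * g y

/-- This serves the case where the first bit is determined by bit `j`: the value at the forced bit
is again a product of the same kind, in the other bits. -/
theorem Splits.subst {k : ℕ} {f : List Bool → ℂ} (hf : Splits (k + 1) f) {j : ℕ} (hj : j < k)
    (b : Bool) : Splits k fun y => f ((y.getD j false ^^ b) :: y) := by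
  induction hf with
  | const c => exact .const c
  | un i hi h =>
    cases i with
    | zero => exact .un j hj fun x => h (x ^^ b)
    | succ i => exact .un i (by omega) h
  | bin i i' hi hi' b' =>
    cases i with
    | zero =>
      cases i' with
      | zero =>
        convert Splits.const (k := k) (if b' = false then 1 else 0) using 2 with y
        cases y.getD j false <;> cases b <;> cases b' <;> simp
      | succ i' =>
        convert Splits.bin (k := k) j i' hj (by omega) (b' ^^ b) using 3 with y
        simp only [List.getD_cons_zero, List.getD_cons_succ]
        cases y.getD j false <;> cases b <;> cases b' <;> cases y.getD i' false <;> simp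
    | succ i =>
      cases i' with
      | zero =>
        convert Splits.bin (k := k) i j (by omega) hj (b ^^ b') using 3 with y
        simp only [List.getD_cons_zero, List.getD_cons_succ]
        cases y.getD j false <;> cases b <;> cases b' <;> cases y.getD i false <;> simp
      | succ i' => exact .bin i i' (by omega) (by omega) b'
  | mul f g _ _ hf hg => exact .mul _ _ hf hg

/-- The first bit is independent of the others, or it is determined by one of them. -/
theorem Splits.untied_or_tied {k : ℕ} {f : List Bool → ℂ} (hf : Splits (k + 1) f) :
    (∃ (h : Bool → ℂ) (g : List Bool → ℂ), Splits k g ∧ ∀ x y, f (x :: y) = h x * g y) ∨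
    ∃ j < k, ∃ b, ∀ x y, x ≠ (y.getD j false ^^ b) → f (x :: y) = 0 := by
  induction hf with
  | const c => exact .inl ⟨fun _ => 1, fun _ => c, .const c, by simp⟩
  | un i hi h =>
    left
    cases i with
    | zero => exact ⟨h, fun _ => 1, .const 1, by simp⟩
    | succ i => exact ⟨fun _ => 1, _, .un i (by omega) h, by simp⟩
  | bin i i' hi hi' b' =>
    cases i with
    | zero =>
      cases i' with
      | zero =>
        refine .inl ⟨fun _ => 1, _, .const (if b' = false then 1 else 0), fun x y => ?_⟩
        cases x <;> cases b' <;> simp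
      | succ i' => exact .inr ⟨i', by omega, b', fun x y h => by simpa using h⟩
    | succ i =>
      cases i' with
      | zero =>
        refine .inr ⟨i, by omega, b', fun x y h => ?_⟩
        simp only [List.getD_cons_zero, List.getD_cons_succ, ite_eq_right_iff, one_ne_zero,
          imp_false]
        revert h
        cases x <;> cases y.getD i false <;> cases b' <;> simp
      | succ i' => exact .inl ⟨fun _ => 1, _, .bin i i' (by omega) (by omega) b', by simp⟩
  | mul f g _ _ hf hg =>
    rcases hf with ⟨h, f', hf', e⟩ | ⟨j, hj, b, e⟩
    · rcases hg with ⟨h', g', hg', e'⟩ | ⟨j, hj, b, e'⟩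
      · exact .inl ⟨fun x => h x * h' x, _, .mul _ _ hf' hg', fun x y => by simp only [e, e']; ring⟩
      · exact .inr ⟨j, hj, b, fun x y hx => by simp only [e' x y hx, mul_zero]⟩
    · exact .inr ⟨j, hj, b, fun x y hx => by simp only [e x y hx, zero_mul]⟩

open Classical in
/-- Some nonzero value for either value of the first bit. -/
def reduct (f : List Bool → ℂ) (y : List Bool) : ℂ :=
  if f (false :: y) = 0 then f (true :: y) else f (false :: y)

/-- For an independent first bit, `reduct f` is a constant multiple of the other factor. For a tied
one it is `f` at the forced value. -/
theorem Splits.reduct {k : ℕ} {f : List Bool → ℂ} (hf : Splits (k + 1) f) :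
    Splits k (reduct f) := by
  rcases hf.untied_or_tied with ⟨h, g, hg, e⟩ | ⟨j, hj, b, e⟩
  · by_cases h0 : h false = 0
    · convert Splits.mul _ _ (.const (h true)) hg using 2 with y
      simp [ComplexCSP.reduct, e, h0]
    · convert Splits.mul _ _ (.const (h false)) hg using 2 with y
      by_cases h1 : g y = 0 <;> simp [ComplexCSP.reduct, e, h0, h1]
  · convert hf.subst hj b using 2 with y
    have e0 := e false y
    have e1 := e true y
    revert e0 e1
    rw [ComplexCSP.reduct]
    cases (y.getD j false ^^ b) <;> simp
    · intro h h'
      rw [h, h']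
    · intro h h'
      exact absurd h h'

open Classical in
/-- The sign of the first bit, if it is determined by the others, and `0` otherwise. -/
def signOf (f : List Bool → ℂ) (y : List Bool) : ℂ :=
  if f (false :: y) = 0 then if f (true :: y) = 0 then 0 else -1
  else if f (true :: y) = 0 then 1 else 0

theorem signOf_mem (f : List Bool → ℂ) (y : List Bool) :
    signOf f y = 0 ∨ signOf f y = 1 ∨ signOf f y = -1 := by
  rw [signOf]
  split_ifs <;> simp

/-- If no more than one value is nonzero, then the sign determines which one. -/
theorem eq_reduct_mul {f : List Bool → ℂ} {y : List Bool}
    (h : f (false :: y) = 0 ∨ f (true :: y) = 0) (x : Bool) :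
    f (x :: y) = reduct f y * ((1 + signOf f y * sgn x) / 2) := by
  rw [reduct, signOf]
  by_cases h0 : f (false :: y) = 0 <;> by_cases h1 : f (true :: y) = 0 <;>
    cases x <;> simp_all [sgn]

/-! ### Rows of tables -/

/-- All lists of `k` bits, where the first one changes fastest. -/
def rows : ℕ → List (List Bool)
  | 0 => [[]]
  | k + 1 => (rows k).flatMap fun y => [false :: y, true :: y]

theorem mem_rows {k : ℕ} {y : List Bool} : y ∈ rows k ↔ y.length = k := by
  induction k generalizing y with
  | zero => simp [rows]
  | succ k ih =>
    rcases y with _ | ⟨x, y⟩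
    · simp [rows]
    · cases x <;> simp [rows, ih]

theorem length_rows (k : ℕ) : (rows k).length = 2 ^ k := by
  induction k with
  | zero => rfl
  | succ k ih => simp [rows, ih, pow_succ]

theorem map_rows_succ {α : Type} (k : ℕ) (g : List Bool → α) :
    (rows (k + 1)).map g = (rows k).flatMap fun y => [g (false :: y), g (true :: y)] := by
  rw [rows, List.map_flatMap]
  rfl

theorem rows_succ_append (k : ℕ) :
    rows (k + 1) = (rows k).map (· ++ [false]) ++ (rows k).map (· ++ [true]) := by
  induction k with
  | zero => rfl
  | succ k ih =>
    have h : ∀ k, rows (k + 1) = (rows k).flatMap fun y => [false :: y, true :: y] := fun _ => rfl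
    rw [h (k + 1)]
    conv_lhs => rw [ih]
    rw [List.flatMap_append, List.flatMap_map, List.flatMap_map, h k, List.map_flatMap,
      List.map_flatMap]
    rfl

/-- Tables vary the last argument fastest, `rows` the first bit; hence the reversed index. In this
order the two values that differ in the first bit are adjacent on the stack. -/
theorem table_eq_map_rows (k : ℕ) (f : (Fin k → Bool) → ℂ) :
    table k f = (rows k).map fun y => f fun i => y.getD (k - 1 - i) false := by
  induction k with
  | zero => simp [table, rows]; congr; funext i; exact i.elim0
  | succ k ih =>
    rw [table, ih, ih, rows_succ_append, List.map_append, List.map_map, List.map_map]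
    congr 1 <;>
    · refine List.map_congr_left fun y hy => congrArg f (funext fun i => ?_)
      rw [mem_rows] at hy
      refine Fin.cases ?_ (fun i => ?_) i
      · simp [← hy]
      · have h1 : k + 1 - 1 - (i.succ : ℕ) = k - 1 - i := by simp; omega
        have h2 : k - 1 - i < y.length := by omega
        rw [h1, List.getD_append _ _ _ _ h2, Fin.cons_succ]

theorem sum_map_rows_succ (k : ℕ) (g : List Bool → ℂ) :
    ((rows (k + 1)).map g).sum = ((rows k).map fun y => g (false :: y) + g (true :: y)).sum := by
  rw [map_rows_succ]
  induction rows k with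
  | nil => rfl
  | cons y l ih => simp [ih, add_assoc]

/-! ### Search for a tie by means of correlations -/

/-- Sum over the first bit. -/
def foldBit (w : List Bool → ℂ) (y : List Bool) : ℂ := w (false :: y) + w (true :: y)

/-- The correlation with the first bit. -/
def correlation (k : ℕ) (w : List Bool → ℂ) : ℂ :=
  ((rows k).map fun y => w (false :: y) - w (true :: y)).sum

open Classical in
/-- Update the candidate if the correlation is maximal. -/
def candStep (N c : ℂ) (v : ℕ) (acc : ℕ × ℂ) : ℕ × ℂ :=
  if c + N = 0 then (v, -1) else if c - N = 0 then (v, 1) else acc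

/-- The variable with maximal correlation, together with the sign. -/
def search (N : ℂ) : List ℕ → (List Bool → ℂ) → ℕ × ℂ → ℕ × ℂ
  | [], _, acc => acc
  | v :: S, w, acc => search N S (foldBit w) (candStep N (correlation S.length w) v acc)

/-- Summing out the first bit does not affect the correlations with the other bits. So every
variable is treated as the first bit in its turn, on a table half as long. -/
theorem search_spec (N : ℂ) (S : List ℕ) (w : List Bool → ℂ) (acc : ℕ × ℂ) :
    (search N S w acc = acc ∧ ∀ j < S.length, ∀ t : ℂ, t = 1 ∨ t = -1 →
      ((rows S.length).map fun y => w y * sgn (y.getD j false)).sum ≠ t * N) ∨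
    ∃ j < S.length, (search N S w acc).1 = S.getD j 0 ∧
      ((search N S w acc).2 = 1 ∨ (search N S w acc).2 = -1) ∧
      ((rows S.length).map fun y => w y * sgn (y.getD j false)).sum
        = (search N S w acc).2 * N := by
  induction S generalizing w acc with
  | nil => exact .inl ⟨rfl, by simp⟩
  | cons v S ih =>
    have h0 : ((rows (v :: S).length).map fun y => w y * sgn (y.getD 0 false)).sum
        = correlation S.length w := by
      rw [List.length_cons, sum_map_rows_succ, correlation]
      congr 2
      funext y
      simp [sgn]
      ring
    have h1 : ∀ j, ((rows (v :: S).length).map fun y => w y * sgn (y.getD (j + 1) false)).sum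
        = ((rows S.length).map fun y => foldBit w y * sgn (y.getD j false)).sum := by
      intro j
      rw [List.length_cons, sum_map_rows_succ]
      congr 2
      funext y
      simp [foldBit, add_mul]
    rw [search]
    rcases ih (foldBit w) (candStep N (correlation S.length w) v acc) with
      ⟨e, h⟩ | ⟨j, hj, e, ht, h⟩
    · rw [e, candStep]
      split_ifs with c1 c2
      · exact .inr ⟨0, by simp, by simp, by simp, by rw [h0]; linear_combination c1⟩
      · exact .inr ⟨0, by simp, by simp, by simp, by rw [h0]; linear_combination c2⟩
      · refine .inl ⟨rfl, fun j hj t ht => ?_⟩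
        cases j with
        | zero =>
          rw [h0]
          rcases ht with rfl | rfl
          · exact fun h => c2 (by rw [h]; ring)
          · exact fun h => c1 (by rw [h]; ring)
        | succ j =>
          rw [h1]
          exact h j (by simpa using hj) t ht
    · exact .inr ⟨j + 1, by simpa using hj, by simpa using e, ht, by rw [h1, h]⟩

/-- A correlation is maximal only if all terms agree. -/
theorem eq_of_sum_eq {α : Type} (l : List α) (w u : α → ℂ)
    (hw : ∀ y ∈ l, w y = 0 ∨ w y = 1 ∨ w y = -1) (hu : ∀ y ∈ l, u y = 1 ∨ u y = -1)
    (h : (l.map fun y => w y * u y).sum = (l.map fun y => w y * w y).sum) :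
    ∀ y ∈ l, w y = 0 ∨ w y = u y := by
  have key : ∀ l : List α, (∀ y ∈ l, w y = 0 ∨ w y = 1 ∨ w y = -1) →
      (∀ y ∈ l, u y = 1 ∨ u y = -1) →
      (l.map fun y => w y * u y).sum.re ≤ (l.map fun y => w y * w y).sum.re ∧
      ((l.map fun y => w y * u y).sum.re = (l.map fun y => w y * w y).sum.re →
        ∀ y ∈ l, w y = 0 ∨ w y = u y) := by
    intro l hw hu
    induction l with
    | nil => simp
    | cons y l ih =>
      obtain ⟨h1, h2⟩ := ih (fun z hz => hw z (by simp [hz])) fun z hz => hu z (by simp [hz])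
      have h3 : (w y * u y).re ≤ (w y * w y).re ∧
          ((w y * u y).re = (w y * w y).re → w y = 0 ∨ w y = u y) := by
        rcases hw y (by simp) with h | h | h <;> rcases hu y (by simp) with h' | h' <;>
          rw [h, h'] <;> norm_num
      simp only [List.map_cons, List.sum_cons, Complex.add_re, List.mem_cons, forall_eq_or_imp]
      exact ⟨add_le_add h3.1 h1, fun e => ⟨h3.2 (by linarith [h3.1]), h2 (by linarith [h3.1])⟩⟩
  exact (key l hw hu).2 (by rw [h])

/-! ### Decomposition of a constraint into ties -/

open Classical in
/-- The ratio of the two values of the first bit in the first row where both are nonzero. -/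
def ratio (f : List Bool → ℂ) : List (List Bool) → ℂ
  | [] => 0
  | y :: l => if f (false :: y) ≠ 0 ∧ f (true :: y) ≠ 0 then f (true :: y) / f (false :: y)
      else ratio f l

theorem ratio_spec (f : List Bool → ℂ) (l : List (List Bool)) :
    (ratio f l = 0 ∧ ∀ y ∈ l, f (false :: y) = 0 ∨ f (true :: y) = 0) ∨
    (ratio f l ≠ 0 ∧ ∃ y ∈ l, f (false :: y) ≠ 0 ∧ f (true :: y) ≠ 0 ∧
      ratio f l = f (true :: y) / f (false :: y)) := by
  induction l with
  | nil => simp [ratio]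
  | cons y l ih =>
    rw [ratio]
    split_ifs with h
    · exact .inr ⟨div_ne_zero h.2 h.1, y, by simp, h.1, h.2, rfl⟩
    · rcases ih with ⟨e, h'⟩ | ⟨e, z, hz, h'⟩
      · refine .inl ⟨e, ?_⟩
        simp only [List.mem_cons, forall_eq_or_imp]
        exact ⟨by tauto, h'⟩
      · exact .inr ⟨e, z, by simp [hz], h'⟩

/-- The number of rows in which the first bit is determined. -/
def total (k : ℕ) (f : List Bool → ℂ) : ℂ := ((rows k).map fun y => signOf f y * signOf f y).sum

/-- The balance of the first bit. -/
def balance (k : ℕ) (f : List Bool → ℂ) : ℂ := ((rows k).map (signOf f)).sum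

/-- The variable to which the first one is tied. -/
def partner (v : ℕ) (S : List ℕ) (f : List Bool → ℂ) : ℕ × ℂ :=
  search (total S.length f) S (signOf f) (v, 1)

open Classical in
/-- The tie for the first variable. -/
def firstTie (v : ℕ) (S : List ℕ) (f : List Bool → ℂ) : Tie :=
  if ratio f (rows S.length) = 0 then
    if balance S.length f - total S.length f = 0 then ⟨v, v, 1, 1 / 2, 1 / 2⟩
    else if balance S.length f + total S.length f = 0 then ⟨v, v, 1, 1 / 2, -1 / 2⟩
    else ⟨v, (partner v S f).1, (partner v S f).2, 1, 0⟩
  else ⟨v, v, 1, (1 + ratio f (rows S.length)) / 2, (1 - ratio f (rows S.length)) / 2⟩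

theorem firstTie_good {n v : ℕ} {S : List ℕ} (f : List Bool → ℂ) (hv : v < n)
    (hS : ∀ u ∈ S, u < n) : (firstTie v S f).Good n := by
  rw [firstTie]
  split_ifs
  · exact ⟨hv, hv, .inl rfl⟩
  · exact ⟨hv, hv, .inl rfl⟩
  · rcases search_spec (total S.length f) S (signOf f) (v, 1) with ⟨e, -⟩ | ⟨j, hj, e, ht, -⟩
    · rw [partner, e]
      exact ⟨hv, hv, .inl rfl⟩
    · refine ⟨hv, ?_, ht⟩
      rw [partner, e, List.getD_eq_getElem _ _ hj]
      exact hS _ (List.getElem_mem hj)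
  · exact ⟨hv, hv, .inl rfl⟩

/-- A row with two nonzero values shows that the first bit is independent, and then the ratio of
these values is its weight. Otherwise the signs decide whether the bit is constant or copies another
bit; by `eq_of_sum_eq`, an extremal sum certifies the chosen description in every row with a sign.
-/
theorem firstTie_spec (v : ℕ) (S : List ℕ) {f : List Bool → ℂ} (hf : Splits (S.length + 1) f)
    (σ : ℕ → Bool) :
    f ((v :: S).map σ) = reduct f (S.map σ) * (firstTie v S f).val σ := by
  have hmem : S.map σ ∈ rows S.length := mem_rows.2 (by simp)
  have hsq : ∀ x : Bool, (1 + 1 * sgn x * sgn x) / 2 = 1 := fun x => by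
    rw [one_mul, sgn_mul_self]; norm_num
  rw [List.map_cons, firstTie]
  rcases ratio_spec f (rows S.length) with ⟨e, h⟩ | ⟨e, y, -, h0, h1, h2⟩
  · rw [if_pos e, eq_reduct_mul (h _ hmem)]
    have hw : ∀ y ∈ rows S.length, signOf f y = 0 ∨ signOf f y = 1 ∨ signOf f y = -1 :=
      fun y _ => signOf_mem f y
    have hz : ∀ y, signOf f y = 0 → (f (false :: y) = 0 ∨ f (true :: y) = 0) →
        reduct f y = 0 := by
      intro y h1 h2
      by_cases h3 : f (false :: y) = 0 <;> by_cases h4 : f (true :: y) = 0 <;>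
        simp_all [signOf, reduct]
    -- In a row without a sign both values vanish, and so does `reduct f`; there any `t` may replace
    -- the sign.
    suffices H : ∀ t : ℂ, (signOf f (S.map σ) = 0 ∨ signOf f (S.map σ) = t) →
        reduct f (S.map σ) * ((1 + signOf f (S.map σ) * sgn (σ v)) / 2)
          = reduct f (S.map σ) * ((1 + t * sgn (σ v)) / 2) by
      split_ifs with c1 c2
      · rw [H 1 (eq_of_sum_eq _ _ (fun _ => 1) hw (by simp) (by
          simpa [balance, total] using sub_eq_zero.1 c1) _ hmem), Tie.val, hsq]
        ring
      · rw [H (-1) (eq_of_sum_eq _ _ (fun _ => -1) hw (by simp) (by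
          have := eq_neg_of_add_eq_zero_right c2
          rw [total, balance] at this
          rw [this, List.sum_map_mul_right]
          ring) _ hmem), Tie.val, hsq]
        ring
      · have htied : ∃ j < S.length, ∃ b, ∀ x y, x ≠ (y.getD j false ^^ b) → f (x :: y) = 0 := by
          rcases hf.untied_or_tied with ⟨g, g', -, e'⟩ | h
          -- Suppose the first bit is independent with factor `g`. If `g true = 0`, all signs are 0
          -- or 1, so balance equals total. Otherwise all values at `false` vanish, and balance is
          -- minus total. Both were excluded.
          · exfalso
            by_cases h1 : g true = 0
            · refine c1 (sub_eq_zero.2 ?_)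
              rw [balance, total]
              congr 2
              funext y
              rw [signOf, e', e', h1]
              split_ifs <;> simp_all
            · have h2 : ∀ y ∈ rows S.length, f (false :: y) = 0 := by
                intro y hy
                rcases h y hy with h | h
                · exact h
                · rw [e'] at h ⊢
                  rw [(mul_eq_zero.1 h).resolve_left h1, mul_zero]
              refine c2 ?_
              rw [balance, total, ← List.sum_map_add]
              refine List.sum_eq_zero fun z hz => ?_
              obtain ⟨y, hy, rfl⟩ := List.mem_map.1 hz
              rw [signOf, if_pos (h2 y hy)]
              split_ifs <;> simp
          · exact h
        -- The tied bit attains the correlation `sgn b * N`, so the search succeeds. It may return a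
        -- different bit, but its extremal correlation is all that is used.
        have hfound : ∃ j < S.length, (partner v S f).1 = S.getD j 0 ∧
            ((partner v S f).2 = 1 ∨ (partner v S f).2 = -1) ∧
            ((rows S.length).map fun y => signOf f y * sgn (y.getD j false)).sum
              = (partner v S f).2 * total S.length f := by
          rcases search_spec (total S.length f) S (signOf f) (v, 1) with ⟨-, h'⟩ | h'
          · obtain ⟨j, hj, b, e'⟩ := htied
            exfalso
            refine h' j hj (sgn b) (sgn_eq_or b) ?_
            rw [total, ← List.sum_map_mul_left]
            congr 2
            funext y
            have e0 := e' false y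
            have e1 := e' true y
            rw [signOf]
            revert e0 e1
            cases y.getD j false <;> cases b <;> simp +contextual [sgn] <;> intro h <;>
              split_ifs <;> simp
          · exact h'
        obtain ⟨j, hj, e1, ht, e2⟩ := hfound
        rw [H ((partner v S f).2 * sgn ((S.map σ).getD j false)) (eq_of_sum_eq _ _
          (fun y => (partner v S f).2 * sgn (y.getD j false)) hw ?_ ?_ _ hmem)]
        · have e3 : (S.map σ).getD j false = σ (partner v S f).1 := by
            rw [e1, List.getD_eq_getElem _ _ hj, List.getD_eq_getElem _ _ (by simpa using hj),
              List.getElem_map]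
          rw [Tie.val, e3]
          ring
        · intro y _
          rcases ht with h | h <;> rcases sgn_eq_or (y.getD j false) with h' | h' <;>
            rw [h, h'] <;> norm_num
        · have e4 : (partner v S f).2 * (partner v S f).2 = 1 := by
            rcases ht with h | h <;> rw [h] <;> norm_num
          have e5 : ((rows S.length).map fun y =>
              signOf f y * ((partner v S f).2 * sgn (y.getD j false)))
              = (rows S.length).map fun y => (partner v S f).2 *
                (signOf f y * sgn (y.getD j false)) := by
            congr 1
            funext y
            ring
          rw [e5, List.sum_map_mul_left, e2, ← mul_assoc, e4, one_mul, total]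
    intro t ht
    rcases ht with h' | h'
    · rw [hz _ h' (h _ hmem), zero_mul, zero_mul]
    · rw [h']
  · rw [if_neg e]
    -- Two nonzero values in one row rule out a tie. For an independent bit the ratio `ρ` is the
    -- same in all rows with nonzero values, and `(1 + ρ) / 2 + (1 - ρ) / 2 * s` takes the values 1
    -- and `ρ` at `s = 1` and `s = -1`.
    rcases hf.untied_or_tied with ⟨g, g', -, e'⟩ | ⟨j, -, b, e'⟩
    · rw [Tie.val, hsq, h2, reduct]
      simp only [e', ne_eq, mul_eq_zero, not_or] at h0 h1 ⊢
      have h3 : g true * g' y / (g false * g' y) = g true / g false :=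
        mul_div_mul_right _ _ h0.2
      rw [h3]
      by_cases h4 : g' (S.map σ) = 0
      · simp [h4]
      · rw [if_neg (by simp [h0.1, h4])]
        have := h0.1
        cases σ v <;> simp only [sgn] <;> field_simp <;> norm_num <;> ring
    · exfalso
      rcases hy : (y.getD j false ^^ b) with _ | _
      · exact h1 (e' true y (by rw [hy]; simp))
      · exact h0 (e' false y (by rw [hy]; simp))

/-- The ties of a constraint. -/
def ties : List ℕ → (List Bool → ℂ) → List Tie
  | [], _ => []
  | v :: S, f => firstTie v S f :: ties S (reduct f)

/-- The constant factor of a constraint. -/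
def tieConst : List ℕ → (List Bool → ℂ) → ℂ
  | [], f => f []
  | _ :: S, f => tieConst S (reduct f)

theorem ties_spec (S : List ℕ) {f : List Bool → ℂ} (hf : Splits S.length f) (σ : ℕ → Bool) :
    f (S.map σ) = tieConst S f * tieProd (ties S f) σ := by
  induction S generalizing f with
  | nil => simp [ties, tieConst]
  | cons v S ih =>
    rw [firstTie_spec v S hf, ih hf.reduct, ties, tieProd_cons, tieConst]
    ring

theorem ties_good {n : ℕ} {S : List ℕ} (hS : ∀ u ∈ S, u < n) (f : List Bool → ℂ) :
    ∀ r ∈ ties S f, r.Good n := by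
  induction S generalizing f with
  | nil => simp [ties]
  | cons v S ih =>
    simp only [List.mem_cons, forall_eq_or_imp] at hS
    simp only [ties, List.mem_cons, forall_eq_or_imp]
    exact ⟨firstTie_good f hS.1 hS.2, ih hS.2 _⟩

theorem length_ties (S : List ℕ) (f : List Bool → ℂ) : (ties S f).length = S.length := by
  induction S generalizing f with
  | nil => rfl
  | cons v S ih => simp [ties, ih]

/-! ### Constraints in `ED` as functions of lists of bits -/

/-- A constraint as a function of lists of bits, in reverse order. -/
def Constraint.onList (f : Constraint) (y : List Bool) : ℂ :=
  f.val fun i => y.getD (f.arity - 1 - i) false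

theorem Splits.prod {k l : ℕ} {g : Fin l → List Bool → ℂ} (h : ∀ i, Splits k (g i)) :
    Splits k fun y => ∏ i, g i y := by
  induction l with
  | zero => simpa using .const 1
  | succ l ih =>
    simp only [Fin.prod_univ_succ]
    exact .mul _ _ (h 0) (ih fun i => h i.succ)

/-- The factorisation in `ED` only guarantees that the decomposition succeeds; the program never
sees it. -/
theorem splits_onList {f : Constraint} (hf : f ∈ ED) : Splits f.arity f.onList := by
  obtain ⟨l₁, l₂, h, j, g, m, n, -, hg, e⟩ := hf
  have lt : ∀ i : Fin f.arity, f.arity - 1 - i < f.arity := fun i => by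
    have := i.isLt
    omega
  have : f.onList = fun y => (∏ i, h i (y.getD (f.arity - 1 - j i) false)) *
      ∏ i, g i (y.getD (f.arity - 1 - m i) false) (y.getD (f.arity - 1 - n i) false) := by
    funext y
    exact e _
  rw [this]
  refine .mul _ _ (.prod fun i => .un _ (lt _) _) (.prod fun i => ?_)
  rcases hg i with h | h <;> rw [h]
  · convert Splits.bin _ _ (lt (m i)) (lt (n i)) false using 3 with y
    simp [binEQ]
  · convert Splits.bin _ _ (lt (m i)) (lt (n i)) true using 2 with y
    cases y.getD (f.arity - 1 - m i) false <;> cases y.getD (f.arity - 1 - n i) false <;>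
      simp [binXOR]

theorem mem_ED_of_unary {f : Constraint} (hf : f ∈ unaryConstraints) : f ∈ ED := by
  obtain ⟨k, hk, f⟩ := f
  obtain rfl : k = 1 := hf
  refine ⟨1, 0, fun _ b => f fun _ => b, fun _ => 0, Fin.elim0, Fin.elim0, Fin.elim0, by simp,
    fun i => i.elim0, fun x => ?_⟩
  simp only [Finset.univ_unique, Finset.prod_const, Finset.card_singleton, pow_one,
    Finset.univ_eq_empty, Finset.prod_empty, mul_one]
  congr 1
  funext i
  rw [Subsingleton.elim i 0]

/-! ### A program that decomposes constraints into ties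

Stacks: `6` the variables of the constraint, `7` its table, both in reverse order; `8` the reduced
table; `9` signs of rows; `33` to `35` ratio, total and balance; `36` scanned variables; `37` folded
signs; `38` correlation; `39`, `40` the partner of the variable in `27`. -/

/-- Read a scope. -/
def scopeBody : Prog :=
  .block [.copy 0 6, .pop 0, .arith .plus 26 26 26, .push 42 1, .arith .minus 25 42 25]

/-- Register `26` doubles with each variable read, so it ends up with the length of the table, which
has to be known to find its end. -/
theorem runs_scopeLoop (S : List ℕ) {s : Store} {l : List ℂ} {c : ℂ}
    (h0 : s 0 = S.map (fun v : ℕ => (v : ℂ)) ++ l) (h25 : s.top 25 = S.length)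
    (h26 : s.top 26 = c) :
    ∃ s', Runs (.loop (.nonzero 25) scopeBody) ((1 + scopeBody.cost) * S.length + 1) s s' ∧
      s' 0 = l ∧ s' 6 = S.reverse.map (fun v : ℕ => (v : ℂ)) ++ s 6 ∧
      s'.top 26 = c * 2 ^ S.length := by
  induction S generalizing s c with
  | nil => exact ⟨s, Runs.loop_stop (by simp [h25]), by simpa using h0, by simp, by simpa using h26⟩
  | cons v S ih =>
    rw [List.map_cons, List.cons_append] at h0
    have hold : (Test.nonzero 25).Holds s := by
      simp only [Test.holds_nonzero, h25]
      exact_mod_cast S.length.succ_ne_zero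
    obtain ⟨s', r, r0, r6, r26⟩ := ih (s := scopeBody.exec s) (c := c + c)
      (by simp [scopeBody, h0]) (by simp [scopeBody, h25]) (by simp [scopeBody, h26])
    refine ⟨s', (Runs.loop_go hold (runs_exec _ rfl s) r).mono (le_of_eq ?_), r0, ?_, ?_⟩
    · rw [List.length_cons]; ring
    · rw [r6]; simp [scopeBody, Store.top_eq h0]
    · rw [r26, List.length_cons]; ring

/-- Read a table. -/
def tableBody : Prog := .block [.copy 0 7, .pop 0, .push 42 1, .arith .minus 26 42 26]

theorem runs_tableLoop (T : List ℂ) {s : Store} {l : List ℂ} (h0 : s 0 = T ++ l)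
    (h26 : s.top 26 = T.length) :
    ∃ s', Runs (.loop (.nonzero 26) tableBody) ((1 + tableBody.cost) * T.length + 1) s s' ∧
      s' 0 = l ∧ s' 7 = T.reverse ++ s 7 := by
  induction T generalizing s with
  | nil => exact ⟨s, Runs.loop_stop (by simp [h26]), by simpa using h0, by simp⟩
  | cons v T ih =>
    rw [List.cons_append] at h0
    have hold : (Test.nonzero 26).Holds s := by
      simp only [Test.holds_nonzero, h26]
      exact_mod_cast T.length.succ_ne_zero
    obtain ⟨s', r, r0, r7⟩ := ih (s := tableBody.exec s)
      (by simp [tableBody, h0]) (by simp [tableBody, h26])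
    refine ⟨s', (Runs.loop_go hold (runs_exec _ rfl s) r).mono (le_of_eq ?_), r0, ?_⟩
    · rw [List.length_cons]; ring
    · rw [r7]; simp [tableBody, Store.top_eq h0]

/-- Process two values that differ in the first bit. -/
def pairBody : Prog :=
  .block [.copy 7 30, .pop 7, .copy 7 31, .pop 7,
    .ite (.nonzero 31)
      (.block [.copy 31 8, .ite (.nonzero 30)
        (.block [.arith .over 30 31 33, .push 32 0]) (.push 32 1)])
      (.block [.copy 30 8, .ite (.nonzero 30) (.push 32 (-1)) (.push 32 0)]),
    .copy 32 9, .arith .plus 35 32 35, .arith .times 32 32 32, .arith .plus 34 32 34]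

theorem pairBody_exec {s : Store} {f : List Bool → ℂ} {y : List Bool} {D : List (List Bool)}
    {l : List ℂ} (h7 : s 7 = f (true :: y) :: f (false :: y) :: l) (h33 : s.top 33 = ratio f D) :
    pairBody.exec s 7 = l ∧ pairBody.exec s 8 = reduct f y :: s 8 ∧
    pairBody.exec s 9 = signOf f y :: s 9 ∧ (pairBody.exec s).top 33 = ratio f (y :: D) ∧
    (pairBody.exec s).top 34 = s.top 34 + signOf f y * signOf f y ∧
    (pairBody.exec s).top 35 = s.top 35 + signOf f y := by
  have t := Store.top_eq h7
  rw [reduct, signOf, ratio]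
  by_cases h0 : f (false :: y) = 0 <;> by_cases h1 : f (true :: y) = 0 <;>
    simp [pairBody, h7, t, h0, h1, h33]

/-- The reversed table presents the last row first. Register `33` is overwritten by each later hit,
so it finally holds the ratio of the earliest row, as in `ratio`. -/
theorem runs_pairLoop (M : List (List Bool)) {s : Store} {f : List Bool → ℂ} {D : List (List Bool)}
    (h7 : s 7 = M.flatMap fun y => [f (true :: y), f (false :: y)])
    (h33 : s.top 33 = ratio f D) :
    ∃ s', Runs (.loop (.nonempty 7) pairBody) ((1 + pairBody.cost) * M.length + 1) s s' ∧
      s' 7 = [] ∧ s' 8 = (M.map (reduct f)).reverse ++ s 8 ∧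
      s' 9 = (M.map (signOf f)).reverse ++ s 9 ∧ s'.top 33 = ratio f (M.reverse ++ D) ∧
      s'.top 34 = s.top 34 + (M.map fun y => signOf f y * signOf f y).sum ∧
      s'.top 35 = s.top 35 + (M.map (signOf f)).sum := by
  induction M generalizing s D with
  | nil => exact ⟨s, Runs.loop_stop (by simp [h7]), by simpa using h7, by simp, by simp,
      by simpa using h33, by simp, by simp⟩
  | cons y M ih =>
    rw [List.flatMap_cons] at h7
    obtain ⟨a7, a8, a9, a33, a34, a35⟩ := pairBody_exec h7 h33
    obtain ⟨s', r, r7, r8, r9, r33, r34, r35⟩ := ih (s := pairBody.exec s) a7 a33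
    refine ⟨s', (Runs.loop_go (by simp [h7]) (runs_exec _ rfl s) r).mono (le_of_eq ?_), r7, ?_, ?_,
      ?_, ?_, ?_⟩
    · rw [List.length_cons]; ring
    · rw [r8, a8]; simp
    · rw [r9, a9]; simp
    · rw [r33]; simp
    · rw [r34, a34]; simp [add_assoc]
    · rw [r35, a35]; simp [add_assoc]

/-- Process two signs that differ in the first bit. -/
def foldBody : Prog :=
  .block [.copy 9 30, .pop 9, .copy 9 31, .pop 9, .arith .plus 30 31 37, .arith .minus 30 31 42,
    .arith .plus 38 42 38]

theorem runs_foldLoop (M : List (List Bool)) {s : Store} {w : List Bool → ℂ}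
    (h9 : s 9 = M.flatMap fun y => [w (false :: y), w (true :: y)]) :
    ∃ s', Runs (.loop (.nonempty 9) foldBody) ((1 + foldBody.cost) * M.length + 1) s s' ∧
      s' 9 = [] ∧ s' 37 = (M.map (foldBit w)).reverse ++ s 37 ∧
      s'.top 38 = s.top 38 + (M.map fun y => w (false :: y) - w (true :: y)).sum := by
  induction M generalizing s with
  | nil => exact ⟨s, Runs.loop_stop (by simp [h9]), by simpa using h9, by simp, by simp⟩
  | cons y M ih =>
    rw [List.flatMap_cons, List.cons_append, List.cons_append, List.nil_append] at h9
    have t := Store.top_eq h9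
    obtain ⟨s', r, r9, r37, r38⟩ := ih (s := foldBody.exec s) (by simp [foldBody, h9])
    refine ⟨s', (Runs.loop_go (by simp [h9]) (runs_exec _ rfl s) r).mono (le_of_eq ?_), r9, ?_, ?_⟩
    · rw [List.length_cons]; ring
    · rw [r37]; simp [foldBody, h9, t, foldBit]
    · rw [r38]; simp [foldBody, h9, t, add_assoc]

/-- Start the comparison with a variable. -/
def searchHead : Prog := .block [.copy 6 41, .copy 6 36, .pop 6, .push 38 0]

/-- Update the partner. -/
def searchTail : Prog :=
  .block [.arith .minus 38 34 42, .arith .plus 38 34 43,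
    .ite (.nonzero 42) .skip (.block [.copy 41 39, .push 40 1]),
    .ite (.nonzero 43) .skip (.block [.copy 41 39, .push 40 (-1)])]

/-- Compare with a variable. -/
def searchBody : Prog :=
  .block [searchHead, .loop (.nonempty 9) foldBody, .move 37 9, searchTail]

/-- A bound for the number of steps of the comparison with a variable for `q` rows. -/
def searchCost (q : ℕ) : ℕ :=
  searchHead.cost + (1 + foldBody.cost) * q + 6 * q + searchTail.cost + 7

/-- The test of `c + N` comes last in the program, so its result lies on top; this matches the
priority of `-1` in `candStep`. -/
theorem searchTail_exec {s : Store} {N c : ℂ} {v : ℕ} {acc : ℕ × ℂ} (h38 : s.top 38 = c)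
    (h34 : s.top 34 = N) (h41 : s.top 41 = v) (h39 : s.top 39 = acc.1) (h40 : s.top 40 = acc.2) :
    (searchTail.exec s).top 39 = (candStep N c v acc).1 ∧
    (searchTail.exec s).top 40 = (candStep N c v acc).2 := by
  rw [candStep]
  by_cases h1 : c - N = 0 <;> by_cases h2 : c + N = 0 <;>
    simp [searchTail, h38, h34, h41, h39, h40, h1, h2]

/-- The signs are folded once per variable, so a single number is left on stack `9`; `varTie` pops
it. The scope is preserved, reversed, on stack `36`. -/
theorem runs_searchLoop (q : ℕ) {N : ℂ} (S : List ℕ) (hq : 2 ^ S.length ≤ q) {s : Store}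
    {w : List Bool → ℂ} {acc : ℕ × ℂ} (h6 : s 6 = S.map fun v : ℕ => (v : ℂ))
    (h9 : s 9 = (rows S.length).map w) (h37 : s 37 = []) (h34 : s.top 34 = N)
    (h39 : s.top 39 = acc.1) (h40 : s.top 40 = acc.2) :
    ∃ s', Runs (.loop (.nonempty 6) searchBody) ((1 + searchCost q) * S.length + 1) s s' ∧
      s' 6 = [] ∧ s' 36 = S.reverse.map (fun v : ℕ => (v : ℂ)) ++ s 36 ∧ (∃ z, s' 9 = [z]) ∧
      s' 37 = [] ∧ s'.top 39 = (search N S w acc).1 ∧ s'.top 40 = (search N S w acc).2 := by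
  induction S generalizing s w acc with
  | nil => exact ⟨s, Runs.loop_stop (by simp [h6]), by simpa using h6, by simp, ⟨_, h9⟩, h37, h39,
      h40⟩
  | cons v S ih =>
    rw [List.map_cons] at h6
    have t6 := Store.top_eq h6
    have hq' : 2 ^ S.length ≤ q := (Nat.pow_le_pow_right (by norm_num) (by simp)).trans hq
    have go := runs_exec searchHead rfl s
    set s₀ := searchHead.exec s with hs₀
    obtain ⟨s₁, a, a9, a37, a38⟩ := runs_foldLoop (rows S.length) (s := s₀) (w := w) (by
      rw [go.frame 9 rfl, h9, List.length_cons, map_rows_succ])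
    rw [go.frame 37 rfl, h37, List.append_nil] at a37
    obtain ⟨s₂, b, b37, b9⟩ := runs_move (i := 37) (j := 9) (by decide) _ s₁ a37
    rw [List.reverse_reverse, a9, List.append_nil] at b9
    have go' := runs_exec searchTail rfl s₂
    obtain ⟨c39, c40⟩ := searchTail_exec (s := s₂) (N := N) (c := correlation S.length w) (v := v)
      (acc := acc) (by rw [b.frame_top 38 rfl, a38]; simp [hs₀, searchHead, correlation])
      (by rw [b.frame_top 34 rfl, a.frame_top 34 rfl, go.frame_top 34 rfl, h34])
      (by rw [b.frame_top 41 rfl, a.frame_top 41 rfl]; simp [hs₀, searchHead, t6])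
      (by rw [b.frame_top 39 rfl, a.frame_top 39 rfl, go.frame_top 39 rfl, h39])
      (by rw [b.frame_top 40 rfl, a.frame_top 40 rfl, go.frame_top 40 rfl, h40])
    have e6 : s₀ 6 = S.map fun v : ℕ => (v : ℂ) := by simp [hs₀, searchHead, h6]
    obtain ⟨s', r, r6, r36, r9⟩ := ih hq' (s := searchTail.exec s₂) (w := foldBit w)
      (acc := candStep N (correlation S.length w) v acc)
      (by rw [go'.frame 6 rfl, b.frame 6 rfl, a.frame 6 rfl, e6])
      (by rw [go'.frame 9 rfl, b9]) (by rw [go'.frame 37 rfl, b37])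
      (by rw [go'.frame_top 34 rfl, b.frame_top 34 rfl, a.frame_top 34 rfl, go.frame_top 34 rfl,
        h34]) c39 c40
    refine ⟨s', (Runs.loop_go (by simp [h6]) (go.cons (a.cons (b.cons (go'.cons (Runs.nil _))))) r
      ).mono ?_, r6, ?_, r9⟩
    · have h1 : (1 + foldBody.cost) * 2 ^ S.length ≤ (1 + foldBody.cost) * q := by gcongr
      have h2 : searchCost q = searchHead.cost + (1 + foldBody.cost) * q + 6 * q +
        searchTail.cost + 7 := rfl
      rw [List.length_reverse, List.length_map, length_rows, List.length_cons, Nat.mul_succ]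
      omega
    · rw [r36, go'.frame 36 rfl, b.frame 36 rfl, a.frame 36 rfl]
      simp [hs₀, searchHead, t6]

/-- Start the treatment of a variable. -/
def varHead : Prog :=
  .block [.copy 6 27, .pop 6, .push 33 0, .push 34 0, .push 35 0]

/-- The default partner. -/
def varMid : Prog := .block [.copy 27 39, .push 40 1]

/-- Compute the tie. -/
def varTie : Prog :=
  .block [.pop 9, .arith .minus 35 34 42, .arith .plus 35 34 43, .copy 27 15, .copy 27 16,
    .push 17 1, .push 30 2, .push 31 1, .arith .over 31 30 18,
    .ite (.nonzero 33)
      (.block [.arith .plus 31 33 42, .arith .over 42 30 18, .arith .minus 31 33 42,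
        .arith .over 42 30 19])
      (.ite (.nonzero 42)
        (.ite (.nonzero 43) (.block [.copy 39 16, .copy 40 17, .push 18 1, .push 19 0])
          (.push 19 (-1 / 2)))
        (.push 19 (1 / 2)))]

theorem varTie_exec {s : Store} {v : ℕ} {S : List ℕ} {f : List Bool → ℂ} (h27 : s.top 27 = v)
    (h33 : s.top 33 = ratio f (rows S.length)) (h34 : s.top 34 = total S.length f)
    (h35 : s.top 35 = balance S.length f) (h39 : s.top 39 = (partner v S f).1)
    (h40 : s.top 40 = (partner v S f).2) : TieRegs (varTie.exec s) (firstTie v S f) := by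
  rw [firstTie]
  by_cases h1 : ratio f (rows S.length) = 0
  · by_cases h2 : balance S.length f - total S.length f = 0
    · constructor <;> simp [varTie, h27, h33, h34, h35, h1, h2]
    · by_cases h3 : balance S.length f + total S.length f = 0 <;> constructor <;>
        simp [varTie, h27, h33, h34, h35, h39, h40, h1, h2, h3]
  · constructor <;> simp [varTie, h27, h33, h34, h35, h1]

/-- Treat a variable. -/
def varBody : Prog :=
  .block [varHead, .loop (.nonempty 7) pairBody, .move 8 7, varMid,
    .loop (.nonempty 6) searchBody, .move 36 6, varTie, writeTie 3]

/-- A bound for the number of steps of the treatment of a variable. -/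
def varCost (k q : ℕ) : ℕ :=
  varHead.cost + (1 + pairBody.cost) * q + 6 * q + varMid.cost + (1 + searchCost q) * k + 6 * k +
    varTie.cost + (writeTie 3).cost + 13

/-- The auxiliary stacks are empty. -/
structure Clean (s : Store) : Prop where
  h8 : s 8 = []
  h9 : s 9 = []
  h36 : s 36 = []
  h37 : s 37 = []

/-- Each round replaces the table by that of `reduct f`, of half the length, in the same reversed
form. The last remaining entry is the constant factor. -/
theorem runs_varLoop (k q : ℕ) (S : List ℕ) (hk : S.length ≤ k) (hq : 2 ^ S.length ≤ q) {s : Store}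
    {f : List Bool → ℂ} (hs : Clean s) (h6 : s 6 = S.map fun v : ℕ => (v : ℂ))
    (h7 : s 7 = ((rows S.length).map f).reverse) :
    ∃ s', Runs (.loop (.nonempty 6) varBody) ((1 + varCost k q) * S.length + 1) s s' ∧ Clean s' ∧
      s' 6 = [] ∧ s' 7 = [tieConst S f] ∧
      s' 3 = (ties S f).reverse.flatMap Tie.code ++ s 3 := by
  induction S generalizing s f with
  | nil => exact ⟨s, Runs.loop_stop (by simp [h6]), hs, by simpa using h6, h7, by simp [ties]⟩
  | cons v S ih =>
    rw [List.map_cons] at h6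
    have t6 := Store.top_eq h6
    have hk' : S.length ≤ k := by rw [List.length_cons] at hk; omega
    have hq' : 2 ^ S.length ≤ q := (Nat.pow_le_pow_right (by norm_num) (by simp)).trans hq
    have g1 := runs_exec varHead rfl s
    set s₁ := varHead.exec s with hs₁
    obtain ⟨s₂, g2, a7, a8, a9, a33, a34, a35⟩ := runs_pairLoop (rows S.length).reverse (s := s₁)
      (f := f) (D := []) (by
        rw [g1.frame 7 rfl, h7, List.length_cons, map_rows_succ, List.reverse_flatMap]
        rfl) (by simp [hs₁, varHead, ratio])
    rw [List.reverse_reverse, List.append_nil] at a33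
    rw [List.map_reverse, List.reverse_reverse, g1.frame 8 rfl, hs.h8, List.append_nil] at a8
    rw [List.map_reverse, List.reverse_reverse, g1.frame 9 rfl, hs.h9, List.append_nil] at a9
    rw [List.map_reverse, List.sum_reverse] at a34 a35
    obtain ⟨s₃, g3, b8, b7⟩ := runs_move (i := 8) (j := 7) (by decide) _ s₂ a8
    rw [a7, List.append_nil] at b7
    have g4 := runs_exec varMid rfl s₃
    set s₄ := varMid.exec s₃ with hs₄
    have e27 : s₁.top 27 = v := by simp [hs₁, varHead, t6]
    have e27' : s₃.top 27 = v := by rw [g3.frame_top 27 rfl, g2.frame_top 27 rfl, e27]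
    have e6 : s₁ 6 = S.map fun v : ℕ => (v : ℂ) := by simp [hs₁, varHead, h6]
    have e34 : s₄.top 34 = total S.length f := by
      rw [g4.frame_top 34 rfl, g3.frame_top 34 rfl, a34]
      simp [hs₁, varHead, total]
    have e35 : s₄.top 35 = balance S.length f := by
      rw [g4.frame_top 35 rfl, g3.frame_top 35 rfl, a35]
      simp [hs₁, varHead, balance]
    obtain ⟨s₅, g5, c6, c36, ⟨z, c9⟩, c37, c39, c40⟩ := runs_searchLoop q S hq' (s := s₄)
      (w := signOf f) (acc := (v, 1))
      (by rw [g4.frame 6 rfl, g3.frame 6 rfl, g2.frame 6 rfl, e6])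
      (by rw [g4.frame 9 rfl, g3.frame 9 rfl, a9])
      (by rw [g4.frame 37 rfl, g3.frame 37 rfl, g2.frame 37 rfl, g1.frame 37 rfl, hs.h37]) e34
      (by simp [hs₄, varMid, e27']) (by simp [hs₄, varMid])
    rw [g4.frame 36 rfl, g3.frame 36 rfl, g2.frame 36 rfl, g1.frame 36 rfl, hs.h36,
      List.append_nil] at c36
    obtain ⟨s₆, g6, d36, d6⟩ := runs_move (i := 36) (j := 6) (by decide) _ s₅ c36
    rw [c6, List.append_nil, List.map_reverse, List.reverse_reverse] at d6
    have g7 := runs_exec varTie rfl s₆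
    have hr := varTie_exec (s := s₆) (v := v) (S := S) (f := f)
      (by rw [g6.frame_top 27 rfl, g5.frame_top 27 rfl, g4.frame_top 27 rfl, e27'])
      (by rw [g6.frame_top 33 rfl, g5.frame_top 33 rfl, g4.frame_top 33 rfl, g3.frame_top 33 rfl,
        a33])
      (by rw [g6.frame_top 34 rfl, g5.frame_top 34 rfl, e34])
      (by rw [g6.frame_top 35 rfl, g5.frame_top 35 rfl, e35])
      (by rw [g6.frame_top 39 rfl, c39, partner]) (by rw [g6.frame_top 40 rfl, c40, partner])
    have f9 : varTie.exec s₆ 9 = [] := by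
      have : s₆ 9 = [z] := by rw [g6.frame 9 rfl, c9]
      by_cases h1 : s₆.top 33 = 0 <;> by_cases h2 : s₆.top 35 - s₆.top 34 = 0 <;>
        by_cases h3 : s₆.top 35 + s₆.top 34 = 0 <;> simp [varTie, this, h1, h2, h3]
    set s₇ := varTie.exec s₆ with hs₇
    have g8 := runs_exec (writeTie 3) rfl s₇
    obtain ⟨k3, -⟩ := writeTie_exec (i := 3) (by decide) hr
    have e3 : s₇ 3 = s 3 := by
      rw [g7.frame 3 rfl, g6.frame 3 rfl, g5.frame 3 rfl, g4.frame 3 rfl, g3.frame 3 rfl,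
        g2.frame 3 rfl, g1.frame 3 rfl]
    obtain ⟨s', r, r1, r2, r3, r4⟩ := ih hk' hq' (s := (writeTie 3).exec s₇) (f := reduct f)
      ⟨by rw [g8.frame 8 rfl, g7.frame 8 rfl, g6.frame 8 rfl, g5.frame 8 rfl, g4.frame 8 rfl, b8],
        by rw [g8.frame 9 rfl, f9], by rw [g8.frame 36 rfl, g7.frame 36 rfl, d36],
        by rw [g8.frame 37 rfl, g7.frame 37 rfl, g6.frame 37 rfl, c37]⟩
      (by rw [g8.frame 6 rfl, g7.frame 6 rfl, d6])
      (by rw [g8.frame 7 rfl, g7.frame 7 rfl, g6.frame 7 rfl, g5.frame 7 rfl, g4.frame 7 rfl, b7])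
    refine ⟨s', (Runs.loop_go (by simp [h6]) (g1.cons (g2.cons (g3.cons (g4.cons (g5.cons (g6.cons
      (g7.cons (g8.cons (Runs.nil _))))))))) r).mono ?_, r1, r2, r3, ?_⟩
    · have h1 : (1 + pairBody.cost) * 2 ^ S.length ≤ (1 + pairBody.cost) * q := by gcongr
      have h2 : (1 + searchCost q) * S.length ≤ (1 + searchCost q) * k := by gcongr
      have h3 : varCost k q = varHead.cost + (1 + pairBody.cost) * q + 6 * q + varMid.cost +
        (1 + searchCost q) * k + 6 * k + varTie.cost + (writeTie 3).cost + 13 := rfl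
      simp only [List.length_reverse, List.length_map, length_rows, List.length_cons]
      rw [Nat.mul_succ]
      omega
    · rw [r4, k3, e3]
      simp [ties]

/-- Start the treatment of a constraint. -/
def appHead : Prog := .block [.copy 0 25, .pop 0, .push 26 1]

/-- Finish the treatment of a constraint. -/
def appTail : Prog := .block [.arith .times 2 7 2, .pop 7]

/-- Treat a constraint. -/
def appBody : Prog :=
  .block [appHead, .loop (.nonzero 25) scopeBody, .loop (.nonzero 26) tableBody,
    .loop (.nonempty 6) varBody, appTail]

/-- A bound for the number of steps of the treatment of a constraint. -/
def appCost (m : ℕ) : ℕ :=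
  appHead.cost + (1 + scopeBody.cost) * m + (1 + tableBody.cost) * m + (1 + varCost m m) * m +
    appTail.cost + 9

/-- The variables of a constraint in reverse order. -/
def App.revScope (a : App ℕ) : List ℕ := (List.ofFn a.scope).reverse

theorem App.length_revScope (a : App ℕ) : a.revScope.length = a.con.arity := by
  simp [App.revScope]

/-- The ties of a list of constraints. -/
def allTies (L : List (App ℕ)) : List Tie := L.flatMap fun a => ties a.revScope a.con.onList

theorem runs_appLoop (m : ℕ) (L : List (App ℕ)) (hm : ∀ a ∈ L, a.code.length ≤ m) {s : Store}
    (hs : Clean s) (h0 : s 0 = L.flatMap App.code) (h6 : s 6 = []) (h7 : s 7 = []) :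
    ∃ s', Runs (.loop (.nonempty 0) appBody) ((1 + appCost m) * L.length + 1) s s' ∧
      s' 3 = (allTies L).reverse.flatMap Tie.code ++ s 3 ∧
      s'.top 2 = s.top 2 * (L.map fun a => tieConst a.revScope a.con.onList).prod := by
  induction L generalizing s with
  | nil => exact ⟨s, Runs.loop_stop (by simp [h0]), by simp [allTies], by simp⟩
  | cons a L ih =>
    -- The code of the constraint contains its whole table, so loops over `2 ^ k` rows take time
    -- linear in the input.
    have ha : a.con.arity + 2 ^ a.con.arity ≤ m := by
      refine le_trans ?_ (hm a (by simp))
      simp [App.code, table_length]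
    have ha₁ : a.con.arity ≤ m := (Nat.le_add_right _ _).trans ha
    have ha₂ : 2 ^ a.con.arity ≤ m := (Nat.le_add_left _ _).trans ha
    have hcode : a.code = (a.con.arity : ℂ) :: ((List.ofFn a.scope).map (fun v : ℕ => (v : ℂ)) ++
        table a.con.arity a.con.val) := by
      rw [App.code, List.map_ofFn]
      rfl
    rw [List.flatMap_cons, hcode, List.cons_append, List.append_assoc] at h0
    have t0 := Store.top_eq h0
    have g1 := runs_exec appHead rfl s
    set s₁ := appHead.exec s with hs₁
    obtain ⟨s₂, g2, a0, a6, a26⟩ := runs_scopeLoop (List.ofFn a.scope) (s := s₁) (c := 1)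
      (l := table a.con.arity a.con.val ++ L.flatMap App.code)
      (by simp [hs₁, appHead, h0]) (by simp [hs₁, appHead, t0])
      (by simp [hs₁, appHead])
    obtain ⟨s₃, g3, b0, b7⟩ := runs_tableLoop (table a.con.arity a.con.val) a0
      (by rw [a26, table_length]; simp)
    obtain ⟨s₄, g4, c, c6, c7, c3⟩ := runs_varLoop m m a.revScope
      (by rwa [a.length_revScope]) (by rwa [a.length_revScope]) (s := s₃)
      (f := a.con.onList)
      ⟨by rw [g3.frame 8 rfl, g2.frame 8 rfl, g1.frame 8 rfl, hs.h8],
        by rw [g3.frame 9 rfl, g2.frame 9 rfl, g1.frame 9 rfl, hs.h9],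
        by rw [g3.frame 36 rfl, g2.frame 36 rfl, g1.frame 36 rfl, hs.h36],
        by rw [g3.frame 37 rfl, g2.frame 37 rfl, g1.frame 37 rfl, hs.h37]⟩
      (by rw [g3.frame 6 rfl, a6, g1.frame 6 rfl, h6, List.append_nil, App.revScope])
      (by rw [b7, g2.frame 7 rfl, g1.frame 7 rfl, h7, List.append_nil, a.length_revScope,
        table_eq_map_rows]; rfl)
    have g5 := runs_exec appTail rfl s₄
    obtain ⟨s', r, r3, r2⟩ := ih (fun a ha => hm a (by simp [ha])) (s := appTail.exec s₄)
      ⟨by rw [g5.frame 8 rfl, c.h8], by rw [g5.frame 9 rfl, c.h9],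
        by rw [g5.frame 36 rfl, c.h36], by rw [g5.frame 37 rfl, c.h37]⟩
      (by rw [g5.frame 0 rfl, g4.frame 0 rfl, b0]) (by rw [g5.frame 6 rfl, c6])
      (by simp [appTail, c7])
    refine ⟨s', (Runs.loop_go (by simp [h0]) (g1.cons (g2.cons (g3.cons (g4.cons (g5.cons
      (Runs.nil _)))))) r).mono ?_, ?_, ?_⟩
    · have h1 : (1 + scopeBody.cost) * a.con.arity ≤ (1 + scopeBody.cost) * m := by gcongr
      have h2 : (1 + tableBody.cost) * 2 ^ a.con.arity ≤ (1 + tableBody.cost) * m := by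
        gcongr
      have h3 : (1 + varCost m m) * a.con.arity ≤ (1 + varCost m m) * m := by gcongr
      have h4 : appCost m = appHead.cost + (1 + scopeBody.cost) * m + (1 + tableBody.cost) * m +
        (1 + varCost m m) * m + appTail.cost + 9 := rfl
      rw [List.length_ofFn, table_length, a.length_revScope, List.length_cons, Nat.mul_succ]
      omega
    · rw [r3, g5.frame 3 rfl, c3, g3.frame 3 rfl, g2.frame 3 rfl, g1.frame 3 rfl]
      simp [allTies]
    · have e2 : s₄.top 2 = s.top 2 := by
        rw [g4.frame_top 2 rfl, g3.frame_top 2 rfl, g2.frame_top 2 rfl, g1.frame_top 2 rfl]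
      rw [r2]
      simp [appTail, e2, Store.top_eq c7, mul_assoc]

/-! ### The complete evaluation program and its correctness -/

/-- Count the variables. -/
def countBody : Prog := .block [.pop 0, .push 42 1, .arith .plus 5 42 5]

theorem runs_countLoop (n : ℕ) {s : Store} {l : List ℂ} {c : ℂ}
    (h0 : s 0 = List.replicate n 1 ++ 0 :: l) (h5 : s.top 5 = c) :
    ∃ s', Runs (.loop (.nonzero 0) countBody) ((1 + countBody.cost) * n + 1) s s' ∧
      s' 0 = 0 :: l ∧ s'.top 5 = c + n := by
  induction n generalizing s c with
  | zero => exact ⟨s, Runs.loop_stop (by simp [Store.top_eq h0]), h0, by simpa using h5⟩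
  | succ n ih =>
    rw [List.replicate_succ, List.cons_append] at h0
    obtain ⟨s', r, r0, r5⟩ := ih (s := countBody.exec s) (c := c + 1) (by simp [countBody, h0])
      (by simp [countBody, h5])
    refine ⟨s', (Runs.loop_go (by simp [Store.top_eq h0]) (runs_exec _ rfl s) r).mono
      (le_of_eq ?_), r0, ?_⟩
    · ring
    · rw [r5]; push_cast; ring

/-- Evaluate an instance whose constraints are products of unary constraints, equalities and
disequalities. -/
def evalProg : Prog :=
  .block [.push 2 1, .loop (.nonzero 0) countBody, .pop 0, .loop (.nonempty 0) appBody,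
    .loop (.nonzero 5) elimBody, .copy 2 0]

/-- A bound for the number of steps of `evalProg`. -/
def evalCost (m : ℕ) : ℕ :=
  (1 + countBody.cost) * m + (1 + appCost m) * m + (1 + elimCost m) * m + 13

/-- Every constraint is a constant times its ties, so the whole instance is a constant times one
product of ties. The list is reversed because the program stacks the ties it finds. -/
theorem bsum_prodApps (n : ℕ) (L : List (App ℕ)) (hL : ∀ a ∈ L, a.con ∈ ED) (hn : AppsBelow n L)
    (σ : ℕ → Bool) :
    bsum 0 n (prodApps L) σ
      = (L.map fun a => tieConst a.revScope a.con.onList).prod *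
        eliminate n (allTies L).reverse := by
  have hgood : ∀ r ∈ (allTies L).reverse, r.Good n := by
    intro r hr
    obtain ⟨a, ha, hr⟩ := List.mem_flatMap.1 (List.mem_reverse.1 hr)
    refine ties_good (fun u hu => ?_) _ r hr
    obtain ⟨i, rfl⟩ := (List.mem_ofFn' _ _).1 (List.mem_reverse.1 hu)
    exact hn a ha i
  have hprod : prodApps L = fun σ => (L.map fun a => tieConst a.revScope a.con.onList).prod *
      tieProd (allTies L).reverse σ := by
    funext σ
    rw [tieProd_reverse]
    clear hgood hn
    induction L with
    | nil => simp [prodApps, allTies]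
    | cons a L ih =>
      have h1 : a.eval σ = a.con.onList (a.revScope.map σ) := by
        rw [App.eval, Constraint.onList]
        congr 1
        funext i
        have hi := i.isLt
        rw [App.revScope, List.getD_eq_getElem _ _ (by simp; omega)]
        simp only [List.getElem_map, List.getElem_reverse, List.getElem_ofFn, List.length_ofFn]
        congr 2
        ext
        simp
        omega
      have h2 : prodApps (a :: L) σ = a.eval σ * prodApps L σ := by simp [prodApps]
      rw [h2, ih fun a ha => hL a (by simp [ha]), h1, ties_spec a.revScope (f := a.con.onList) (by
        rw [a.length_revScope]
        exact splits_onList (hL a (by simp)))]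
      simp only [allTies, List.flatMap_cons, tieProd_append, List.map_cons, List.prod_cons]
      ring
  rw [hprod, bsum_mul_left n (fun _ _ _ => rfl), eliminate_spec n hgood]

/-- There is one tie for each entry of a scope, and scopes are spelled out in the code. -/
theorem length_allTies_le (L : List (App ℕ)) :
    (allTies L).length ≤ (L.flatMap App.code).length := by
  induction L with
  | nil => simp [allTies]
  | cons a L ih =>
    simp only [allTies, List.flatMap_cons, List.length_append] at ih ⊢
    refine add_le_add ?_ ih
    rw [length_ties, a.length_revScope]
    simp [App.code]
    omega

theorem length_le_flatMap_code (L : List (App ℕ)) : L.length ≤ (L.flatMap App.code).length := by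
  induction L with
  | nil => simp
  | cons a L ih =>
    simp only [List.flatMap_cons, List.length_append, List.length_cons, App.code]
    omega

theorem length_code_le {L : List (App ℕ)} {a : App ℕ} (ha : a ∈ L) :
    a.code.length ≤ (L.flatMap App.code).length :=
  (List.sublist_flatten_of_mem (List.mem_map_of_mem ha)).length_le

theorem runs_evalProg {F : Set Constraint} (hF : F ⊆ ED) (I : CSPInst F) {s : Store}
    (h0 : s 0 = I.code) (hs : ∀ j, j ≠ 0 → s j = []) :
    ∃ s', Runs evalProg (evalCost I.code.length) s s' ∧ s'.top 0 = I.value := by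
  set L := I.apps.map Application.toApp with hL
  have hED : ∀ a ∈ L, a.con ∈ ED := by
    intro a ha
    obtain ⟨b, hb, rfl⟩ := List.mem_map.1 ha
    exact hF (I.mem b hb)
  have hbelow : AppsBelow I.n L := by
    intro a ha i
    obtain ⟨b, hb, rfl⟩ := List.mem_map.1 ha
    exact (b.scope i).isLt
  have hlen : I.code.length = I.n + ((L.flatMap App.code).length + 1) := by
    rw [I.code_eq]
    simp [hL]
  set m := I.code.length with hm
  have g1 := runs_exec (.push 2 1) rfl s
  set s₁ := (Prog.push 2 1).exec s with hs₁
  obtain ⟨s₂, g2, a0, a5⟩ := runs_countLoop I.n (s := s₁) (l := L.flatMap App.code) (c := 0)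
    (by rw [g1.frame 0 rfl, h0, I.code_eq])
    (by rw [g1.frame_top 5 rfl]; simp [Store.top, hs 5 (by decide)])
  have g3 := runs_exec (.pop 0) rfl s₂
  set s₃ := (Prog.pop 0).exec s₂ with hs₃
  have e : ∀ j, (Prog.push 2 1).touches j = false →
      (Prog.loop (.nonzero 0) countBody).touches j = false → (Prog.pop 0).touches j = false →
      j ≠ 0 → s₃ j = [] := fun j h1 h2 h3 hj => by
    rw [g3.frame j h3, g2.frame j h2, g1.frame j h1, hs j hj]
  obtain ⟨s₄, g4, b3, b2⟩ := runs_appLoop m L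
    (fun a ha => (length_code_le ha).trans (by omega)) (s := s₃)
    ⟨e 8 rfl rfl rfl (by decide), e 9 rfl rfl rfl (by decide), e 36 rfl rfl rfl (by decide),
      e 37 rfl rfl rfl (by decide)⟩ (by simp [hs₃, a0]) (e 6 rfl rfl rfl (by decide))
    (e 7 rfl rfl rfl (by decide))
  rw [e 3 rfl rfl rfl (by decide), List.append_nil] at b3
  have hties : (allTies L).reverse.length ≤ m := by
    have := length_allTies_le L
    rw [List.length_reverse]
    omega
  obtain ⟨s₅, g5, c2⟩ := runs_elimLoop I.n m hties (s := s₄) b3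
    (by rw [g4.frame 4 rfl, e 4 rfl rfl rfl (by decide)])
    (by rw [g4.frame_top 5 rfl, g3.frame_top 5 rfl, a5, zero_add])
  have g6 := runs_exec (.copy 2 0) rfl s₅
  refine ⟨_, (g1.cons (g2.cons (g3.cons (g4.cons (g5.cons (g6.cons (Runs.nil _))))))).mono ?_, ?_⟩
  · have h1 : (1 + countBody.cost) * I.n ≤ (1 + countBody.cost) * m := by gcongr; omega
    have h2 : (1 + appCost m) * L.length ≤ (1 + appCost m) * m := by
      gcongr
      have := length_le_flatMap_code L
      omega
    have h3 : (1 + elimCost m) * I.n ≤ (1 + elimCost m) * m := by gcongr; omega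
    have h4 : evalCost m = (1 + countBody.cost) * m + (1 + appCost m) * m + (1 + elimCost m) * m +
      13 := rfl
    simp only [Prog.cost]
    omega
  · have e2 : s₃.top 2 = 1 := by
      rw [g3.frame_top 2 rfl, g2.frame_top 2 rfl]
      simp [hs₁]
    rw [I.value_eq fun _ => false, bsum_prodApps _ _ hED hbelow]
    simp [c2, b2, e2]

/-! ### The running time of the evaluation is polynomial -/

/-- Functions given by polynomials. -/
def IsPoly (f : ℕ → ℕ) : Prop := ∃ b : Polynomial ℕ, ∀ m, b.eval m = f m

theorem IsPoly.const (c : ℕ) : IsPoly fun _ => c := ⟨.C c, by simp⟩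

theorem IsPoly.id : IsPoly fun m => m := ⟨.X, by simp⟩

theorem IsPoly.add {f g : ℕ → ℕ} (hf : IsPoly f) (hg : IsPoly g) : IsPoly fun m => f m + g m :=
  let ⟨b, hb⟩ := hf
  let ⟨c, hc⟩ := hg
  ⟨b + c, by simp [hb, hc]⟩

theorem IsPoly.mul {f g : ℕ → ℕ} (hf : IsPoly f) (hg : IsPoly g) : IsPoly fun m => f m * g m :=
  let ⟨b, hb⟩ := hf
  let ⟨c, hc⟩ := hg
  ⟨b * c, by simp [hb, hc]⟩

theorem isPoly_searchCost : IsPoly searchCost :=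
  ((((IsPoly.const _).add ((IsPoly.const _).mul .id)).add ((IsPoly.const _).mul .id)).add
    (.const _)).add (.const _)

theorem isPoly_varCost : IsPoly fun m => varCost m m :=
  ((((((((IsPoly.const _).add ((IsPoly.const _).mul .id)).add ((IsPoly.const _).mul .id)).add
    (.const _)).add (((IsPoly.const _).add isPoly_searchCost).mul .id)).add
    ((IsPoly.const _).mul .id)).add (.const _)).add (.const _)).add (.const _)

theorem isPoly_appCost : IsPoly appCost :=
  (((((IsPoly.const _).add ((IsPoly.const _).mul .id)).add ((IsPoly.const _).mul .id)).add
    (((IsPoly.const _).add isPoly_varCost).mul .id)).add (.const _)).add (.const _)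

theorem isPoly_elimCost : IsPoly elimCost :=
  ((((IsPoly.const _).add ((IsPoly.const _).mul .id)).add ((IsPoly.const _).mul .id)).add
    (.const _)).add (.const _)

theorem isPoly_evalCost : IsPoly evalCost :=
  ((((IsPoly.const _).mul .id).add (((IsPoly.const _).add isPoly_appCost).mul .id)).add
    (((IsPoly.const _).add isPoly_elimCost).mul .id)).add (.const _)

/-- Products of unary constraints, equalities and disequalities can be counted in polynomial
time. -/
theorem polyTime_of_subset_ED {F : Set Constraint} (hF : F ⊆ ED) : (CSPStar F).PolyTime := by
  obtain ⟨b, hb⟩ := isPoly_evalCost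
  refine ⟨evalProg, b, fun I => ?_⟩
  obtain ⟨s', r, h⟩ := runs_evalProg (Set.union_subset hF fun f hf => mem_ED_of_unary hf) I
    (s := fun i => if i = 0 then (CSPStar F).code I else []) rfl (fun j hj => by simp [hj])
  obtain ⟨t, ht, r⟩ := r []
  exact ⟨t, by rw [hb]; exact ht, _, r, rfl, h⟩

end

end ComplexCSP

theorem theorem1p1 (F : Set ComplexCSP.Constraint) :
    (F ⊆ ComplexCSP.ED → (ComplexCSP.CSPStar F).PolyTime) ∧
    (¬ F ⊆ ComplexCSP.ED → ComplexCSP.APReducible ComplexCSP.SATC (ComplexCSP.CSPStar F)) := 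
  ⟨ComplexCSP.polyTime_of_subset_ED, ComplexCSP.apReducible_of_not_subset_ED⟩
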